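/- **Setting.** Let $G$ be a group, $H\le G$ a subgroup with $[H:H\cap xHx^{-1}]<\infty$ for all $x\in G$, and $\sigma:H\to\mathbb T$ a unitary character with finite range; put $K=\ker\sigma$. Such a $(G,H,\sigma)$ is a one-dimensional Hecke triple; it is reduced if $\bigcap_{x\in G}xKx^{-1}=\{e\}$. Let $G_\sigma$ be the Schlichting completion: the closure of $G$ in the group of permutations of the discrete set $G/K$ (topology of pointwise convergence), that is, the completion of $G$ in the Hecke topology of $(G,K)$. Let $H_\sigma$ be the closure of $H$ in $G_\sigma$, a compact open subgroup, and write $\sigma$ also for the continuous extension of $\sigma$ to $H_\sigma$. Let $\mu$ be the left Haar measure of $G_\sigma$ with $\mu(H_\sigma)=1$, and $\Delta$ the modular function, $\mu(Ax)=\Delta(x)\mu(A)$. The algebras $C_c(G_\sigma)\subset L^1(G_\sigma)$ carry convolution and the involution $f^*(x)=\Delta(x^{-1})\overline{f(x^{-1})}$, $C^*(G_\sigma)$ is the enveloping $C^*$-algebra of $L^1(G_\sigma)$, and $p_\sigma=\chi_{H_\sigma}\sigma$, a projection in $C_c(G_\sigma)$. The generalised Hecke algebra $\mathcal H_\sigma(G,H)$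 consists of the functions $f:G\to\mathbb C$ with $f(hxk)=\sigma(h)f(x)\sigma(k)$ ($h,k\in H$) and finite support in $H\backslash G/H$, with $f*g(x)=\sum_{yH\in G/H}f(y)g(y^{-1}x)$ and $f^*(x)=\Delta_K(x^{-1})\overline{f(x^{-1})}$, where $\Delta_K(x)=[K:K\cap xKx^{-1}]/[K:K\cap x^{-1}Kx]$. Restriction of functions to $G$ maps $p_\sigma C_c(G_\sigma)p_\sigma$ to $\mathcal H_\sigma(G,H)$. A unitary representation $\pi$ of $G$ on a Hilbert space $V$ is $(H,\sigma)$-smooth if $\pi(G)\{\xi\in V:\pi(h)\xi=\sigma(h)\xi\ \forall h\in H\}$ has dense linear span in $V$. Write $\langle f,f\rangle_R=f^*f$. A nondegenerate $*$-representation $\pi$ of $\mathcal H_\sigma(G,H)$ by bounded operators on a Hilbert space is $\langle\rangle_R$-positive if $\pi\big((f^*f)|_G\big)\ge 0$ for all $f\in C_c(G_\sigma)p_\sigma$; a nondegenerate $*$-representation $\pi$ of $p_\sigma L^1(G_\sigma)p_\sigma$ is $\langle\rangle_R$-positive if $\pi(f^*f)\ge0$ for all $f\in L^1(G_\sigma)p_\sigma$.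 In all the categories of representations below the morphisms are the bounded intertwining operators. **Theorem.** Let $(G,H,\sigma)$ be a reduced one-dimensional Hecke triple. There are equivalences of categories between (a) the unitary $(H,\sigma)$-smooth representations of $G$ and the $\langle\rangle_R$-positive representations of $\mathcal H_\sigma(G,H)$; (b) the nondegenerate $*$-representations of the ideal $\overline{C^*(G_\sigma)p_\sigma C^*(G_\sigma)}$ of $C^*(G_\sigma)$ and the $\langle\rangle_R$-positive representations of $p_\sigma L^1(G_\sigma)p_\sigma$. The equivalence in (a) can be chosen additive and compatible with adjoints of intertwining operators, and the one in (b) moreover $\mathbb C$-linear. If in (a) the $(H,\sigma)$-smooth representations are replaced by the $(H,\overline\sigma)$-smooth ones, there is likewise an equivalence that is $\mathbb C$-linear and compatible with adjoints. -/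

import Mathlib

set_option linter.unusedSectionVars false

/-! ## Completions of seminormed `*`-algebras and enveloping `C*`-algebras -/

section Completion

/-- The Hausdorff completion of a seminormed (not necessarily unital) `*`-algebra `A`. -/
def StarCompletion (A : Type*) [UniformSpace A] : Type _ := UniformSpace.Completion A

namespace StarCompletion

open UniformSpace

variable (A : Type*) [NonUnitalSeminormedRing A]

noncomputable instance : NormedAddCommGroup (StarCompletion A) :=
  inferInstanceAs (NormedAddCommGroup (Completion A))

instance : CompleteSpace (StarCompletion A) :=
  inferInstanceAs (CompleteSpace (Completion A))

noncomputable instance [NormedSpace ℂ A] : NormedSpace ℂ (StarCompletion A) :=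
  inferInstanceAs (NormedSpace ℂ (Completion A))

variable {A}

/-- The canonical map from `A` to its completion. -/
def of (a : A) : StarCompletion A := (a : Completion A)

lemma isDenseInducing_of : IsDenseInducing (of : A → StarCompletion A) :=
  Completion.isDenseInducing_coe

lemma continuous_of : Continuous (of : A → StarCompletion A) := Completion.continuous_coe A

lemma of_add (a b : A) : of (a + b) = of a + of b := Completion.coe_add a b

lemma of_zero : of (0 : A) = 0 := rfl

lemma of_smul [NormedSpace ℂ A] (c : ℂ) (a : A) : of (c • a) = c • of a := Completion.coe_smul c a

lemma norm_of (a : A) : ‖of a‖ = ‖a‖ := Completion.norm_coe a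

lemma ind {p : StarCompletion A → Prop} (hp : IsClosed {x | p x}) (h : ∀ a, p (of a)) (x) : p x :=
  Completion.induction_on x hp h

/-- The product on the completion: the continuous extension of the product of `A`. -/
noncomputable def mulExt (x y : StarCompletion A) : StarCompletion A :=
  (isDenseInducing_of.prodMap isDenseInducing_of).extend (fun p : A × A ↦ of (p.1 * p.2)) (x, y)

lemma mulExt_of (a b : A) : mulExt (of a) (of b) = of (a * b) :=
  (isDenseInducing_of.prodMap isDenseInducing_of).extend_eq
      (continuous_of.comp (continuous_mul (M := A))) (a, b)

lemma continuous_mulExt : Continuous fun p : StarCompletion A × StarCompletion A ↦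
    mulExt p.1 p.2 := by
  let m : A →+ A →+ Completion A := (AddMonoidHom.mul : A →+ A →+ A).compr₂ Completion.toCompl
  have : Continuous fun p : A × A ↦ m p.1 p.2 :=
    (Completion.continuous_coe A).comp continuous_mul
  have di : IsDenseInducing (Completion.toCompl : A → Completion A) :=
    Completion.isDenseInducing_coe
  exact (di.extend_Z_bilin di this :)

attribute [irreducible] mulExt

noncomputable instance : Mul (StarCompletion A) := ⟨mulExt⟩

lemma of_mul (a b : A) : of (a * b) = of a * of b := (mulExt_of a b).symm

instance : ContinuousMul (StarCompletion A) := ⟨continuous_mulExt⟩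

noncomputable instance : NonUnitalRing (StarCompletion A) where
  __ : AddCommGroup (StarCompletion A) := inferInstance
  __ : Mul (StarCompletion A) := inferInstance
  zero_mul := by
    refine ind (isClosed_eq (by fun_prop) continuous_const) fun a ↦ ?_
    rw [← of_zero, ← of_mul, zero_mul]
  mul_zero := by
    refine ind (isClosed_eq (by fun_prop) continuous_const) fun a ↦ ?_
    rw [← of_zero, ← of_mul, mul_zero]
  mul_assoc x y z := by
    revert x; refine ind (isClosed_eq (by fun_prop) (by fun_prop)) fun a ↦ ?_
    revert y; refine ind (isClosed_eq (by fun_prop) (by fun_prop)) fun b ↦ ?_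
    revert z; refine ind (isClosed_eq (by fun_prop) (by fun_prop)) fun c ↦ ?_
    simp only [← of_mul, mul_assoc]
  left_distrib x y z := by
    revert x; refine ind (isClosed_eq (by fun_prop) (by fun_prop)) fun a ↦ ?_
    revert y; refine ind (isClosed_eq (by fun_prop) (by fun_prop)) fun b ↦ ?_
    revert z; refine ind (isClosed_eq (by fun_prop) (by fun_prop)) fun c ↦ ?_
    simp only [← of_mul, ← of_add, mul_add]
  right_distrib x y z := by
    revert x; refine ind (isClosed_eq (by fun_prop) (by fun_prop)) fun a ↦ ?_
    revert y; refine ind (isClosed_eq (by fun_prop) (by fun_prop)) fun b ↦ ?_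
    revert z; refine ind (isClosed_eq (by fun_prop) (by fun_prop)) fun c ↦ ?_
    simp only [← of_mul, ← of_add, add_mul]

noncomputable instance : NonUnitalNormedRing (StarCompletion A) where
  __ : NormedAddCommGroup (StarCompletion A) := inferInstance
  __ : NonUnitalRing (StarCompletion A) := inferInstance
  norm_mul_le x y := by
    revert x; refine ind (isClosed_le (by fun_prop) (by fun_prop)) fun a ↦ ?_
    revert y; refine ind (isClosed_le (by fun_prop) (by fun_prop)) fun b ↦ ?_
    simpa only [← of_mul, norm_of] using norm_mul_le a b

instance [NormedSpace ℂ A] [IsScalarTower ℂ A A] : IsScalarTower ℂ (StarCompletion A)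
    (StarCompletion A) where
  smul_assoc c x y := by
    simp only [smul_eq_mul]
    have hc : Continuous fun z : StarCompletion A ↦ c • z := continuous_const_smul c
    revert x; refine ind (isClosed_eq (hc.mul continuous_const)
      (hc.comp (continuous_mul_const y))) fun a ↦ ?_
    revert y; refine ind (isClosed_eq (continuous_const_mul _)
      (hc.comp (continuous_const_mul _))) fun b ↦ ?_
    simp only [← of_mul, ← of_smul, smul_mul_assoc]

instance [NormedSpace ℂ A] [SMulCommClass ℂ A A] : SMulCommClass ℂ (StarCompletion A)
    (StarCompletion A) where
  smul_comm c x y := by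
    simp only [smul_eq_mul]
    have hc : Continuous fun z : StarCompletion A ↦ c • z := continuous_const_smul c
    revert x; refine ind (isClosed_eq (hc.comp (continuous_mul_const y))
      (continuous_mul_const _)) fun a ↦ ?_
    revert y; refine ind (isClosed_eq (hc.comp (continuous_const_mul _))
      ((continuous_const_mul _).comp hc)) fun b ↦ ?_
    simp only [← of_mul, ← of_smul, mul_smul_comm]

variable [StarRing A] [NormedStarGroup A]

/-- The involution on the completion: the continuous extension of the involution of `A`. -/
noncomputable instance : Star (StarCompletion A) := ⟨Completion.map (star : A → A)⟩

lemma continuous_star' : Continuous (star : StarCompletion A → StarCompletion A) :=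
  Completion.continuous_map

lemma of_star (a : A) : of (star a) = star (of a) :=
  (Completion.map_coe (starNormedAddGroupHom (E := A)).uniformContinuous a).symm

noncomputable instance : StarRing (StarCompletion A) where
  star_involutive := by
    refine ind (isClosed_eq (continuous_star'.comp continuous_star') continuous_id) fun a ↦ ?_
    rw [← of_star, ← of_star, star_star]
  star_mul x y := by
    have := continuous_star' (A := A)
    revert x; refine ind (isClosed_eq (by fun_prop) (by fun_prop)) fun a ↦ ?_
    revert y; refine ind (isClosed_eq (by fun_prop) (by fun_prop)) fun b ↦ ?_
    simp only [← of_mul, ← of_star, star_mul]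
  star_add x y := by
    have := continuous_star' (A := A)
    revert x; refine ind (isClosed_eq (by fun_prop) (by fun_prop)) fun a ↦ ?_
    revert y; refine ind (isClosed_eq (by fun_prop) (by fun_prop)) fun b ↦ ?_
    simp only [← of_add, ← of_star, star_add]

instance : NormedStarGroup (StarCompletion A) where
  norm_star_le x := by
    have := continuous_star' (A := A)
    revert x; refine ind (isClosed_le (by fun_prop) (by fun_prop)) fun a ↦ ?_
    rw [← of_star, norm_of, norm_of, norm_star]

instance [NormedSpace ℂ A] [StarModule ℂ A] : StarModule ℂ (StarCompletion A) where
  star_smul c x := by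
    have h := continuous_star' (A := A)
    have hc (c : ℂ) : Continuous fun z : StarCompletion A ↦ c • z := continuous_const_smul c
    revert x; refine ind (isClosed_eq (h.comp (hc _)) ((hc _).comp h)) fun a ↦ ?_
    rw [← of_star, ← of_smul, ← of_smul, ← of_star, star_smul]

lemma cstarRing (hA : ∀ a : A, ‖a‖ * ‖a‖ ≤ ‖star a * a‖) : CStarRing (StarCompletion A) where
  norm_mul_self_le x := by
    have := continuous_star' (A := A)
    revert x; refine ind (isClosed_le (by fun_prop) (by fun_prop)) fun a ↦ ?_
    rw [← of_star, ← of_mul, norm_of, norm_of]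
    exact hA a

end StarCompletion

/-- A `C*`-seminorm on a seminormed `*`-algebra `A` that is dominated by the given seminorm of `A`.
These are the functions `a ↦ ‖π a‖` for the contractive `*`-representations `π` of `A` by
operators on Hilbert spaces (every `*`-representation of a Banach `*`-algebra with isometric
involution is contractive). -/
structure CStarSeminorm (A : Type*) [NonUnitalSeminormedRing A] [NormedSpace ℂ A] [StarRing A]
    extends Seminorm ℂ A where
  mul_le' : ∀ a b, toFun (a * b) ≤ toFun a * toFun b
  star_mul_self' : ∀ a, toFun (star a * a) = toFun a * toFun a
  le_norm' : ∀ a, toFun a ≤ ‖a‖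

variable (A : Type*) [NonUnitalSeminormedRing A] [NormedSpace ℂ A] [StarRing A]

/-- A copy of `A`, to carry the largest `C*`-seminorm dominated by the norm. -/
def WithCStarNorm : Type _ := A

namespace WithCStarNorm

instance : NonUnitalRing (WithCStarNorm A) := inferInstanceAs (NonUnitalRing A)
instance : StarRing (WithCStarNorm A) := inferInstanceAs (StarRing A)
instance : Module ℂ (WithCStarNorm A) := inferInstanceAs (Module ℂ A)
instance [IsScalarTower ℂ A A] : IsScalarTower ℂ (WithCStarNorm A) (WithCStarNorm A) :=
  inferInstanceAs (IsScalarTower ℂ A A)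
instance [SMulCommClass ℂ A A] : SMulCommClass ℂ (WithCStarNorm A) (WithCStarNorm A) :=
  inferInstanceAs (SMulCommClass ℂ A A)
instance [StarModule ℂ A] : StarModule ℂ (WithCStarNorm A) :=
  inferInstanceAs (StarModule ℂ A)

variable {A}

instance : Nonempty (CStarSeminorm A) :=
  ⟨{ (0 : Seminorm ℂ A) with
      mul_le' := fun a b ↦ show (0 : ℝ) ≤ 0 * 0 by simp
      star_mul_self' := fun a ↦ show (0 : ℝ) = 0 * 0 by simp
      le_norm' := fun a ↦ norm_nonneg a }⟩

/-- The largest `C*`-seminorm on `A` that is dominated by the norm of `A`. -/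
noncomputable def maxNorm (a : A) : ℝ := ⨆ q : CStarSeminorm A, q.toFun a

lemma bddAbove (a : A) : BddAbove (Set.range fun q : CStarSeminorm A ↦ q.toFun a) :=
  ⟨‖a‖, by rintro _ ⟨q, rfl⟩; exact q.le_norm' a⟩

lemma le_maxNorm (q : CStarSeminorm A) (a : A) : q.toFun a ≤ maxNorm a :=
  le_ciSup (bddAbove a) q

lemma maxNorm_le {a : A} {c : ℝ} (h : ∀ q : CStarSeminorm A, q.toFun a ≤ c) : maxNorm a ≤ c :=
  ciSup_le h

lemma CStarSeminorm_nonneg (q : CStarSeminorm A) (a : A) : 0 ≤ q.toFun a :=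
  apply_nonneg q.toSeminorm a

lemma maxNorm_nonneg (a : A) : 0 ≤ maxNorm a :=
  Real.iSup_nonneg fun q ↦ CStarSeminorm_nonneg q a

lemma maxNorm_mul_le (a b : A) : maxNorm (a * b) ≤ maxNorm a * maxNorm b :=
  maxNorm_le fun q ↦ (q.mul_le' a b).trans <|
    mul_le_mul (le_maxNorm q a) (le_maxNorm q b) (CStarSeminorm_nonneg q b) (maxNorm_nonneg a)

lemma maxNorm_mul_self_le (a : A) : maxNorm a * maxNorm a ≤ maxNorm (star a * a) := by
  have h : maxNorm a ≤ √(maxNorm (star a * a)) := maxNorm_le fun q ↦ by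
    refine Real.le_sqrt_of_sq_le ?_
    rw [sq, ← q.star_mul_self']
    exact le_maxNorm q _
  calc maxNorm a * maxNorm a ≤ √(maxNorm (star a * a)) * √(maxNorm (star a * a)) :=
        mul_self_le_mul_self (maxNorm_nonneg a) h
    _ = _ := Real.mul_self_sqrt (maxNorm_nonneg _)

lemma maxNorm_le_norm (a : A) : maxNorm a ≤ ‖a‖ := maxNorm_le fun q ↦ q.le_norm' a

lemma maxNorm_star_le (a : A) : maxNorm (star a) ≤ maxNorm a := by
  refine maxNorm_le fun q ↦ le_trans ?_ (le_maxNorm q a)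
  have h1 := q.star_mul_self' (star a)
  have h2 := q.mul_le' (star (star a)) (star a)
  rw [star_star] at h1 h2
  rw [h1] at h2
  rcases (CStarSeminorm_nonneg q (star a)).eq_or_lt with h | h
  · rw [← h]; exact CStarSeminorm_nonneg q a
  · exact le_of_mul_le_mul_right h2 h

variable (A)

noncomputable instance : Norm (WithCStarNorm A) := ⟨maxNorm (A := A)⟩

lemma core : SeminormedSpace.Core ℂ (WithCStarNorm A) where
  norm_nonneg := maxNorm_nonneg (A := A)
  norm_smul c a := by
    change (⨆ q : CStarSeminorm A, q.toFun ((c • a : A))) = ‖c‖ * ⨆ q : CStarSeminorm A, q.toFun a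
    rw [Real.mul_iSup_of_nonneg (norm_nonneg c)]
    exact congrArg iSup (funext fun q ↦ q.smul' c a)
  norm_triangle a b := maxNorm_le (A := A) fun q ↦ (q.add_le' a b).trans <|
    add_le_add (le_maxNorm q a) (le_maxNorm q b)

noncomputable instance : SeminormedAddCommGroup (WithCStarNorm A) :=
  SeminormedAddCommGroup.ofCore (core A)

noncomputable instance : NormedSpace ℂ (WithCStarNorm A) :=
  { (inferInstance : Module ℂ (WithCStarNorm A)) with
    norm_smul_le := fun c a ↦ ((core A).norm_smul c a).le }

noncomputable instance : NonUnitalSeminormedRing (WithCStarNorm A) :=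
  { (inferInstance : SeminormedAddCommGroup (WithCStarNorm A)),
    (inferInstance : NonUnitalRing (WithCStarNorm A)) with
    norm_mul_le := maxNorm_mul_le (A := A) }

instance : NormedStarGroup (WithCStarNorm A) := ⟨maxNorm_star_le (A := A)⟩

end WithCStarNorm

/-- The enveloping `C*`-algebra of a seminormed `*`-algebra `A`: the Hausdorff completion of `A`
in the largest `C*`-seminorm dominated by the norm of `A`. -/
abbrev CStarEnvelope : Type _ := StarCompletion (WithCStarNorm A)

variable {A} in
/-- The canonical map from `A` to its enveloping `C*`-algebra. -/
noncomputable def toCStarEnvelope (a : A) : CStarEnvelope A :=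
  StarCompletion.of (show WithCStarNorm A from a)

instance : CStarRing (CStarEnvelope A) :=
  StarCompletion.cstarRing (WithCStarNorm.maxNorm_mul_self_le (A := A))

lemma star_toCStarEnvelope (a : A) : star (toCStarEnvelope a) = toCStarEnvelope (star a) :=
  (StarCompletion.of_star (A := WithCStarNorm A) a).symm

noncomputable instance [IsScalarTower ℂ A A] [SMulCommClass ℂ A A] [StarModule ℂ A] :
    NonUnitalCStarAlgebra (CStarEnvelope A) where

end Completion
/-! ## The convolution algebra, `L¹` and `C*`-algebra of a locally compact group -/

section GroupAlgebra

open MeasureTheory Measure Set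
open scoped Pointwise ComplexConjugate

/-- The space of compactly supported continuous complex functions on `L`. It carries the
convolution product, the involution and the `L¹`-norm given by the left Haar measure `μ`
(and not the pointwise product of functions). -/
structure ConvAlg {L : Type*} [TopologicalSpace L] [MeasurableSpace L] (μ : Measure L) where
  /-- the underlying function -/
  toFun : L → ℂ
  continuous' : Continuous toFun
  compact' : HasCompactSupport toFun

namespace ConvAlg

section Basic

variable {L : Type*} [TopologicalSpace L] [MeasurableSpace L] {μ : Measure L}

instance : CoeFun (ConvAlg μ) (fun _ ↦ L → ℂ) := ⟨toFun⟩

@[ext] lemma ext {f g : ConvAlg μ} (h : ∀ x, f x = g x) : f = g := by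
  cases f; cases g; congr; exact funext h

instance : Zero (ConvAlg μ) := ⟨⟨fun _ ↦ 0, continuous_const, HasCompactSupport.zero⟩⟩
instance : Add (ConvAlg μ) :=
  ⟨fun f g ↦ ⟨fun x ↦ f x + g x, f.continuous'.add g.continuous', f.compact'.add g.compact'⟩⟩
instance : Neg (ConvAlg μ) :=
  ⟨fun f ↦ ⟨fun x ↦ -f x, f.continuous'.neg, f.compact'.neg⟩⟩
instance : Sub (ConvAlg μ) :=
  ⟨fun f g ↦ ⟨fun x ↦ f x - g x, f.continuous'.sub g.continuous', f.compact'.sub g.compact'⟩⟩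
instance {R : Type*} [Monoid R] [DistribMulAction R ℂ] [ContinuousConstSMul R ℂ] :
    SMul R (ConvAlg μ) :=
  ⟨fun c f ↦ ⟨fun x ↦ c • f x, f.continuous'.const_smul c,
    f.compact'.mono' ((Function.support_const_smul_subset c f).trans subset_closure)⟩⟩

@[simp] lemma add_apply (f g : ConvAlg μ) (x : L) : (f + g) x = f x + g x := rfl
@[simp] lemma zero_apply (x : L) : (0 : ConvAlg μ) x = 0 := rfl
@[simp] lemma smul_apply (c : ℂ) (f : ConvAlg μ) (x : L) : (c • f) x = c * f x := rfl

instance : AddCommGroup (ConvAlg μ) :=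
  Function.Injective.addCommGroup toFun (fun _ _ h ↦ ext (congrFun h)) rfl (fun _ _ ↦ rfl)
    (fun _ ↦ rfl) (fun _ _ ↦ rfl) (fun _ _ ↦ rfl) (fun _ _ ↦ rfl)

instance : Module ℂ (ConvAlg μ) :=
  Function.Injective.module ℂ ⟨⟨toFun, rfl⟩, fun _ _ ↦ rfl⟩ (fun _ _ h ↦ ext (congrFun h))
    (fun _ _ ↦ rfl)

/-- The `L¹`-norm. -/
noncomputable instance : Norm (ConvAlg μ) := ⟨fun f ↦ ∫ x, ‖f x‖ ∂μ⟩

lemma norm_def (f : ConvAlg μ) : ‖f‖ = ∫ x, ‖f x‖ ∂μ := rfl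

variable [OpensMeasurableSpace L] [IsFiniteMeasureOnCompacts μ]

lemma integrable (f : ConvAlg μ) : Integrable f μ :=
  f.continuous'.integrable_of_hasCompactSupport f.compact'

variable (μ) in
lemma core : SeminormedSpace.Core ℂ (ConvAlg μ) where
  norm_nonneg f := integral_nonneg fun _ ↦ norm_nonneg _
  norm_smul c f := by simp [norm_def, integral_const_mul]
  norm_triangle f g := by
    simp only [norm_def]
    rw [← integral_add f.integrable.norm g.integrable.norm]
    exact integral_mono (f + g).integrable.norm (f.integrable.norm.add g.integrable.norm)
      fun x ↦ norm_add_le _ _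

noncomputable instance : SeminormedAddCommGroup (ConvAlg μ) :=
  SeminormedAddCommGroup.ofCore (core μ)

noncomputable instance : NormedSpace ℂ (ConvAlg μ) :=
  { (inferInstance : Module ℂ (ConvAlg μ)) with
    norm_smul_le := fun c a ↦ ((core μ).norm_smul c a).le }

end Basic

variable {L : Type*} [Group L] [TopologicalSpace L] [IsTopologicalGroup L]
  [MeasurableSpace L] [BorelSpace L] {μ : Measure L}

section Convolution

variable {E : Type*} [RCLike E]

lemma continuous_conv [LocallyCompactSpace L] [IsFiniteMeasureOnCompacts μ] {f g : L → E}
    (hf : Continuous f) (hf' : HasCompactSupport f) (hg : Continuous g) :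
    Continuous fun x ↦ ∫ y, f y * g (y⁻¹ * x) ∂μ := by
  rw [← continuousOn_univ]
  refine continuousOn_integral_of_compact_support (k := tsupport f) hf' ?_ ?_
  · exact Continuous.continuousOn (by fun_prop)
  · intro x y _ hy
    rw [image_eq_zero_of_notMem_tsupport hy, zero_mul]

lemma hasCompactSupport_conv {f g : L → E} (hf : HasCompactSupport f) (hg : HasCompactSupport g) :
    HasCompactSupport fun x ↦ ∫ y, f y * g (y⁻¹ * x) ∂μ := by
  refine HasCompactSupport.intro (K := tsupport f * tsupport g) (hf.isCompact.mul hg.isCompact) ?_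
  intro x hx
  refine integral_eq_zero_of_ae (Filter.Eventually.of_forall fun y ↦ ?_)
  by_contra h
  refine hx ⟨y, subset_tsupport _ (left_ne_zero_of_mul h), y⁻¹ * x,
    subset_tsupport _ (right_ne_zero_of_mul h), by simp⟩

lemma hasCompactSupport_kernel {f g : L → E} (hf : HasCompactSupport f)
    (hg : HasCompactSupport g) :
    HasCompactSupport (fun p : L × L ↦ f p.2 * g (p.2⁻¹ * p.1)) := by
  refine HasCompactSupport.intro (K := (tsupport f * tsupport g) ×ˢ tsupport f)
    ((hf.isCompact.mul hg.isCompact).prod hf.isCompact) ?_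
  rintro ⟨x, y⟩ hx
  by_contra h
  have hy := subset_tsupport _ (left_ne_zero_of_mul h)
  exact hx ⟨⟨y, hy, y⁻¹ * x, subset_tsupport _ (right_ne_zero_of_mul h), by simp⟩, hy⟩

end Convolution

variable [LocallyCompactSpace L] [IsHaarMeasure μ]

/-- The convolution product `(f * g)(x) = ∫ f(y) g(y⁻¹x) dμ(y)`. -/
noncomputable instance : Mul (ConvAlg μ) :=
  ⟨fun f g ↦ ⟨fun x ↦ ∫ y, f y * g (y⁻¹ * x) ∂μ,
    continuous_conv f.continuous' f.compact' g.continuous',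
    hasCompactSupport_conv f.compact' g.compact'⟩⟩

lemma mul_apply (f g : ConvAlg μ) (x : L) : (f * g) x = ∫ y, f y * g (y⁻¹ * x) ∂μ := rfl

lemma integrable_kernel (f g : ConvAlg μ) (x : L) :
    Integrable (fun y ↦ f y * g (y⁻¹ * x)) μ := by
  refine Continuous.integrable_of_hasCompactSupport ?_ f.compact'.mul_right
  exact f.continuous'.mul (g.continuous'.comp (by fun_prop))

noncomputable instance : NonUnitalRing (ConvAlg μ) where
  __ : AddCommGroup (ConvAlg μ) := inferInstance
  __ : Mul (ConvAlg μ) := inferInstance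
  zero_mul f := by ext x; simp [mul_apply]
  mul_zero f := by ext x; simp [mul_apply]
  left_distrib f g h := by
    ext x
    simp only [mul_apply, add_apply, mul_add]
    exact integral_add (integrable_kernel f g x) (integrable_kernel f h x)
  right_distrib f g h := by
    ext x
    simp only [mul_apply, add_apply, add_mul]
    exact integral_add (integrable_kernel f h x) (integrable_kernel g h x)
  mul_assoc f g h := by
    ext x
    simp only [mul_apply, ← integral_mul_const, ← integral_const_mul]
    rw [integral_integral_swap_of_hasCompactSupport]
    · congr 1 with z
      rw [← integral_mul_left_eq_self _ z]
      simp only [mul_inv_rev, mul_assoc, inv_mul_cancel_left]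
    · have := f.continuous'; have := g.continuous'; have := h.continuous'
      fun_prop
    · refine HasCompactSupport.mono (f := fun p : L × L ↦ f p.2 * g (p.2⁻¹ * p.1))
        (hasCompactSupport_kernel f.compact' g.compact') ?_
      intro p hp
      exact left_ne_zero_of_mul hp

lemma integral_norm_conv_le {f g : L → ℂ} (hf : Continuous f) (hf' : HasCompactSupport f)
    (hg : Continuous g) (hg' : HasCompactSupport g) :
    ∫ x, ‖∫ y, f y * g (y⁻¹ * x) ∂μ‖ ∂μ ≤ (∫ x, ‖f x‖ ∂μ) * ∫ x, ‖g x‖ ∂μ := by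
  have h1 : Integrable (fun x ↦ ∫ y, ‖f y‖ * ‖g (y⁻¹ * x)‖ ∂μ) μ :=
    (continuous_conv (f := fun y ↦ ‖f y‖) (g := fun y ↦ ‖g y‖) hf.norm hf'.norm
      hg.norm).integrable_of_hasCompactSupport
      (hasCompactSupport_conv (f := fun y ↦ ‖f y‖) (g := fun y ↦ ‖g y‖) hf'.norm hg'.norm)
  have h2 : Integrable (fun x ↦ ∫ y, f y * g (y⁻¹ * x) ∂μ) μ :=
    (continuous_conv hf hf' hg).integrable_of_hasCompactSupport (hasCompactSupport_conv hf' hg')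
  have h3 : ∀ x, ‖∫ y, f y * g (y⁻¹ * x) ∂μ‖ ≤ ∫ y, ‖f y‖ * ‖g (y⁻¹ * x)‖ ∂μ := fun x ↦ by
    refine (norm_integral_le_integral_norm _).trans_eq ?_
    simp only [norm_mul]
  refine le_trans (integral_mono h2.norm h1 h3) (le_of_eq ?_)
  have h4 : Continuous (Function.uncurry fun x y ↦ ‖f y‖ * ‖g (y⁻¹ * x)‖) := by
    simp only [Function.uncurry_def]; fun_prop
  rw [integral_integral_swap_of_hasCompactSupport h4
      (hasCompactSupport_kernel (f := fun y ↦ ‖f y‖) (g := fun y ↦ ‖g y‖) hf'.norm hg'.norm),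
    ← integral_mul_const]
  congr 1 with y
  rw [integral_const_mul, integral_mul_left_eq_self (fun x ↦ ‖g x‖)]

lemma norm_mul_le' (f g : ConvAlg μ) : ‖f * g‖ ≤ ‖f‖ * ‖g‖ :=
  integral_norm_conv_le f.continuous' f.compact' g.continuous' g.compact'

noncomputable instance : NonUnitalSeminormedRing (ConvAlg μ) :=
  { (inferInstance : SeminormedAddCommGroup (ConvAlg μ)),
    (inferInstance : NonUnitalRing (ConvAlg μ)) with
    norm_mul_le := norm_mul_le' }

instance : IsScalarTower ℂ (ConvAlg μ) (ConvAlg μ) where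
  smul_assoc c f g := by
    ext x
    simp [mul_apply, mul_assoc, integral_const_mul]

instance : SMulCommClass ℂ (ConvAlg μ) (ConvAlg μ) where
  smul_comm c f g := by
    ext x
    simp [mul_apply, mul_left_comm, integral_const_mul]

/-! ### The involution -/

/-- The modular function `Δ` of `L`, normalised by `μ (A x) = Δ(x) μ(A)` for a left Haar
measure `μ`. (Mathlib's modular character is normalised by `μ (A x⁻¹) = Δ'(x) μ(A)`.) -/
noncomputable def modularFun (x : L) : ℝ := (modularCharacter x⁻¹ : NNReal)

lemma modularFun_mul (x y : L) : modularFun (x * y) = modularFun x * modularFun y := by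
  simp [modularFun, mul_comm]

lemma modularFun_one : modularFun (1 : L) = 1 := by simp [modularFun]

lemma modularFun_pos (x : L) : 0 < modularFun x := modularCharacterFun_pos _

lemma modularFun_inv_mul (x : L) : modularFun x⁻¹ * modularFun x = 1 := by
  rw [← modularFun_mul, inv_mul_cancel, modularFun_one]

lemma integral_mul_right {f : L → ℝ} (hf : Continuous f) (hf' : HasCompactSupport f) (z : L) :
    ∫ x, f (x * z) ∂μ = modularFun z⁻¹ * ∫ x, f x ∂μ := by
  have h1 : ∫ x, f x ∂(map (· * z) μ) = ∫ x, f (x * z) ∂μ :=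
    integral_map (by fun_prop) hf.aestronglyMeasurable
  rw [← h1, integral_isMulLeftInvariant_eq_smul_of_hasCompactSupport _ μ hf hf',
    integral_smul_nnreal_measure, modularFun, inv_inv]
  change _ = (modularCharacterFun z : ℝ) * _
  rw [modularCharacterFun_eq_haarScalarFactor μ]
  rfl

variable (μ) in
lemma exists_bump : ∃ f : L → ℝ, Continuous f ∧ HasCompactSupport f ∧ 0 < ∫ x, f x ∂μ := by
  obtain ⟨⟨f, f_cont⟩, f_comp, f_nonneg, f_one⟩ :
    ∃ f : C(L, ℝ), HasCompactSupport f ∧ 0 ≤ f ∧ f 1 ≠ 0 := exists_continuous_nonneg_pos 1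
  exact ⟨f, f_cont, f_comp,
    f_cont.integral_pos_of_hasCompactSupport_nonneg_nonzero f_comp f_nonneg f_one⟩

lemma continuous_modularFun : Continuous (modularFun : L → ℝ) := by
  obtain ⟨f, hf, hf', h0⟩ := exists_bump (haar : Measure L)
  have h1 : Continuous fun z : L ↦ ∫ x, f (x * z) ∂(haar : Measure L) := by
    refine continuous_iff_continuousAt.2 fun z₀ ↦ ?_
    obtain ⟨t, t_comp, ht⟩ := exists_compact_mem_nhds z₀
    refine ContinuousOn.continuousAt (s := t) ?_ ht
    refine continuousOn_integral_of_compact_support (k := tsupport f * t⁻¹)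
      (hf'.isCompact.mul t_comp.inv) (Continuous.continuousOn (by fun_prop)) ?_
    intro z x hz hx
    by_contra h
    exact hx ⟨x * z, subset_tsupport _ h, z⁻¹, by simpa using hz, by simp⟩
  have h2 : (modularFun : L → ℝ) =
      fun z ↦ (∫ x, f (x * z⁻¹) ∂(haar : Measure L)) / ∫ x, f x ∂(haar : Measure L) := by
    ext z
    rw [integral_mul_right hf hf', inv_inv, mul_div_cancel_right₀ _ h0.ne']
  rw [h2]
  exact (h1.comp continuous_inv).div_const _

/-- The inversion formula `∫ Δ(x⁻¹) f(x⁻¹) dμ(x) = ∫ f dμ`. -/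
lemma integral_modularFun_inv {f : L → ℝ} (hf : Continuous f) (hf' : HasCompactSupport f) :
    ∫ x, modularFun x⁻¹ * f x⁻¹ ∂μ = ∫ x, f x ∂μ := by
  obtain ⟨g, hg, hg', h0⟩ := exists_bump μ
  refine mul_left_cancel₀ h0.ne' ?_
  have e1 : ∀ y, (∫ x, g x ∂μ) * (modularFun y⁻¹ * f y⁻¹) = ∫ x, g (x * y) * f y⁻¹ ∂μ := by
    intro y
    rw [integral_mul_const, integral_mul_right hg hg']
    ring
  have c1 : HasCompactSupport (Function.uncurry fun y x ↦ g (x * y) * f y⁻¹) := by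
    refine HasCompactSupport.intro (K := (tsupport f)⁻¹ ×ˢ (tsupport g * tsupport f))
      (hf'.isCompact.inv.prod (hg'.isCompact.mul hf'.isCompact)) ?_
    rintro ⟨y, x⟩ h
    by_contra h'
    have hy := subset_tsupport _ (right_ne_zero_of_mul h')
    exact h ⟨by simpa using hy, x * y, subset_tsupport _ (left_ne_zero_of_mul h'), y⁻¹, hy,
      by simp⟩
  have c2 : HasCompactSupport (Function.uncurry fun x y ↦ g y * f (y⁻¹ * x)) :=
    hasCompactSupport_kernel hg' hf'
  calc (∫ x, g x ∂μ) * ∫ x, modularFun x⁻¹ * f x⁻¹ ∂μ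
      = ∫ y, ∫ x, g (x * y) * f y⁻¹ ∂μ ∂μ := by
        rw [← integral_const_mul]; simp only [e1]
    _ = ∫ x, ∫ y, g (x * y) * f y⁻¹ ∂μ ∂μ :=
        integral_integral_swap_of_hasCompactSupport
          (by simp only [Function.uncurry_def]; fun_prop) c1
    _ = ∫ x, ∫ y, g y * f (y⁻¹ * x) ∂μ ∂μ := by
        congr 1 with x
        rw [← integral_mul_left_eq_self (fun y ↦ g y * f (y⁻¹ * x)) x]
        simp
    _ = ∫ y, ∫ x, g y * f (y⁻¹ * x) ∂μ ∂μ :=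
        integral_integral_swap_of_hasCompactSupport
          (by simp only [Function.uncurry_def]; fun_prop) c2
    _ = (∫ x, g x ∂μ) * ∫ x, f x ∂μ := by
        rw [← integral_mul_const]
        congr 1 with y
        rw [integral_const_mul, integral_mul_left_eq_self f]

/-- The involution `f*(x) = Δ(x⁻¹) conj (f(x⁻¹))`. -/
noncomputable instance : Star (ConvAlg μ) :=
  ⟨fun f ↦ ⟨fun x ↦ (modularFun x⁻¹ : ℂ) * conj (f x⁻¹), by
    have := f.continuous'; have := continuous_modularFun (L := L); fun_prop, by
    refine HasCompactSupport.intro (K := (tsupport f)⁻¹) f.compact'.isCompact.inv ?_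
    intro x hx
    have : f x⁻¹ = 0 := image_eq_zero_of_notMem_tsupport (by simpa using hx)
    rw [this]; simp⟩⟩

lemma star_apply (f : ConvAlg μ) (x : L) :
    (star f) x = (modularFun x⁻¹ : ℂ) * conj (f x⁻¹) := rfl

noncomputable instance : StarRing (ConvAlg μ) where
  star_involutive f := by
    ext x
    rw [star_apply, star_apply, map_mul, inv_inv, Complex.conj_ofReal, Complex.conj_conj,
      ← mul_assoc, ← Complex.ofReal_mul, modularFun_inv_mul, Complex.ofReal_one, one_mul]
  star_mul f g := by
    ext x
    simp only [star_apply, mul_apply, ← integral_conj, ← integral_const_mul]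
    rw [← integral_mul_left_eq_self _ x⁻¹]
    congr 1 with y
    have h : (modularFun x⁻¹ : ℂ) = modularFun (y⁻¹ * x)⁻¹ * modularFun y⁻¹ := by
      rw [← Complex.ofReal_mul, ← modularFun_mul]; simp
    rw [h, map_mul]
    simp only [mul_inv_rev, inv_inv, mul_inv_cancel_right]
    ring
  star_add f g := by
    ext x
    simp [star_apply, mul_add]

instance : StarModule ℂ (ConvAlg μ) where
  star_smul c f := by
    ext x
    simp [star_apply, mul_left_comm]

instance : NormedStarGroup (ConvAlg μ) where
  norm_star_le f := by
    refine le_of_eq ?_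
    simp only [norm_def, star_apply, norm_mul, Complex.norm_real, RCLike.norm_conj,
      Real.norm_of_nonneg (modularFun_pos _).le]
    exact integral_modularFun_inv f.continuous'.norm f.compact'.norm

end ConvAlg

variable {L : Type*} [Group L] [TopologicalSpace L] [IsTopologicalGroup L]
  [LocallyCompactSpace L] [MeasurableSpace L] [BorelSpace L]

/-- The Banach `*`-algebra `L¹(L)`, as the completion of `C_c(L)` in the `L¹`-norm. -/
abbrev GroupL1 (μ : Measure L) [IsHaarMeasure μ] : Type _ := StarCompletion (ConvAlg μ)

/-- The group `C*`-algebra `C*(L)`: the enveloping `C*`-algebra of `L¹(L)`. -/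
abbrev GroupCStar (μ : Measure L) [IsHaarMeasure μ] : Type _ := CStarEnvelope (GroupL1 μ)

end GroupAlgebra
/-! ## Corners and ideals -/

section Corners

/-- The corner `pAp` of a `*`-algebra `A`, for a self-adjoint element `p`. -/
def starCorner {A : Type*} [NonUnitalRing A] [StarRing A] [Module ℂ A] [IsScalarTower ℂ A A]
    [SMulCommClass ℂ A A] (p : A) (hp : star p = p) : NonUnitalStarSubalgebra ℂ A where
  carrier := {x | ∃ a, x = p * a * p}
  add_mem' := by
    rintro _ _ ⟨a, rfl⟩ ⟨b, rfl⟩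
    exact ⟨a + b, by rw [mul_add, add_mul]⟩
  zero_mem' := ⟨0, by simp⟩
  mul_mem' := by
    rintro _ _ ⟨a, rfl⟩ ⟨b, rfl⟩
    exact ⟨a * p * p * b, by simp only [mul_assoc]⟩
  smul_mem' := by
    rintro c _ ⟨a, rfl⟩
    exact ⟨c • a, by rw [mul_smul_comm, smul_mul_assoc]⟩
  star_mem' := by
    rintro _ ⟨a, rfl⟩
    exact ⟨star a, by simp only [star_mul, hp, mul_assoc]⟩

/-- For an element `f = ap` of the bimodule `Ap`, the value `⟨f, f⟩_R = f* f` in `pAp` of the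
right inner product `⟨f, g⟩_R = f* g`. -/
def rightInnerSelf {A : Type*} [NonUnitalRing A] [StarRing A] [Module ℂ A] [IsScalarTower ℂ A A]
    [SMulCommClass ℂ A A] (p : A) (hp : star p = p) (a : A) : starCorner p hp :=
  ⟨star (a * p) * (a * p), star a * a, by simp only [star_mul, hp, mul_assoc]⟩

/-- The closed two-sided ideal of a `C*`-algebra `A` generated by the set `ApA`, for a self-adjoint
element `p`: the closed linear span of the products `apb`. -/
def closedIdeal {A : Type*} [NonUnitalCStarAlgebra A] (p : A) (hp : star p = p) :
    NonUnitalStarSubalgebra ℂ A where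
  carrier := closure (Submodule.span ℂ {x | ∃ a b, x = a * p * b} : Set A)
  add_mem' {x y} hx hy :=
    (Submodule.span ℂ {x | ∃ a b, x = a * p * b}).topologicalClosure.add_mem hx hy
  zero_mem' := (Submodule.span ℂ {x | ∃ a b, x = a * p * b}).topologicalClosure.zero_mem
  mul_mem' := by
    intro x y hx _
    refine map_mem_closure (f := fun z ↦ z * y) (continuous_mul_const y) hx fun z hz ↦ ?_
    induction hz using Submodule.span_induction with
    | mem z hz =>
      obtain ⟨a, b, rfl⟩ := hz
      exact Submodule.subset_span ⟨a, b * y, by simp only [mul_assoc]⟩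
    | zero => simp
    | add u v _ _ hu hv => simp only [add_mul]; exact Submodule.add_mem _ hu hv
    | smul c u _ hu => simp only [smul_mul_assoc]; exact Submodule.smul_mem _ c hu
  smul_mem' c x hx :=
    (Submodule.span ℂ {x | ∃ a b, x = a * p * b}).topologicalClosure.smul_mem c hx
  star_mem' {x} hx := by
    refine map_mem_closure continuous_star hx fun z hz ↦ ?_
    induction hz using Submodule.span_induction with
    | mem z hz =>
      obtain ⟨a, b, rfl⟩ := hz
      exact Submodule.subset_span ⟨star b, star a, by simp only [star_mul, hp, mul_assoc]⟩
    | zero => simp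
    | add u v _ _ hu hv => rw [star_add]; exact Submodule.add_mem _ hu hv
    | smul c u _ hu => rw [star_smul]; exact Submodule.smul_mem _ _ hu

end Corners

/-! ## Categories of representations on Hilbert spaces -/

section Representations

open CategoryTheory

universe w v u

/-- A complex Hilbert space together with a family of bounded operators indexed by `ι`. Unitary
representations of a group and `*`-representations of a `*`-algebra are such families. -/
structure HilbRep (ι : Type u) : Type (max u (w + 1)) where
  /-- the Hilbert space -/
  V : Type w
  [normedAddCommGroup : NormedAddCommGroup V]
  [innerProductSpace : InnerProductSpace ℂ V]
  [completeSpace : CompleteSpace V]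
  /-- the operators -/
  act : ι → V →L[ℂ] V

attribute [instance] HilbRep.normedAddCommGroup HilbRep.innerProductSpace HilbRep.completeSpace

namespace HilbRep

variable {ι : Type u}

/-- The bounded operators intertwining two families. -/
def intertwiners (R S : HilbRep.{w} ι) : Submodule ℂ (R.V →L[ℂ] S.V) where
  carrier := {T | ∀ i ξ, T (R.act i ξ) = S.act i (T ξ)}
  add_mem' {T U} hT hU i ξ := by simp [hT i ξ, hU i ξ]
  zero_mem' i ξ := by simp
  smul_mem' c T hT i ξ := by simp [hT i ξ]

/-- The morphisms are the bounded intertwining operators. -/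
instance : Category.{w} (HilbRep.{w} ι) where
  Hom R S := intertwiners R S
  id R := ⟨.id ℂ R.V, fun _ _ ↦ rfl⟩
  comp S T := ⟨T.1.comp S.1, fun i ξ ↦ by simp [S.2 i ξ, T.2 i (S.1 ξ)]⟩

/-- The bounded operator underlying a morphism. -/
def toCLM {R S : HilbRep.{w} ι} (f : R ⟶ S) : R.V →L[ℂ] S.V := f.1

instance : Preadditive (HilbRep.{w} ι) where
  homGroup R S := inferInstanceAs (AddCommGroup (intertwiners R S))
  add_comp _ _ _ f f' g := Subtype.ext (ContinuousLinearMap.comp_add g.1 f.1 f'.1)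
  comp_add _ _ _ f g g' := Subtype.ext (ContinuousLinearMap.add_comp g.1 g'.1 f.1)

instance : Linear ℂ (HilbRep.{w} ι) where
  homModule R S := inferInstanceAs (Module ℂ (intertwiners R S))
  smul_comp _ _ _ c f g := Subtype.ext (ContinuousLinearMap.comp_smul g.1 c f.1)
  comp_smul _ _ _ f c g := Subtype.ext (ContinuousLinearMap.smul_comp c g.1 f.1)

/-- A functor between categories of representations that is compatible with adjoints of
intertwining operators: `F(T*) = F(T)*`. -/
def PreservesAdjoints {κ : Type v} {P : ObjectProperty (HilbRep.{w} ι)}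
    {Q : ObjectProperty (HilbRep.{w} κ)} (F : P.FullSubcategory ⥤ Q.FullSubcategory) : Prop :=
  ∀ (R S : P.FullSubcategory) (T : R ⟶ S) (T' : S ⟶ R),
    toCLM T'.hom = (toCLM T.hom).adjoint →
      toCLM (F.map T').hom = (toCLM (F.map T).hom).adjoint

/-- The family of operators is a unitary representation of the (discrete) group `G`. -/
def IsUnitaryRep {G : Type u} [Group G] (R : HilbRep.{w} G) : Prop :=
  R.act 1 = 1 ∧ (∀ x y, R.act (x * y) = R.act x * R.act y) ∧ ∀ x, R.act x ∈ unitary (R.V →L[ℂ] R.V)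

/-- The space of vectors `ξ` with `π(h) ξ = σ(h) ξ` for all `h ∈ H`. -/
def isotypic {G : Type u} [Group G] {H : Subgroup G} (σ : H →* Circle) (R : HilbRep.{w} G) :
    Set R.V :=
  {ξ | ∀ h : H, R.act h ξ = (σ h : ℂ) • ξ}

/-- The unitary `(H, σ)`-smooth representations: the closed linear span of `π(G) V_{H,π}` is the
whole space. -/
def IsUnitarySmooth {G : Type u} [Group G] {H : Subgroup G} (σ : H →* Circle) :
    ObjectProperty (HilbRep.{w} G) := fun R ↦
  R.IsUnitaryRep ∧
    (Submodule.span ℂ {v | ∃ x, ∃ ξ ∈ R.isotypic σ, v = R.act x ξ}).topologicalClosure = ⊤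

/-- The family of operators is a nondegenerate `*`-representation of the `*`-algebra `A`. -/
def IsNondegStarRep (A : Type u) [Add A] [Mul A] [Star A] [SMul ℂ A] :
    ObjectProperty (HilbRep.{w} A) := fun R ↦
  (∀ a b, R.act (a + b) = R.act a + R.act b) ∧ (∀ (c : ℂ) a, R.act (c • a) = c • R.act a) ∧
    (∀ a b, R.act (a * b) = R.act a * R.act b) ∧ (∀ a, R.act (star a) = star (R.act a)) ∧
    (Submodule.span ℂ {v | ∃ a ξ, v = R.act a ξ}).topologicalClosure = ⊤

end HilbRep

end Representations
/-! ## Hecke triples and their Schlichting completions -/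

section Permutations

open Topology

/-- The group of permutations of a discrete set `X`, with the topology of pointwise convergence
of permutations and of their inverses. (For a discrete `X` the second follows from the first.) -/
def PermTop (X : Type*) : Type _ := Equiv.Perm X

namespace PermTop

variable {X : Type*}

instance : Group (PermTop X) := inferInstanceAs (Group (Equiv.Perm X))

/-- The image of a point under a permutation. -/
def app (e : PermTop X) (x : X) : X := (show Equiv.Perm X from e) x

lemma app_mul (e f : PermTop X) (x : X) : (e * f).app x = e.app (f.app x) := rfl

lemma app_one (x : X) : (1 : PermTop X).app x = x := rfl

lemma ext {e f : PermTop X} (h : ∀ x, e.app x = f.app x) : e = f := Equiv.ext h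

lemma app_inv_app (e : PermTop X) (x : X) : e⁻¹.app (e.app x) = x := by
  rw [← app_mul, inv_mul_cancel, app_one]

lemma app_app_inv (e : PermTop X) (x : X) : e.app (e⁻¹.app x) = x := by
  rw [← app_mul, mul_inv_cancel, app_one]

/-- A permutation and its inverse, as a pair of maps. -/
def pair (e : PermTop X) : (X → X) × (X → X) := (e.app, e⁻¹.app)

variable [TopologicalSpace X]

instance : TopologicalSpace (PermTop X) := TopologicalSpace.induced pair inferInstance

lemma continuous_pair : Continuous (pair : PermTop X → _) := continuous_induced_dom

lemma continuous_app (x : X) : Continuous fun e : PermTop X ↦ e.app x :=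
  (continuous_apply x).comp (continuous_fst.comp continuous_pair)

lemma continuous_inv_app (x : X) : Continuous fun e : PermTop X ↦ e⁻¹.app x :=
  (continuous_apply x).comp (continuous_snd.comp continuous_pair)

variable [DiscreteTopology X]

instance : IsTopologicalGroup (PermTop X) where
  continuous_mul := by
    have h1 : Continuous fun q : PermTop X × X ↦ q.1.app q.2 :=
      continuous_prod_of_discrete_right.2 continuous_app
    have h2 : Continuous fun q : PermTop X × X ↦ q.1⁻¹.app q.2 :=
      continuous_prod_of_discrete_right.2 continuous_inv_app
    refine continuous_induced_rng.2 (Continuous.prodMk ?_ ?_)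
    · exact continuous_pi fun x ↦
        h1.comp (continuous_fst.prodMk ((continuous_app x).comp continuous_snd))
    · refine continuous_pi fun x ↦ ?_
      have : (fun q : PermTop X × PermTop X ↦ (q.1 * q.2)⁻¹.app x) =
          fun q ↦ q.2⁻¹.app (q.1⁻¹.app x) := by
        ext q; rw [mul_inv_rev, app_mul]
      change Continuous (fun q : PermTop X × PermTop X ↦ (q.1 * q.2)⁻¹.app x)
      rw [this]
      exact h2.comp (continuous_snd.prodMk ((continuous_inv_app x).comp continuous_fst))
  continuous_inv := by
    refine continuous_induced_rng.2 (Continuous.prodMk ?_ ?_)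
    · exact continuous_pi continuous_inv_app
    · refine continuous_pi fun x ↦ ?_
      change Continuous (fun q : PermTop X ↦ q⁻¹⁻¹.app x)
      simpa only [inv_inv] using continuous_app x

lemma isClosedEmbedding_pair : IsClosedEmbedding (pair : PermTop X → _) where
  eq_induced := rfl
  injective e f h := ext fun x ↦ congrFun (congrArg Prod.fst h) x
  isClosed_range := by
    have : Set.range (pair : PermTop X → _) = ⋂ x : X,
        ({q : (X → X) × (X → X) | q.1 (q.2 x) = x} ∩ {q | q.2 (q.1 x) = x}) := by
      ext q
      simp only [Set.mem_range, Set.mem_iInter, Set.mem_inter_iff, Set.mem_ofPred_eq]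
      constructor
      · rintro ⟨e, rfl⟩ x
        exact ⟨app_app_inv e x, app_inv_app e x⟩
      · intro h
        exact ⟨(⟨q.1, q.2, fun x ↦ (h x).2, fun x ↦ (h x).1⟩ : Equiv.Perm X), rfl⟩
    rw [this]
    have h1 : Continuous fun r : (X → X) × X ↦ r.1 r.2 :=
      continuous_prod_of_discrete_right.2 continuous_apply
    refine isClosed_iInter fun x ↦ IsClosed.inter ?_ ?_
    · refine isClosed_eq (h1.comp (continuous_fst.prodMk ?_)) continuous_const
      exact (continuous_apply x).comp continuous_snd
    · refine isClosed_eq (h1.comp (continuous_snd.prodMk ?_)) continuous_const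
      exact (continuous_apply x).comp continuous_fst

lemma isCompact_of_finite {F : X → Set X} (hF : ∀ x, (F x).Finite) :
    IsCompact {e : PermTop X | ∀ x, e.app x ∈ F x ∧ e⁻¹.app x ∈ F x} := by
  have h1 : IsCompact (Set.univ.pi F) := isCompact_univ_pi fun x ↦ (hF x).isCompact
  have h2 := isClosedEmbedding_pair.isCompact_preimage (h1.prod h1)
  refine h2.of_isClosed_subset ?_ ?_
  · simp only [Set.ofPred_forall]
    refine isClosed_iInter fun x ↦ IsClosed.and ?_ ?_
    · exact (isClosed_discrete (F x)).preimage (continuous_app x)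
    · exact (isClosed_discrete (F x)).preimage (continuous_inv_app x)
  · intro e he
    exact ⟨fun x _ ↦ (he x).1, fun x _ ↦ (he x).2⟩

end PermTop

end Permutations

section HeckeTriples

open MeasureTheory Measure Set Topology
open scoped ComplexConjugate

universe w u

/-- For a subgroup `A` of `G` and `x ∈ G`, the index `[A : A ∩ xAx⁻¹]` (zero if infinite). -/
noncomputable def conjIndex {G : Type u} [Group G] (A : Subgroup G) (x : G) : ℕ :=
  (A.map (MulAut.conj x).toMonoidHom).relIndex A

/-- A one-dimensional Hecke triple `(G, H, σ)`: a Hecke pair `(G, H)` and a unitary character `σ`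
of `H` with finite range. -/
structure HeckeTriple (G : Type u) [Group G] where
  /-- the subgroup -/
  H : Subgroup G
  /-- the character -/
  σ : H →* Circle
  hecke : ∀ x : G, conjIndex H x ≠ 0
  finite_range : (Set.range σ).Finite

namespace HeckeTriple

variable {G : Type u} [Group G] (T : HeckeTriple G)

/-- The kernel of `σ`, as a subgroup of `G`. -/
noncomputable def K : Subgroup G := T.σ.ker.map T.H.subtype

lemma mem_K {x : G} : x ∈ T.K ↔ ∃ h : x ∈ T.H, T.σ ⟨x, h⟩ = 1 := by
  simp [K, MonoidHom.mem_ker]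

lemma K_le : T.K ≤ T.H := fun _ hx ↦ (T.mem_K.1 hx).1

/-- The Hecke triple is reduced: the intersection of all the conjugates `xKx⁻¹` is trivial. -/
def IsReduced : Prop := ⨅ x : G, T.K.map (MulAut.conj x).toMonoidHom = ⊥

/-- The set `G/K` is regarded as a discrete space. -/
instance : TopologicalSpace (G ⧸ T.K) := ⊥

instance : DiscreteTopology (G ⧸ T.K) := ⟨rfl⟩

/-- The action of `G` on `G/K` by left translations. -/
noncomputable def toPerm : G →* PermTop (G ⧸ T.K) := MulAction.toPermHom G (G ⧸ T.K)

lemma toPerm_app (g : G) (q : G ⧸ T.K) : (T.toPerm g).app q = g • q := rfl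

/-- The Schlichting completion `G_σ`: the closure of (the image of) `G` in the group of
permutations of `G/K`. The topology that `G` receives from the permutations of `G/K` is the Hecke
topology of `(G, K)`: the stabilizer of the point `xK` is `xKx⁻¹`. -/
def Gσ : Type u := (T.toPerm.range).topologicalClosure

noncomputable instance : Group T.Gσ := inferInstanceAs (Group (T.toPerm.range).topologicalClosure)

instance : TopologicalSpace T.Gσ :=
  inferInstanceAs (TopologicalSpace (T.toPerm.range).topologicalClosure)

instance : IsTopologicalGroup T.Gσ :=
  inferInstanceAs (IsTopologicalGroup (T.toPerm.range).topologicalClosure)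

instance : MeasurableSpace T.Gσ := borel _

instance : BorelSpace T.Gσ := ⟨rfl⟩

/-- The canonical homomorphism `G → G_σ`. -/
noncomputable def j : G →* T.Gσ where
  toFun g := ⟨T.toPerm g, subset_closure ⟨g, rfl⟩⟩
  map_one' := Subtype.ext T.toPerm.map_one
  map_mul' x y := Subtype.ext (T.toPerm.map_mul x y)

variable {T} in
/-- The underlying permutation of `G/K` of an element of `G_σ`. -/
def app (u : T.Gσ) (q : G ⧸ T.K) : G ⧸ T.K := u.1.app q

lemma continuous_val : Continuous fun u : T.Gσ ↦ u.1 := continuous_subtype_val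

lemma continuous_app (q : G ⧸ T.K) : Continuous fun u : T.Gσ ↦ app u q :=
  (PermTop.continuous_app q).comp T.continuous_val

lemma app_mul (u v : T.Gσ) (q : G ⧸ T.K) : app (u * v) q = app u (app v q) := rfl

lemma app_j (g : G) (q : G ⧸ T.K) : app (T.j g) q = g • q := rfl

lemma denseRange_j : DenseRange T.j := by
  intro u
  have hu : u.1 ∈ closure (Set.range T.toPerm) := u.2
  have hi : IsInducing (fun v : T.Gσ ↦ v.1) := IsInducing.subtypeVal
  rw [hi.closure_eq_preimage_closure_image]
  change u.1 ∈ closure _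
  convert hu
  ext e
  constructor
  · rintro ⟨_, ⟨g, rfl⟩, rfl⟩; exact ⟨g, rfl⟩
  · rintro ⟨g, rfl⟩; exact ⟨T.j g, ⟨g, rfl⟩, rfl⟩

/-- The closure `H_σ` of `H` in `G_σ`. -/
noncomputable def Hσ : Subgroup T.Gσ := (T.H.map T.j).topologicalClosure

/-- The set `H/K`. -/
def cosetsH : Set (G ⧸ T.K) := (fun h : G ↦ (h : G ⧸ T.K)) '' T.H

lemma mk_mem_cosetsH {g : G} : (g : G ⧸ T.K) ∈ T.cosetsH ↔ g ∈ T.H := by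
  constructor
  · rintro ⟨h, hh, e⟩
    have := T.K_le (QuotientGroup.eq.1 e)
    simpa using T.H.mul_mem hh this
  · exact fun h ↦ ⟨g, h, rfl⟩

lemma mem_Hσ {u : T.Gσ} : u ∈ T.Hσ ↔ app u (1 : G) ∈ T.cosetsH := by
  have hclopen : IsClopen {v : T.Gσ | app v ((1 : G) : G ⧸ T.K) ∈ T.cosetsH} :=
    (isClopen_discrete T.cosetsH).preimage (T.continuous_app _)
  have key : ∀ g, app (T.j g) ((1 : G) : G ⧸ T.K) = (g : G ⧸ T.K) := fun g ↦ by
    rw [app_j, MulAction.Quotient.smul_mk, smul_eq_mul, mul_one]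
  constructor
  · intro hu
    refine closure_minimal ?_ hclopen.1 hu
    rintro _ ⟨h, hh, rfl⟩
    change app (T.j h) ((1 : G) : G ⧸ T.K) ∈ T.cosetsH
    rw [key]
    exact T.mk_mem_cosetsH.2 hh
  · intro hu
    have h1 := T.denseRange_j.open_subset_closure_inter hclopen.2 hu
    refine closure_mono ?_ h1
    rintro _ ⟨hv, g, rfl⟩
    change app (T.j g) ((1 : G) : G ⧸ T.K) ∈ T.cosetsH at hv
    rw [key, mk_mem_cosetsH] at hv
    exact ⟨g, hv, rfl⟩

lemma j_mem_Hσ {g : G} : T.j g ∈ T.Hσ ↔ g ∈ T.H := by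
  rw [mem_Hσ, app_j, MulAction.Quotient.smul_mk, smul_eq_mul, mul_one, mk_mem_cosetsH]

lemma isOpen_Hσ : IsOpen (T.Hσ : Set T.Gσ) := by
  have : (T.Hσ : Set T.Gσ) = (fun v ↦ app v ((1 : G) : G ⧸ T.K)) ⁻¹' T.cosetsH := by
    ext u; exact T.mem_Hσ
  rw [this]
  exact (isOpen_discrete T.cosetsH).preimage (T.continuous_app _)

lemma isClosed_Hσ : IsClosed (T.Hσ : Set T.Gσ) := isClosed_closure

lemma relIndex_K_ne_zero : T.K.relIndex T.H ≠ 0 := by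
  have h1 : T.K.relIndex T.H = T.σ.ker.index := by
    rw [Subgroup.relIndex, K, ← Subgroup.comap_subtype,
      Subgroup.comap_map_eq_self_of_injective T.H.subtype_injective]
  rw [h1, Subgroup.index_ker]
  have : Finite T.σ.range := T.finite_range
  exact Nat.card_pos.ne'

lemma relIndex_conj (A B : Subgroup G) (x : G) :
    (A.map (MulAut.conj x).toMonoidHom).relIndex (B.map (MulAut.conj x).toMonoidHom) =
      A.relIndex B :=
  Subgroup.relIndex_map_map_of_injective A B (MulAut.conj x).injective

lemma conj_K_relIndex_ne_zero (x : G) :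
    (T.K.map (MulAut.conj x).toMonoidHom).relIndex T.H ≠ 0 :=
  Subgroup.relIndex_ne_zero_trans (by rw [relIndex_conj]; exact T.relIndex_K_ne_zero) (T.hecke x)

lemma finite_orbit (A B : Subgroup G) (x : G)
    (h : (B.map (MulAut.conj x).toMonoidHom).relIndex A ≠ 0) :
    ((fun a : G ↦ ((a * x : G) : G ⧸ B)) '' A).Finite := by
  have : Finite (A ⧸ (B.map (MulAut.conj x).toMonoidHom).subgroupOf A) :=
    haveI : ((B.map (MulAut.conj x).toMonoidHom).subgroupOf A).FiniteIndex := ⟨h⟩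
    Subgroup.finite_quotient_of_finiteIndex
  refine (Set.finite_range (Quotient.lift
    (s := QuotientGroup.leftRel ((B.map (MulAut.conj x).toMonoidHom).subgroupOf A))
    (fun a : A ↦ (((a : G) * x : G) : G ⧸ B)) ?_)).subset ?_
  · intro a b hab
    rw [← Quotient.eq_iff_equiv, Quotient.eq, QuotientGroup.leftRel_apply,
      Subgroup.mem_subgroupOf] at hab
    obtain ⟨k, hk, e⟩ := hab
    rw [QuotientGroup.eq]
    have : ((a : G) * x)⁻¹ * (b * x) = k := by
      have e' : x * k * x⁻¹ = (a : G)⁻¹ * b := by simpa using e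
      rw [mul_inv_rev, mul_assoc, ← mul_assoc (a : G)⁻¹, ← e']
      group
    rw [this]; exact hk
  · rintro _ ⟨a, ha, rfl⟩
    exact ⟨Quotient.mk _ ⟨a, ha⟩, rfl⟩

lemma finite_smul (q : G ⧸ T.K) : ((fun h : G ↦ h • q) '' T.H).Finite := by
  obtain ⟨x, rfl⟩ := QuotientGroup.mk_surjective q
  exact finite_orbit T.H T.K x (T.conj_K_relIndex_ne_zero x)

lemma isCompact_Hσ : IsCompact (T.Hσ : Set T.Gσ) := by
  have hC := PermTop.isCompact_of_finite T.finite_smul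
  have hemb : IsClosedEmbedding (fun u : T.Gσ ↦ u.1) :=
    (isClosed_closure (s := (T.toPerm.range : Set (PermTop (G ⧸ T.K))))).isClosedEmbedding_subtypeVal
  refine (hemb.isCompact_preimage hC).of_isClosed_subset T.isClosed_Hσ ?_
  refine closure_minimal ?_ ?_
  · rintro _ ⟨h, hh, rfl⟩ q
    refine ⟨⟨h, hh, rfl⟩, ⟨h⁻¹, T.H.inv_mem hh, ?_⟩⟩
    change _ = (T.toPerm h)⁻¹.app q
    rw [← map_inv, toPerm_app]
  · refine IsClosed.preimage T.continuous_val ?_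
    simp only [Set.ofPred_forall]
    refine isClosed_iInter fun x ↦ IsClosed.and ?_ ?_
    · exact (isClosed_discrete _).preimage (PermTop.continuous_app x)
    · exact (isClosed_discrete _).preimage (PermTop.continuous_inv_app x)

/-- `H_σ` as a compact set with non-empty interior. -/
def positiveCompacts : TopologicalSpace.PositiveCompacts T.Gσ where
  carrier := T.Hσ
  isCompact' := T.isCompact_Hσ
  interior_nonempty' := ⟨1, by rw [T.isOpen_Hσ.interior_eq]; exact T.Hσ.one_mem⟩

instance : LocallyCompactSpace T.Gσ :=
  T.positiveCompacts.locallyCompactSpace_of_group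

/-- The left Haar measure of `G_σ` with `μ(H_σ) = 1`. -/
noncomputable def μ : Measure T.Gσ := haarMeasure T.positiveCompacts

instance : IsHaarMeasure T.μ := isHaarMeasure_haarMeasure T.positiveCompacts

lemma μ_Hσ : T.μ T.Hσ = 1 := haarMeasure_self (K₀ := T.positiveCompacts)

/-! ### The projection `p_σ` -/

open Classical in
/-- The function on `G/K` induced by the extension of `σ` by zero to `G`. -/
noncomputable def chi (q : G ⧸ T.K) : ℂ :=
  Quotient.liftOn' q (fun g ↦ if h : g ∈ T.H then (T.σ ⟨g, h⟩ : ℂ) else 0) (by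
    intro a b hab
    rw [QuotientGroup.leftRel_apply] at hab
    obtain ⟨h1, h2⟩ := T.mem_K.1 hab
    by_cases ha : a ∈ T.H
    · have hb : b ∈ T.H := by simpa using T.H.mul_mem ha h1
      have : (⟨b, hb⟩ : T.H) = ⟨a, ha⟩ * ⟨a⁻¹ * b, h1⟩ := Subtype.ext (by simp)
      simp only [ha, hb, dif_pos]
      rw [this, map_mul, h2, mul_one]
    · have hb : b ∉ T.H := fun hb ↦ ha (by simpa using T.H.mul_mem hb (T.H.inv_mem h1))
      simp only [ha, hb, dif_neg, not_false_iff])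

open Classical in
lemma chi_of_mem {g : G} (h : g ∈ T.H) : T.chi g = T.σ ⟨g, h⟩ := by
  change (if h : g ∈ T.H then (T.σ ⟨g, h⟩ : ℂ) else 0) = _
  rw [dif_pos h]

open Classical in
lemma chi_of_notMem {g : G} (h : g ∉ T.H) : T.chi g = 0 := by
  change (if h : g ∈ T.H then (T.σ ⟨g, h⟩ : ℂ) else 0) = _
  rw [dif_neg h]

/-- The projection `p_σ = χ_{H_σ} σ` in `C_c(G_σ)`. Here `σ` stands for its unique continuous
extension to `H_σ`; for `u ∈ H_σ` it is given by `σ(u) = σ(h)` where `h ∈ H` is such that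
`u · K = hK`. See `p_j` and `p_eq_zero` below. -/
noncomputable def p : ConvAlg T.μ where
  toFun u := T.chi (app u (1 : G))
  continuous' := (continuous_of_discreteTopology (f := T.chi)).comp (T.continuous_app _)
  compact' := by
    refine HasCompactSupport.intro T.isCompact_Hσ fun u hu ↦ ?_
    rw [SetLike.mem_coe, mem_Hσ] at hu
    obtain ⟨g, hg⟩ := QuotientGroup.mk_surjective (app u ((1 : G) : G ⧸ T.K))
    rw [← hg] at hu ⊢
    exact T.chi_of_notMem fun h ↦ hu (T.mk_mem_cosetsH.2 h)

lemma p_j (g : G) : T.p (T.j g) = T.chi g := by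
  change T.chi (app (T.j g) (1 : G)) = _
  rw [app_j, MulAction.Quotient.smul_mk, smul_eq_mul, mul_one]

lemma p_j_of_mem {h : G} (hh : h ∈ T.H) : T.p (T.j h) = T.σ ⟨h, hh⟩ := by
  rw [p_j, chi_of_mem]

lemma p_eq_zero {u : T.Gσ} (hu : u ∉ T.Hσ) : T.p u = 0 := by
  rw [mem_Hσ] at hu
  obtain ⟨g, hg⟩ := QuotientGroup.mk_surjective (app u ((1 : G) : G ⧸ T.K))
  change T.chi (app u (1 : G)) = 0
  rw [← hg] at hu ⊢
  exact T.chi_of_notMem fun h ↦ hu (T.mk_mem_cosetsH.2 h)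

lemma chi_mul_left {h : G} (hh : h ∈ T.H) (g : G) :
    T.chi ((h * g : G) : G ⧸ T.K) = T.σ ⟨h, hh⟩ * T.chi g := by
  by_cases hg : g ∈ T.H
  · rw [T.chi_of_mem (T.H.mul_mem hh hg), T.chi_of_mem hg, ← Circle.coe_mul, ← map_mul]
    rfl
  · rw [T.chi_of_notMem hg, T.chi_of_notMem, mul_zero]
    exact fun h' ↦ hg (by simpa using T.H.mul_mem (T.H.inv_mem hh) h')

lemma chi_mul_right {h : G} (hh : h ∈ T.H) (g : G) :
    T.chi ((g * h : G) : G ⧸ T.K) = T.chi g * T.σ ⟨h, hh⟩ := by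
  by_cases hg : g ∈ T.H
  · rw [T.chi_of_mem (T.H.mul_mem hg hh), T.chi_of_mem hg, ← Circle.coe_mul, ← map_mul]
    rfl
  · rw [T.chi_of_notMem hg, T.chi_of_notMem, zero_mul]
    exact fun h' ↦ hg (by simpa using T.H.mul_mem h' (T.H.inv_mem hh))

lemma chi_inv (g : G) : conj (T.chi ((g⁻¹ : G) : G ⧸ T.K)) = T.chi g := by
  by_cases hg : g ∈ T.H
  · rw [T.chi_of_mem (T.H.inv_mem hg), T.chi_of_mem hg, ← Circle.coe_inv_eq_conj, ← map_inv]
    congr 2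
    exact Subtype.ext (by simp)
  · rw [T.chi_of_notMem hg, T.chi_of_notMem (fun h ↦ hg (by simpa using T.H.inv_mem h)), map_zero]

lemma p_mul_left {h : G} (hh : h ∈ T.H) (u : T.Gσ) :
    T.p (T.j h * u) = T.σ ⟨h, hh⟩ * T.p u := by
  have hp := T.p.continuous'
  refine T.denseRange_j.induction_on (p := fun u ↦ T.p (T.j h * u) = T.σ ⟨h, hh⟩ * T.p u) u
    (isClosed_eq (hp.comp (continuous_const_mul _)) (continuous_const.mul hp)) fun g ↦ ?_
  rw [← map_mul, p_j, p_j, chi_mul_left]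

lemma p_mul_right {h : G} (hh : h ∈ T.H) (u : T.Gσ) :
    T.p (u * T.j h) = T.p u * T.σ ⟨h, hh⟩ := by
  have hp := T.p.continuous'
  refine T.denseRange_j.induction_on (p := fun u ↦ T.p (u * T.j h) = T.p u * T.σ ⟨h, hh⟩) u
    (isClosed_eq (hp.comp (continuous_mul_const _)) (hp.mul continuous_const)) fun g ↦ ?_
  rw [← map_mul, p_j, p_j, chi_mul_right]

lemma p_inv (u : T.Gσ) : conj (T.p u⁻¹) = T.p u := by
  have hp := T.p.continuous'
  refine T.denseRange_j.induction_on (p := fun u ↦ conj (T.p u⁻¹) = T.p u) u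
    (isClosed_eq (Complex.continuous_conj.comp (hp.comp continuous_inv)) hp) fun g ↦ ?_
  rw [← map_inv, p_j, p_j, chi_inv]

/-- The modular function is trivial on `H_σ`. -/
lemma modularFun_of_mem {u : T.Gσ} (hu : u ∈ T.Hσ) : ConvAlg.modularFun u = 1 := by
  have hc : IsClopen (T.Hσ : Set T.Gσ) := ⟨T.isClosed_Hσ, T.isOpen_Hσ⟩
  have h1 : Continuous (Set.indicator (T.Hσ : Set T.Gσ) (fun _ ↦ (1 : ℝ))) :=
    continuous_const.indicator (by simp [hc.frontier_eq])
  have h2 : HasCompactSupport (Set.indicator (T.Hσ : Set T.Gσ) (fun _ ↦ (1 : ℝ))) :=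
    HasCompactSupport.intro T.isCompact_Hσ fun x hx ↦ by simp [hx]
  have h3 := ConvAlg.integral_mul_right (μ := T.μ) h1 h2 u⁻¹
  have h4 : ∀ x, Set.indicator (T.Hσ : Set T.Gσ) (fun _ ↦ (1 : ℝ)) (x * u⁻¹) =
      Set.indicator (T.Hσ : Set T.Gσ) (fun _ ↦ (1 : ℝ)) x := fun x ↦ by
    have : x * u⁻¹ ∈ (T.Hσ : Set T.Gσ) ↔ x ∈ (T.Hσ : Set T.Gσ) :=
      Subgroup.mul_mem_cancel_right _ (T.Hσ.inv_mem hu)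
    by_cases hx : x ∈ (T.Hσ : Set T.Gσ)
    · rw [Set.indicator_of_mem hx, Set.indicator_of_mem (this.2 hx)]
    · rw [Set.indicator_of_notMem hx, Set.indicator_of_notMem (fun h ↦ hx (this.1 h))]
  simp only [h4, inv_inv] at h3
  rw [integral_indicator_const _ T.isOpen_Hσ.measurableSet, measureReal_def, μ_Hσ] at h3
  simpa using h3.symm

lemma star_p : star T.p = T.p := by
  ext u
  rw [ConvAlg.star_apply, p_inv]
  by_cases hu : u ∈ T.Hσ
  · rw [T.modularFun_of_mem (T.Hσ.inv_mem hu)]; simp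
  · rw [T.p_eq_zero hu, mul_zero]

/-- `p_σ` is idempotent, so it is a projection in `C_c(G_σ)`. -/
lemma p_mul_p : T.p * T.p = T.p := by
  ext u
  rw [ConvAlg.mul_apply]
  have h : ∀ y, T.p y * T.p (y⁻¹ * u) = Set.indicator (T.Hσ : Set T.Gσ) (fun _ ↦ T.p u) y := by
    intro y
    have hp := T.p.continuous'
    by_cases hy : y ∈ (T.Hσ : Set T.Gσ)
    · rw [Set.indicator_of_mem hy]
      have hcl : IsClosed {z : T.Gσ | T.p z * T.p (z⁻¹ * u) = T.p u} :=
        isClosed_eq (hp.mul (hp.comp (continuous_inv.mul continuous_const))) continuous_const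
      refine closure_minimal ?_ hcl hy
      rintro _ ⟨g, hg, rfl⟩
      change T.p (T.j g) * T.p ((T.j g)⁻¹ * u) = T.p u
      rw [← map_inv, T.p_mul_left (T.H.inv_mem hg), T.p_j_of_mem hg, ← mul_assoc,
        ← Circle.coe_mul, ← map_mul]
      have : (⟨g, hg⟩ : T.H) * ⟨g⁻¹, T.H.inv_mem hg⟩ = 1 := Subtype.ext (by simp)
      rw [this]; simp
    · rw [Set.indicator_of_notMem hy, T.p_eq_zero hy, zero_mul]
  simp only [h]
  rw [integral_indicator_const _ T.isOpen_Hσ.measurableSet, measureReal_def, μ_Hσ]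
  simp

/-! ### The generalised Hecke algebra -/

/-- The generalised Hecke algebra `H_σ(G, H)`: the functions `f : G → ℂ` with
`f(hxk) = σ(h) f(x) σ(k)` for `h, k ∈ H` that have finite support in `H \ G / H`. -/
def heckeAlgebra : Submodule ℂ (G → ℂ) where
  carrier := {f | (∀ (h k : T.H) (x : G), f (h * x * k) = T.σ h * f x * T.σ k) ∧
    (DoubleCoset.mk T.H T.H '' Function.support f).Finite}
  add_mem' := by
    rintro f g ⟨hf, hf'⟩ ⟨hg, hg'⟩
    refine ⟨fun h k x ↦ by simp only [Pi.add_apply, hf, hg]; ring, (hf'.union hg').subset ?_⟩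
    rw [← Set.image_union]
    exact Set.image_mono (Function.support_add f g)
  zero_mem' := ⟨fun h k x ↦ by simp, by simp⟩
  smul_mem' := by
    rintro c f ⟨hf, hf'⟩
    refine ⟨fun h k x ↦ by simp only [Pi.smul_apply, smul_eq_mul, hf]; ring, hf'.subset ?_⟩
    exact Set.image_mono (Function.support_const_smul_subset c f)

variable {T}

lemma hecke_mul_left (f : T.heckeAlgebra) (h : T.H) (x : G) : f.1 (h * x) = T.σ h * f.1 x := by
  simpa using f.2.1 h 1 x

lemma hecke_mul_right (f : T.heckeAlgebra) (x : G) (k : T.H) : f.1 (x * k) = f.1 x * T.σ k := by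
  simpa using f.2.1 1 k x

/-- The support of an element of the Hecke algebra is finite in `G/H`. -/
lemma hecke_finite (f : T.heckeAlgebra) :
    ((fun x : G ↦ (x : G ⧸ T.H)) '' Function.support f.1).Finite := by
  refine (Set.Finite.biUnion f.2.2 (t := fun q ↦ (fun a : G ↦ ((a * q.out : G) : G ⧸ T.H)) '' T.H)
    fun q _ ↦ finite_orbit T.H T.H q.out (T.hecke q.out)).subset ?_
  rintro _ ⟨x, hx, rfl⟩
  refine Set.mem_biUnion (Set.mem_image_of_mem _ hx) ?_
  obtain ⟨h, k, hh, hk, e⟩ := DoubleCoset.mk_out_eq_mul T.H T.H x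
  refine ⟨h⁻¹, T.H.inv_mem hh, ?_⟩
  change ((h⁻¹ * (DoubleCoset.mk T.H T.H x).out : G) : G ⧸ T.H) = (x : G ⧸ T.H)
  rw [e, QuotientGroup.eq]
  have : (h⁻¹ * (h * x * k))⁻¹ * x = k⁻¹ := by group
  rw [this]; exact T.H.inv_mem hk

/-- The product in the sum defining the convolution is independent of the representative. -/
lemma conv_rep (f g : T.heckeAlgebra) (x y : G) (k : T.H) :
    f.1 (y * k) * g.1 ((y * k)⁻¹ * x) = f.1 y * g.1 (y⁻¹ * x) := by
  have h1 : ((y * k)⁻¹ * x : G) = ((k⁻¹ : T.H) : G) * (y⁻¹ * x) := by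
    simp [mul_assoc]
  rw [h1, hecke_mul_right, hecke_mul_left, map_inv, Circle.coe_inv]
  have := Circle.coe_ne_zero (T.σ k)
  field_simp

/-- The convolution `(f * g)(x) = ∑ f(y) g(y⁻¹x)`, where `y` runs over a set of representatives
of `G/H`. -/
noncomputable def conv (f g : G → ℂ) (x : G) : ℂ :=
  ∑ᶠ q : G ⧸ T.H, f q.out * g (q.out⁻¹ * x)

lemma conv_term (f g : T.heckeAlgebra) (x y : G) :
    f.1 (y : G ⧸ T.H).out * g.1 ((y : G ⧸ T.H).out⁻¹ * x) = f.1 y * g.1 (y⁻¹ * x) := by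
  obtain ⟨k, hk⟩ := QuotientGroup.mk_out_eq_mul T.H y
  rw [hk, conv_rep]

lemma conv_support (f g : T.heckeAlgebra) (x : G) :
    (Function.support fun q : G ⧸ T.H ↦ f.1 q.out * g.1 (q.out⁻¹ * x)).Finite := by
  refine (hecke_finite f).subset fun q hq ↦ ?_
  exact ⟨q.out, left_ne_zero_of_mul hq, q.out_eq'⟩

lemma conv_mem (f g : T.heckeAlgebra) : conv (T := T) f.1 g.1 ∈ T.heckeAlgebra := by
  have hr : ∀ (x : G) (k : T.H), conv (T := T) f.1 g.1 (x * k) =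
      conv (T := T) f.1 g.1 x * T.σ k := by
    intro x k
    rw [conv, conv, finsum_mul' _ _ (conv_support f g x)]
    refine finsum_congr fun q ↦ ?_
    rw [← mul_assoc, hecke_mul_right, mul_assoc]
  have hl : ∀ (h : T.H) (x : G), conv (T := T) f.1 g.1 (h * x) =
      T.σ h * conv (T := T) f.1 g.1 x := by
    intro h x
    rw [conv, conv, mul_finsum' _ _ (conv_support f g x)]
    rw [← finsum_comp_equiv (MulAction.toPerm (h : G) : Equiv.Perm (G ⧸ T.H))]
    refine finsum_congr fun q ↦ ?_
    obtain ⟨y, rfl⟩ := QuotientGroup.mk_surjective q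
    rw [MulAction.toPerm_apply, MulAction.Quotient.smul_mk, smul_eq_mul, conv_term, conv_term,
      hecke_mul_left, mul_assoc]
    congr 3
    group
  refine ⟨fun h k x ↦ by rw [hr, hl], ?_⟩
  let F : Set (G ⧸ T.H) := (fun x : G ↦ (x : G ⧸ T.H)) '' Function.support f.1
  let F' : Set (G ⧸ T.H) := (fun x : G ↦ (x : G ⧸ T.H)) '' Function.support g.1
  have hF : (Set.image2 (fun q q' : G ⧸ T.H ↦ DoubleCoset.mk T.H T.H (q.out * q'.out)) F F').Finite :=
    (hecke_finite f).image2 _ (hecke_finite g)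
  refine hF.subset ?_
  rintro _ ⟨x, hx, rfl⟩
  obtain ⟨q, hq⟩ : ∃ q : G ⧸ T.H, f.1 q.out * g.1 (q.out⁻¹ * x) ≠ 0 := by
    by_contra! h
    refine hx ?_
    rw [conv]
    simp only [h, finsum_zero]
  refine ⟨q, ⟨q.out, left_ne_zero_of_mul hq, q.out_eq'⟩, ((q.out⁻¹ * x : G) : G ⧸ T.H),
    ⟨_, right_ne_zero_of_mul hq, rfl⟩, ?_⟩
  obtain ⟨k, hk⟩ := QuotientGroup.mk_out_eq_mul T.H (q.out⁻¹ * x)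
  change DoubleCoset.mk T.H T.H (q.out * ((q.out⁻¹ * x : G) : G ⧸ T.H).out) = _
  rw [hk, DoubleCoset.eq]
  exact ⟨1, T.H.one_mem, (k : G)⁻¹, T.H.inv_mem k.2, by group⟩

noncomputable instance : Mul T.heckeAlgebra := ⟨fun f g ↦ ⟨conv (T := T) f.1 g.1, conv_mem f g⟩⟩

variable (T)

/-- The function `Δ_K(x) = [K : K ∩ xKx⁻¹] / [K : K ∩ x⁻¹Kx]` on `G`. -/
noncomputable def ΔK (x : G) : ℝ := (conjIndex T.K x : ℝ) / conjIndex T.K x⁻¹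

lemma conj_K {h : G} (hh : h ∈ T.H) : T.K.map (MulAut.conj h).toMonoidHom = T.K := by
  have key : ∀ {h : G}, h ∈ T.H → T.K.map (MulAut.conj h).toMonoidHom ≤ T.K := by
    rintro h hh _ ⟨k, hk, rfl⟩
    obtain ⟨h1, h2⟩ := T.mem_K.1 hk
    refine T.mem_K.2 ⟨T.H.mul_mem (T.H.mul_mem hh h1) (T.H.inv_mem hh), ?_⟩
    have : (⟨_, T.H.mul_mem (T.H.mul_mem hh h1) (T.H.inv_mem hh)⟩ : T.H) =
      ⟨h, hh⟩ * ⟨k, h1⟩ * ⟨h, hh⟩⁻¹ := rfl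
    change T.σ ⟨_, T.H.mul_mem (T.H.mul_mem hh h1) (T.H.inv_mem hh)⟩ = 1
    rw [this, map_mul, map_mul, h2, mul_one, map_inv, mul_inv_cancel]
  refine le_antisymm (key hh) fun k hk ↦ ?_
  refine ⟨h⁻¹ * k * h, ?_, by simp [mul_assoc]⟩
  have := key (T.H.inv_mem hh) ⟨k, hk, rfl⟩
  simpa using this

lemma conjIndex_mul {h k : G} (hh : h ∈ T.H) (hk : k ∈ T.H) (x : G) :
    conjIndex T.K (h * x * k) = conjIndex T.K x := by
  have e : ∀ a b : G, T.K.map (MulAut.conj (a * b)).toMonoidHom =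
      (T.K.map (MulAut.conj b).toMonoidHom).map (MulAut.conj a).toMonoidHom := by
    intro a b
    rw [Subgroup.map_map]
    congr 1
    ext y
    simp
  rw [conjIndex, e, T.conj_K hk, e]
  conv_lhs => rw [← T.conj_K hh]
  rw [T.conj_K hh]
  nth_rewrite 2 [← T.conj_K hh]
  rw [relIndex_conj, conjIndex]

lemma ΔK_mul {h k : G} (hh : h ∈ T.H) (hk : k ∈ T.H) (x : G) : T.ΔK (h * x * k) = T.ΔK x := by
  have : (h * x * k)⁻¹ = k⁻¹ * x⁻¹ * h⁻¹ := by group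
  rw [ΔK, this, T.conjIndex_mul hh hk, T.conjIndex_mul (T.H.inv_mem hk) (T.H.inv_mem hh), ΔK]

variable {T}

lemma heckeStar_mem (f : T.heckeAlgebra) :
    (fun x : G ↦ (T.ΔK x⁻¹ : ℂ) * conj (f.1 x⁻¹)) ∈ T.heckeAlgebra := by
  refine ⟨fun h k x ↦ ?_, ?_⟩
  · have e : ((h : G) * x * k)⁻¹ = ((k⁻¹ : T.H) : G) * x⁻¹ * ((h⁻¹ : T.H) : G) := by
      simp [mul_assoc]
    simp only [e]
    rw [T.ΔK_mul (k⁻¹).2 (h⁻¹).2, f.2.1, map_mul, map_mul, map_inv, map_inv,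
      Circle.coe_inv_eq_conj, Circle.coe_inv_eq_conj, Complex.conj_conj, Complex.conj_conj]
    ring
  · refine (f.2.2.image fun q ↦ DoubleCoset.mk T.H T.H q.out⁻¹).subset ?_
    rintro _ ⟨x, hx, rfl⟩
    have hx' : f.1 x⁻¹ ≠ 0 := fun h ↦ hx (by simp [h])
    refine ⟨_, ⟨x⁻¹, hx', rfl⟩, ?_⟩
    obtain ⟨h, k, hh, hk, e⟩ := DoubleCoset.mk_out_eq_mul T.H T.H x⁻¹
    change DoubleCoset.mk T.H T.H (DoubleCoset.mk T.H T.H x⁻¹).out⁻¹ = _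
    rw [e, DoubleCoset.eq]
    exact ⟨k, hk, h, hh, by group⟩

/-- The involution `f*(x) = Δ_K(x⁻¹) conj (f(x⁻¹))`. -/
noncomputable instance : Star T.heckeAlgebra :=
  ⟨fun f ↦ ⟨fun x ↦ (T.ΔK x⁻¹ : ℂ) * conj (f.1 x⁻¹), heckeStar_mem f⟩⟩

variable (T)

/-- The restriction map `Ψ(f) = f|_G` from the corner `H_σ(G_σ, H_σ) = p_σ C_c(G_σ) p_σ` to the
Hecke algebra `H_σ(G, H)`. -/
noncomputable def restrict (f : starCorner T.p T.star_p) : T.heckeAlgebra :=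
  ⟨fun x ↦ f.1 (T.j x), by
    obtain ⟨_, a, rfl⟩ := f
    have hl : ∀ (b : ConvAlg T.μ) (h : T.H) (u : T.Gσ),
        (T.p * b) (T.j h * u) = T.σ h * (T.p * b) u := by
      intro b h u
      rw [ConvAlg.mul_apply, ConvAlg.mul_apply, ← integral_const_mul,
        ← integral_mul_left_eq_self _ (T.j h)]
      congr 1 with y
      rw [T.p_mul_left h.2, mul_assoc]
      congr 3
      group
    have hr : ∀ (b : ConvAlg T.μ) (k : T.H) (u : T.Gσ),
        (b * T.p) (u * T.j k) = (b * T.p) u * T.σ k := by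
      intro b k u
      rw [ConvAlg.mul_apply, ConvAlg.mul_apply, ← integral_mul_const]
      congr 1 with y
      rw [← mul_assoc, T.p_mul_right k.2, mul_assoc]
    refine ⟨fun h k x ↦ ?_, ?_⟩
    · change (T.p * a * T.p) (T.j (h * x * k)) = _ * (T.p * a * T.p) (T.j x) * _
      rw [map_mul, hr, map_mul, mul_assoc T.p, hl]
    · have hfin : ((fun u : T.Gσ ↦ app u ((1 : G) : G ⧸ T.K)) ''
          tsupport (T.p * a * T.p).toFun).Finite :=
        ((T.p * a * T.p).compact'.isCompact.image (T.continuous_app _)).finite_of_discrete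
      refine (hfin.image fun q ↦ DoubleCoset.mk T.H T.H q.out).subset ?_
      rintro _ ⟨x, hx, rfl⟩
      refine ⟨(x : G ⧸ T.K), ⟨T.j x, subset_tsupport _ hx, ?_⟩, ?_⟩
      · change app (T.j x) ((1 : G) : G ⧸ T.K) = _
        rw [app_j, MulAction.Quotient.smul_mk, smul_eq_mul, mul_one]
      · obtain ⟨k, hk⟩ := QuotientGroup.mk_out_eq_mul T.K x
        change DoubleCoset.mk T.H T.H (x : G ⧸ T.K).out = _
        rw [hk, DoubleCoset.eq]
        exact ⟨1, T.H.one_mem, (k : G)⁻¹, T.H.inv_mem (T.K_le k.2), by group⟩⟩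

/-! ### `p_σ` in `L¹(G_σ)` and in `C*(G_σ)` -/

/-- The projection `p_σ` in `L¹(G_σ)`. -/
noncomputable def pL1 : GroupL1 T.μ := StarCompletion.of T.p

lemma star_pL1 : star T.pL1 = T.pL1 := by
  rw [pL1, ← StarCompletion.of_star, star_p]

/-- The projection `p_σ` in `C*(G_σ)`. -/
noncomputable def pCStar : GroupCStar T.μ := toCStarEnvelope T.pL1

lemma star_pCStar : star T.pCStar = T.pCStar := by
  rw [pCStar, star_toCStarEnvelope, star_pL1]

/-! ### The categories of representations -/

open CategoryTheory

/-- The category of unitary `(H, σ)`-smooth representations of `G`. -/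
abbrev SmoothRep {G : Type u} [Group G] {H : Subgroup G} (σ : H →* Circle) :=
  (HilbRep.IsUnitarySmooth.{w} σ).FullSubcategory

/-- A nondegenerate `*`-representation of `H_σ(G, H)` is `⟨⟩_R`-positive if it is positive on the
elements `⟨f, f⟩_R = f* f` for `f` in the bimodule `C_c(G_σ) p_σ`. -/
def IsPositiveHeckeRep : ObjectProperty (HilbRep.{w} T.heckeAlgebra) := fun R ↦
  HilbRep.IsNondegStarRep T.heckeAlgebra R ∧
    ∀ a : ConvAlg T.μ, (R.act (T.restrict (rightInnerSelf T.p T.star_p a))).IsPositive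

/-- The category of `⟨⟩_R`-positive representations of `H_σ(G, H)`. -/
abbrev PositiveHeckeRep := (IsPositiveHeckeRep.{w} T).FullSubcategory

/-- The ideal of `C*(G_σ)` generated by `p_σ`: the closed linear span of
`C*(G_σ) p_σ C*(G_σ)`. -/
noncomputable def ideal : NonUnitalStarSubalgebra ℂ (GroupCStar T.μ) :=
  closedIdeal T.pCStar T.star_pCStar

/-- The category of nondegenerate representations of the ideal generated by `p_σ`. -/
abbrev IdealRep := (HilbRep.IsNondegStarRep.{w} T.ideal).FullSubcategory

/-- The corner `p_σ L¹(G_σ) p_σ`. -/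
noncomputable def cornerL1 : NonUnitalStarSubalgebra ℂ (GroupL1 T.μ) :=
  starCorner T.pL1 T.star_pL1

/-- A nondegenerate `*`-representation of `p_σ L¹(G_σ) p_σ` is `⟨⟩_R`-positive if it is positive on
the elements `⟨f, f⟩_R = f* f` for `f` in the bimodule `L¹(G_σ) p_σ`. -/
def IsPositiveCornerRep : ObjectProperty (HilbRep.{w} T.cornerL1) := fun R ↦
  HilbRep.IsNondegStarRep T.cornerL1 R ∧
    ∀ a : GroupL1 T.μ, (R.act (rightInnerSelf T.pL1 T.star_pL1 a)).IsPositive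

/-- The category of `⟨⟩_R`-positive representations of `p_σ L¹(G_σ) p_σ`. -/
abbrev PositiveCornerRep := (IsPositiveCornerRep.{w} T).FullSubcategory

end HeckeTriple

end HeckeTriples

universe v u

open CategoryTheory

/-!
All three equivalences send a representation to its compression to the range of the projection
`p_σ`. What makes such a compression an equivalence is the same in all cases. The ambient
representation is generated by operators `e s` from the small space `W` to the large space `V`, and
the Gram operators `(e s)* (e t)` belong to the compressed representation. Hence an operator
between small spaces that intertwines the compressed representations extends to the large spaces
(`IsTotalFamily.exists_intertwiner`), which gives fullness and faithfulness. Conversely, a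
representation on `W` is a compression if its Gram kernel is positive definite, since then the
Kolmogorov decomposition (`exists_kolmogorov`) provides `V`. `⟨⟩_R`-positivity is positivity of the
kernel on the vectors `(Aₛ ζ)ₛ` with `Aₛ` in the represented algebra and a single `ζ`;
`matrix_form_nonneg` passes to all vectors by a decomposition into cyclic subspaces.

For the group, `p_σ = χ_{H_σ} σ` acts by the average of `σ(h) π(h)` over `H`. Its range consists of
the vectors with `π(h) ξ = σ(h)⁻¹ ξ`, so that compression gives the `ℂ`-linear equivalence for the
`(H, σ̄)`-smooth representations. The family is `e x = π(x)|_W` with `x ∈ G`, the Gram operators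
are the images of the elements `p_σ x⁻¹y p_σ`, which span the Hecke algebra, and their products are
computed by averages over finitely many elements of `H` (`HeckeTriple.gen_mul_gen`,
`HeckeTriple.coe_compress`). That restriction of functions to `G` is a `*`-homomorphism needs the
modular function of `G_σ` to restrict to `Δ_K` (`HeckeTriple.modularFun_j`). The `(H, σ)`-smooth
representations are reached by passing to complex conjugate Hilbert spaces, which is additive and
compatible with adjoints but conjugate-linear on morphisms.

For the ideal generated by a projection `p`, in the enveloping `C*`-algebra of a Banach `*`-algebra
`A`, the family is `e a = π(ap)|_W` with `a ∈ A`, and the Gram operators are the images of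
`p a*b p`. On the space constructed from a positive representation of `pAp`, left multiplication by
`a` is bounded by `‖a‖` (`ProjectionCorner.norm_sum_mul_le`), so it extends to the enveloping
`C*`-algebra.
-/

/-! ### Families of operators with given Gram operators -/

section OperatorKernels

open ContinuousLinearMap InnerProductSpace
open scoped InnerProductSpace

variable {S V V' W W' : Type*}
  [NormedAddCommGroup V] [InnerProductSpace ℂ V] [CompleteSpace V]
  [NormedAddCommGroup V'] [InnerProductSpace ℂ V'] [CompleteSpace V']
  [NormedAddCommGroup W] [InnerProductSpace ℂ W] [CompleteSpace W]
  [NormedAddCommGroup W'] [InnerProductSpace ℂ W'] [CompleteSpace W']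

/-- The ranges of the operators `e s : W → V` have dense linear span in `V`. -/
def IsTotalFamily (e : S → W →L[ℂ] V) : Prop :=
  (Submodule.span ℂ {v | ∃ s ξ, v = e s ξ}).topologicalClosure = ⊤

lemma IsTotalFamily.induction {e : S → W →L[ℂ] V} (he : IsTotalFamily e) (X : Submodule ℂ V)
    (hX : IsClosed (X : Set V)) (h : ∀ s ξ, e s ξ ∈ X) (v : V) : v ∈ X := by
  have h1 : (Submodule.span ℂ {v | ∃ s ξ, v = e s ξ}).topologicalClosure ≤ X :=
    Submodule.topologicalClosure_minimal _
      (Submodule.span_le.2 (by rintro _ ⟨s, ξ, rfl⟩; exact h s ξ)) hX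
  exact h1 (he ▸ Submodule.mem_top)

lemma IsTotalFamily.ext {E : Type*} [NormedAddCommGroup E] [NormedSpace ℂ E]
    {e : S → W →L[ℂ] V} (he : IsTotalFamily e) {A B : V →L[ℂ] E}
    (h : ∀ s ξ, A (e s ξ) = B (e s ξ)) : A = B := by
  ext v
  exact he.induction (LinearMap.eqLocus A.toLinearMap B.toLinearMap)
    (isClosed_eq A.continuous B.continuous) h v

lemma IsTotalFamily.eq_zero_of_inner {e : S → W →L[ℂ] V} (he : IsTotalFamily e) {v : V}
    (h : ∀ s ξ, ⟪e s ξ, v⟫_ℂ = 0) : v = 0 := by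
  have h1 : v ∈ (ℂ ∙ v)ᗮ := he.induction _ (Submodule.isClosed_orthogonal _) (fun s ξ ↦
    Submodule.mem_orthogonal_singleton_iff_inner_left.2 (h s ξ)) v
  exact inner_self_eq_zero.1 (Submodule.mem_orthogonal_singleton_iff_inner_left.1 h1)

/-- An assignment `e s ξ ↦ e' s ξ` that is bounded on linear combinations extends to a bounded
operator. -/
lemma IsTotalFamily.exists_extension {e : S → W →L[ℂ] V} (he : IsTotalFamily e)
    (e' : S → W →L[ℂ] V') {C : ℝ} (hC : 0 ≤ C)
    (h : ∀ (F : Finset S) (ξ : S → W), ‖∑ s ∈ F, e' s (ξ s)‖ ≤ C * ‖∑ s ∈ F, e s (ξ s)‖) :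
    ∃ A : V →L[ℂ] V', ‖A‖ ≤ C ∧ ∀ s ξ, A (e s ξ) = e' s ξ := by
  let L : (S →₀ W) →ₗ[ℂ] V := Finsupp.lsum ℂ fun s ↦ (e s).toLinearMap
  let L' : (S →₀ W) →ₗ[ℂ] V' := Finsupp.lsum ℂ fun s ↦ (e' s).toLinearMap
  have hL : DenseRange L := by
    intro v
    have h1 : v ∈ (Submodule.span ℂ {v | ∃ s ξ, v = e s ξ}).topologicalClosure :=
      he ▸ Submodule.mem_top
    refine closure_mono ?_ h1
    change (Submodule.span ℂ {v | ∃ s ξ, v = e s ξ} : Set V) ⊆ (LinearMap.range L : Set V)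
    refine SetLike.coe_subset_coe.2 (Submodule.span_le.2 ?_)
    rintro _ ⟨s, ξ, rfl⟩
    exact ⟨Finsupp.single s ξ, by simp [L]⟩
  have hb : ∀ x, ‖L' x‖ ≤ C * ‖L x‖ := fun x ↦ h x.support x
  refine ⟨L'.extendOfNorm L, LinearMap.opNorm_extendOfNorm_le hL hC hb, fun s ξ ↦ ?_⟩
  have := LinearMap.extendOfNorm_eq hL ⟨C, hb⟩ (Finsupp.single s ξ)
  simpa [L, L'] using this

lemma norm_sq_sum_eq (e : S → W →L[ℂ] V) (F : Finset S) (ξ : S → W) :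
    ‖∑ s ∈ F, e s (ξ s)‖ ^ 2 =
      (∑ s ∈ F, ∑ t ∈ F, ⟪ξ s, ((e s).adjoint ∘L e t) (ξ t)⟫_ℂ).re := by
  rw [← inner_self_eq_norm_sq (𝕜 := ℂ), sum_inner]
  simp only [inner_sum, ContinuousLinearMap.comp_apply, adjoint_inner_right]
  rfl

/-- An assignment between families with the same Gram operators extends to an operator. -/
lemma IsTotalFamily.exists_extension_of_gram_eq {e : S → W →L[ℂ] V} (he : IsTotalFamily e)
    (e' : S → W →L[ℂ] V')
    (h : ∀ s t, (e' s).adjoint ∘L e' t = (e s).adjoint ∘L e t) :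
    ∃ A : V →L[ℂ] V', ∀ s ξ, A (e s ξ) = e' s ξ := by
  suffices h' : ∀ (F : Finset S) (ξ : S → W),
      ‖∑ s ∈ F, e' s (ξ s)‖ ≤ 1 * ‖∑ s ∈ F, e s (ξ s)‖ by
    obtain ⟨A, -, hA⟩ := he.exists_extension e' zero_le_one h'
    exact ⟨A, hA⟩
  intro F ξ
  rw [one_mul]
  refine le_of_sq_le_sq ?_ (norm_nonneg _)
  rw [norm_sq_sum_eq, norm_sq_sum_eq]
  simp only [h, le_refl]

open scoped ComplexOrder in
/-- An operator `T` that intertwines the Gram operators `(e s)* (e t)` and `(e' s)* (e' t)` extends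
to a bounded operator with `e s ξ ↦ e' s (T ξ)`. With `C = (‖T‖² - T*T)^{1/2}`, which commutes with
the Gram operators, the bound is `‖T‖² ‖∑ e s ξₛ‖² - ‖∑ e' s T ξₛ‖² = ‖∑ e s C ξₛ‖² ≥ 0`. -/
lemma IsTotalFamily.exists_intertwiner {e : S → W →L[ℂ] V} (he : IsTotalFamily e)
    (e' : S → W' →L[ℂ] V') (T : W →L[ℂ] W')
    (h : ∀ s t, T ∘L ((e s).adjoint ∘L e t) = ((e' s).adjoint ∘L e' t) ∘L T) :
    ∃ A : V →L[ℂ] V', ∀ s ξ, A (e s ξ) = e' s (T ξ) := by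
  have h' : ∀ s t, ((e s).adjoint ∘L e t) ∘L T.adjoint =
      T.adjoint ∘L ((e' s).adjoint ∘L e' t) := fun s t ↦ by
    have := congrArg adjoint (h t s)
    simpa only [adjoint_comp, adjoint_adjoint] using this
  let D : W →L[ℂ] W := ((‖T‖ ^ 2 : ℝ) : ℂ) • (1 : W →L[ℂ] W) - T.adjoint ∘L T
  have hD : 0 ≤ D := by
    rw [nonneg_iff_isPositive, isPositive_def']
    refine ⟨IsSelfAdjoint.sub (IsSelfAdjoint.smul (Complex.conj_ofReal _) (.one _))
      (isPositive_adjoint_comp_self T).isSelfAdjoint, fun ξ ↦ ?_⟩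
    have e1 : ⟪D ξ, ξ⟫_ℂ = ((‖T‖ ^ 2 * ‖ξ‖ ^ 2 - ‖T ξ‖ ^ 2 : ℝ) : ℂ) := by
      have : D ξ = ((‖T‖ ^ 2 : ℝ) : ℂ) • ξ - T.adjoint (T ξ) := rfl
      rw [this, inner_sub_left, adjoint_inner_left, inner_smul_left,
        inner_self_eq_norm_sq_to_K, inner_self_eq_norm_sq_to_K, Complex.conj_ofReal]
      push_cast
      rfl
    have e2 : ‖T ξ‖ ^ 2 ≤ ‖T‖ ^ 2 * ‖ξ‖ ^ 2 := by
      rw [← mul_pow]; exact pow_le_pow_left₀ (norm_nonneg _) (T.le_opNorm ξ) 2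
    rw [reApplyInnerSelf_apply, e1]
    exact sub_nonneg.2 e2
  let C : W →L[ℂ] W := CFC.sqrt D
  have hCC : C * C = D := CFC.sqrt_mul_sqrt_self D
  have hCs : C.adjoint = C := (CFC.sqrt_nonneg D).isSelfAdjoint
  have hDc : ∀ s t, Commute D ((e s).adjoint ∘L e t) := fun s t ↦ by
    have : T.adjoint ∘L T ∘L ((e s).adjoint ∘L e t) =
        ((e s).adjoint ∘L e t) ∘L (T.adjoint ∘L T) := by
      rw [h, ← comp_assoc T.adjoint, ← h', comp_assoc]
    refine Commute.sub_left ((Commute.one_left _).smul_left _) ?_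
    exact this
  have hCc : ∀ s t, Commute C ((e s).adjoint ∘L e t) := fun s t ↦
    (hDc s t).cfcₙ_nnreal _
  have hb : ∀ (F : Finset S) (ξ : S → W),
      ‖∑ s ∈ F, (e' s ∘L T) (ξ s)‖ ≤ ‖T‖ * ‖∑ s ∈ F, e s (ξ s)‖ := by
    intro F ξ
    refine le_of_sq_le_sq ?_ (by positivity)
    rw [mul_pow, ← sub_nonneg]
    have key : ‖T‖ ^ 2 * ‖∑ s ∈ F, e s (ξ s)‖ ^ 2 - ‖∑ s ∈ F, (e' s ∘L T) (ξ s)‖ ^ 2 =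
        ‖∑ s ∈ F, (e s ∘L C) (ξ s)‖ ^ 2 := by
      rw [norm_sq_sum_eq, norm_sq_sum_eq, norm_sq_sum_eq, ← Complex.re_ofReal_mul, ← Complex.sub_re]
      congr 1
      rw [Finset.mul_sum, ← Finset.sum_sub_distrib]
      refine Finset.sum_congr rfl fun s _ ↦ ?_
      rw [Finset.mul_sum, ← Finset.sum_sub_distrib]
      refine Finset.sum_congr rfl fun t _ ↦ ?_
      have e1 : (e s ∘L C).adjoint ∘L (e t ∘L C) = D ∘L ((e s).adjoint ∘L e t) := by
        rw [adjoint_comp, hCs, ← hCC]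
        have := (hCc s t).eq
        change C * (adjoint (e s) ∘L e t * C) = C * C * (adjoint (e s) ∘L e t)
        rw [← this, mul_assoc]
      have e2 : (e' s ∘L T).adjoint ∘L (e' t ∘L T) =
          T.adjoint ∘L T ∘L ((e s).adjoint ∘L e t) := by
        rw [adjoint_comp, h]; rfl
      rw [e1, e2]
      have e3 (w : W) : D w = ((‖T‖ ^ 2 : ℝ) : ℂ) • w - T.adjoint (T w) := rfl
      simp only [ContinuousLinearMap.comp_apply, e3, inner_sub_right, inner_smul_right]
    rw [key]
    positivity
  obtain ⟨A, -, hA⟩ := he.exists_extension (fun s ↦ e' s ∘L T) (norm_nonneg T) hb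
  exact ⟨A, hA⟩

/-- A matrix `M` of operators from a unital `*`-algebra `𝒜` of operators on `W` is positive if
the forms `∑ ⟨Aₛ ζ, Mₛₜ Aₜ ζ⟩` with `Aₛ ∈ 𝒜` are. A vector of `Wⁿ` is split by the projections to
the cyclic subspaces of its entries, which reduce `𝒜`; in a cyclic subspace it is
approximated by vectors `(Aₛ ζ)ₛ`. -/
lemma matrix_form_nonneg (𝒜 : Submodule ℂ (W →L[ℂ] W)) (h1 : 1 ∈ 𝒜)
    (hmul : ∀ A ∈ 𝒜, ∀ B ∈ 𝒜, A * B ∈ 𝒜) (hstar : ∀ A ∈ 𝒜, star A ∈ 𝒜)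
    (M : S → S → (W →L[ℂ] W)) (hM : ∀ s t, M s t ∈ 𝒜) (F : Finset S)
    (hpos : ∀ (A : S → (W →L[ℂ] W)) (ζ : W), (∀ s, A s ∈ 𝒜) →
      0 ≤ (∑ s ∈ F, ∑ t ∈ F, ⟪A s ζ, M s t (A t ζ)⟫_ℂ).re) (ξ : S → W) :
    0 ≤ (∑ s ∈ F, ∑ t ∈ F, ⟪ξ s, M s t (ξ t)⟫_ℂ).re := by
  classical
  -- Induction on the set `E` of indices at which `ξ` may be nonzero.
  suffices h : ∀ (E : Finset S) (ξ : S → W), (∀ s, s ∈ F → s ∉ E → ξ s = 0) →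
      0 ≤ (∑ s ∈ F, ∑ t ∈ F, ⟪ξ s, M s t (ξ t)⟫_ℂ).re from
    h F ξ fun s h1 h2 ↦ absurd h1 h2
  intro E
  induction E using Finset.induction_on with
  | empty =>
    intro ξ hξ
    refine le_of_eq ?_
    rw [Finset.sum_eq_zero fun s hs ↦ Finset.sum_eq_zero fun t _ ↦ ?_, Complex.zero_re]
    rw [hξ s hs (Finset.notMem_empty s), inner_zero_left]
  | insert a E _ ih =>
    intro ξ hξ
    -- `Z` is the cyclic subspace of `ξ a`; the projection to `Zᗮ` makes the entry at `a` vanish.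
    let Z₀ : Submodule ℂ W := 𝒜.map (ContinuousLinearMap.apply ℂ W (ξ a)).toLinearMap
    let Z : Submodule ℂ W := Z₀.topologicalClosure
    have hZc : IsClosed (Z : Set W) := Z₀.isClosed_topologicalClosure
    have : CompleteSpace Z := hZc.completeSpace_coe
    have hinv : ∀ A ∈ 𝒜, ∀ z ∈ Z, A z ∈ Z := by
      intro A hA z hz
      refine map_mem_closure A.continuous hz fun w hw ↦ ?_
      obtain ⟨B, hB, rfl⟩ := hw
      exact ⟨A * B, hmul A hA B hB, rfl⟩
    have haZ : ξ a ∈ Z := subset_closure ⟨1, h1, rfl⟩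
    have horth : ∀ A ∈ 𝒜, ∀ z ∈ Zᗮ, A z ∈ Zᗮ := by
      intro A hA z hz w hw
      rw [← adjoint_inner_left]
      exact hz _ (hinv _ (hstar A hA) w hw)
    let η : S → W := fun s ↦ Z.starProjection (ξ s)
    let θ : S → W := fun s ↦ ξ s - Z.starProjection (ξ s)
    have hη : ∀ s, η s ∈ Z := fun s ↦ Z.starProjection_apply_mem _
    have hθ : ∀ s, θ s ∈ Zᗮ := fun s ↦ Z.sub_starProjection_mem_orthogonal _
    have hsplit : ∀ s t, ⟪ξ s, M s t (ξ t)⟫_ℂ =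
        ⟪η s, M s t (η t)⟫_ℂ + ⟪θ s, M s t (θ t)⟫_ℂ := by
      intro s t
      have e1 : ∀ u, ξ u = η u + θ u := fun u ↦ by simp [η, θ]
      have z1 : ⟪η s, M s t (θ t)⟫_ℂ = 0 := horth _ (hM s t) _ (hθ t) _ (hη s)
      have z2 : ⟪θ s, M s t (η t)⟫_ℂ = 0 :=
        Submodule.inner_left_of_mem_orthogonal (hinv _ (hM s t) _ (hη t)) (hθ s)
      rw [e1 s, e1 t, map_add, inner_add_left, inner_add_right, inner_add_right, z1, z2]
      ring
    simp only [hsplit, Finset.sum_add_distrib, Complex.add_re]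
    refine add_nonneg ?_ (ih θ fun s hs hsE ↦ ?_)
    · have hcl : IsClosed {v : S → W | 0 ≤ (∑ s ∈ F, ∑ t ∈ F, ⟪v s, M s t (v t)⟫_ℂ).re} := by
        refine isClosed_le continuous_const ?_
        fun_prop
      have hmem : η ∈ closure (Set.univ.pi fun _ : S ↦ (Z₀ : Set W)) := by
        rw [closure_pi_set]
        exact fun s _ ↦ hη s
      refine closure_minimal ?_ hcl hmem
      intro v hv
      choose A hA hAv using fun s ↦ hv s (Set.mem_univ s)
      have : v = fun s ↦ A s (ξ a) := funext fun s ↦ (hAv s).symm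
      rw [this]
      exact hpos A (ξ a) hA
    · by_cases hsa : s = a
      · have : Z.starProjection (ξ s) = ξ s :=
          Submodule.starProjection_eq_self_iff.2 (hsa ▸ haZ)
        simp [θ, this]
      · have : ξ s = 0 := hξ s hs (by simp [hsa, hsE])
        simp [θ, this]

/-- The Kolmogorov decomposition of a positive definite operator-valued kernel: the space `V` is
the reproducing kernel Hilbert space of `M`. -/
lemma exists_kolmogorov.{a, b} {S : Type a} {W : Type b} [NormedAddCommGroup W]
    [InnerProductSpace ℂ W] [CompleteSpace W] (M : S → S → (W →L[ℂ] W))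
    (hM : ∀ s t, star (M s t) = M t s)
    (hpos : ∀ (F : Finset S) (ξ : S → W), 0 ≤ (∑ s ∈ F, ∑ t ∈ F, ⟪ξ s, M s t (ξ t)⟫_ℂ).re) :
    ∃ (V : Type (max a b)) (_ : NormedAddCommGroup V) (_ : InnerProductSpace ℂ V)
      (_ : CompleteSpace V) (e : S → W →L[ℂ] V), IsTotalFamily e ∧
        ∀ s t, (e s).adjoint ∘L e t = M s t := by
  let K : Matrix S S (W →L[ℂ] W) := .of M
  have hK : K.PosSemidef := by
    have tfae := (RKHS.posSemidef_tfae (K := K)).out 0 2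
    refine tfae.2 ⟨Matrix.IsHermitian.ext fun s t ↦ hM t s, fun f ↦ ?_⟩
    refine (hpos f.support f).trans_eq ?_
    change _ = (f.sum fun s v ↦ f.sum fun t v' ↦ ⟪K t s v, v'⟫_ℂ).re
    refine congrArg _ (Finset.sum_congr rfl fun s _ ↦ Finset.sum_congr rfl fun t _ ↦ ?_)
    change ⟪f s, M s t (f t)⟫_ℂ = ⟪M t s (f s), f t⟫_ℂ
    rw [← hM s t, star_eq_adjoint, adjoint_inner_left]
  have : Fact K.PosSemidef := ⟨hK⟩
  refine ⟨RKHS.OfKernel K, inferInstance, inferInstance, inferInstance,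
    RKHS.kerFun (𝕜 := ℂ) (RKHS.OfKernel K), ?_, fun s t ↦ ?_⟩
  · rw [IsTotalFamily, ← RKHS.kerFun_dense (𝕜 := ℂ) (RKHS.OfKernel K)]
    congr 2
    ext v
    constructor
    · rintro ⟨s, ξ, rfl⟩; exact ⟨s, ξ, rfl⟩
    · rintro ⟨s, ξ, rfl⟩; exact ⟨s, ξ, rfl⟩
  · rw [← RKHS.kernel_apply, RKHS.OfKernel.kernel_ofKernel]
    rfl

end OperatorKernels

/-! ### Translations in the convolution algebra -/

section Translation

open MeasureTheory Measure
open scoped ComplexConjugate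

namespace ConvAlg

variable {L : Type*} [Group L] [TopologicalSpace L] [IsTopologicalGroup L]
  [MeasurableSpace L] [BorelSpace L] {μ : Measure L}

/-- Left translation `(λ_g f)(u) = f(g⁻¹u)` on `C_c(L)`. -/
def leftTranslate (g : L) : ConvAlg μ →ₗ[ℂ] ConvAlg μ where
  toFun f :=
    { toFun := fun u ↦ f (g⁻¹ * u)
      continuous' := f.continuous'.comp (continuous_const_mul _)
      compact' := f.compact'.comp_homeomorph (Homeomorph.mulLeft g⁻¹) }
  map_add' _ _ := rfl
  map_smul' _ _ := rfl

lemma leftTranslate_apply (g : L) (f : ConvAlg μ) (u : L) : leftTranslate g f u = f (g⁻¹ * u) := rfl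

lemma leftTranslate_leftTranslate (g h : L) (f : ConvAlg μ) :
    leftTranslate g (leftTranslate h f) = leftTranslate (g * h) f := by
  ext u
  simp [leftTranslate_apply, mul_assoc]

lemma leftTranslate_one (f : ConvAlg μ) : leftTranslate 1 f = f := by
  ext u
  simp [leftTranslate_apply]

lemma sum_apply {ι : Type*} (s : Finset ι) (f : ι → ConvAlg μ) (u : L) :
    (∑ i ∈ s, f i) u = ∑ i ∈ s, f i u := by
  classical
  induction s using Finset.induction_on with
  | empty => rfl
  | insert a s ha ih => rw [Finset.sum_insert ha, Finset.sum_insert ha, add_apply, ih]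

variable [LocallyCompactSpace L] [IsHaarMeasure μ]

lemma integral_mul_right_complex {f : L → ℂ} (hf : Continuous f) (hf' : HasCompactSupport f)
    (z : L) : ∫ x, f (x * z) ∂μ = modularFun z⁻¹ * ∫ x, f x ∂μ := by
  have hi : Integrable f μ := hf.integrable_of_hasCompactSupport hf'
  have hi' : Integrable (fun x ↦ f (x * z)) μ :=
    (hf.comp (continuous_mul_const z)).integrable_of_hasCompactSupport
      (hf'.comp_homeomorph (Homeomorph.mulRight z))
  rw [← integral_re_add_im hi, ← integral_re_add_im hi',
    integral_mul_right (f := fun x ↦ RCLike.re (f x)) (by fun_prop) (hf'.comp_left (by simp)),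
    integral_mul_right (f := fun x ↦ RCLike.im (f x)) (by fun_prop) (hf'.comp_left (by simp))]
  simp only [RCLike.ofReal_mul, mul_add, mul_assoc]
  rfl

lemma leftTranslate_mul (g : L) (f h : ConvAlg μ) :
    leftTranslate g (f * h) = leftTranslate g f * h := by
  ext u
  rw [leftTranslate_apply, mul_apply, mul_apply,
    ← integral_mul_left_eq_self (fun y ↦ leftTranslate g f y * h (y⁻¹ * u)) g]
  simp [leftTranslate_apply, mul_assoc]

lemma star_leftTranslate_mul (g : L) (f h : ConvAlg μ) :
    star (leftTranslate g f) * h = star f * leftTranslate g⁻¹ h := by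
  ext u
  let Φ : L → ℂ := fun y ↦ star f y * leftTranslate g⁻¹ h (y⁻¹ * u)
  have hΦ : Continuous Φ := (star f).continuous'.mul
    ((leftTranslate g⁻¹ h).continuous'.comp (by fun_prop))
  have hΦ' : HasCompactSupport Φ := (star f).compact'.mul_right
  have e1 : ∀ y, star (leftTranslate g f) y * h (y⁻¹ * u) = modularFun g * Φ (y * g) := by
    intro y
    have e2 : modularFun y⁻¹ = modularFun g * modularFun (y * g)⁻¹ := by
      rw [← modularFun_mul]; simp
    simp only [Φ, star_apply, leftTranslate_apply, e2, mul_inv_rev, inv_inv, mul_assoc,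
      mul_inv_cancel_left, Complex.ofReal_mul]
  rw [mul_apply, mul_apply]
  simp only [e1]
  rw [integral_const_mul, integral_mul_right_complex hΦ hΦ', ← mul_assoc, ← Complex.ofReal_mul,
    mul_comm (modularFun g), modularFun_inv_mul, Complex.ofReal_one, one_mul]

end ConvAlg

end Translation

/-! ### Restriction of functions from the Schlichting completion -/

section Restriction

open MeasureTheory Set Topology
open scoped ComplexConjugate Pointwise

namespace HeckeTriple

variable {G : Type u} [Group G] (T : HeckeTriple G)

/-- Functions in `C_c(G_σ)` are determined by their values on `G`, which is dense. -/
lemma ext_of_j {f g : ConvAlg T.μ} (h : ∀ x, f (T.j x) = g (T.j x)) : f = g := by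
  ext u
  exact congrFun (T.denseRange_j.equalizer f.continuous' g.continuous' (funext h)) u

lemma mul_p_apply_mul (f : ConvAlg T.μ) (u : T.Gσ) (h : T.H) :
    (f * T.p) (u * T.j h) = (f * T.p) u * T.σ h := by
  rw [ConvAlg.mul_apply, ConvAlg.mul_apply, ← integral_mul_const]
  congr 1 with y
  rw [← mul_assoc, T.p_mul_right h.2, mul_assoc]

lemma σ_mul_σ_inv (h : T.H) : (T.σ h : ℂ) * T.σ h⁻¹ = 1 := by
  rw [← Circle.coe_mul, ← map_mul, mul_inv_cancel, map_one, Circle.coe_one]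

lemma integral_eq_of_Hσ {F : T.Gσ → ℂ} (hF : Continuous F) {c : ℂ}
    (h1 : ∀ h : T.H, F (T.j h) = c) (h0 : ∀ u ∉ T.Hσ, F u = 0) : ∫ u, F u ∂T.μ = c := by
  have h : ∀ y, F y = Set.indicator (T.Hσ : Set T.Gσ) (fun _ ↦ c) y := by
    intro y
    by_cases hy : y ∈ (T.Hσ : Set T.Gσ)
    · rw [Set.indicator_of_mem hy]
      refine closure_minimal ?_ (isClosed_eq hF (continuous_const (y := c))) hy
      rintro _ ⟨g, hg, rfl⟩
      exact h1 ⟨g, hg⟩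
    · rw [Set.indicator_of_notMem hy, h0 y hy]
  simp only [h]
  rw [integral_indicator_const _ T.isOpen_Hσ.measurableSet, measureReal_def, μ_Hσ]
  simp

/-- The elements of `p_σ C_c(G_σ)` are the functions with `f(hx) = σ(h) f(x)`. -/
lemma p_mul_eq_self {f : ConvAlg T.μ}
    (hf : ∀ (h : T.H) (x : G), f (T.j (h * x)) = T.σ h * f (T.j x)) : T.p * f = f := by
  have hp := T.p.continuous'
  have hc := f.continuous'
  refine T.ext_of_j fun x ↦ ?_
  rw [ConvAlg.mul_apply]
  refine T.integral_eq_of_Hσ (by fun_prop) (fun h ↦ ?_) fun u hu ↦ ?_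
  · rw [T.p_j_of_mem h.2, ← map_inv, ← map_mul]
    have := hf h⁻¹ x
    rw [InvMemClass.coe_inv] at this
    rw [this, ← mul_assoc, σ_mul_σ_inv, one_mul]
  · rw [T.p_eq_zero hu, zero_mul]

lemma app_j_one (g : G) : app (T.j g) ((1 : G) : G ⧸ T.K) = (g : G ⧸ T.K) := by
  rw [app_j, MulAction.Quotient.smul_mk, smul_eq_mul, mul_one]

lemma finite_support_out {A : Subgroup G} (hA : T.K ≤ A) (f : ConvAlg T.μ) :
    (Function.support fun q : G ⧸ A ↦ f (T.j q.out)).Finite := by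
  have hfin : ((fun u : T.Gσ ↦ app u ((1 : G) : G ⧸ T.K)) '' tsupport f.toFun).Finite :=
    (f.compact'.isCompact.image (T.continuous_app _)).finite_of_discrete
  refine (hfin.image fun r ↦ ((r.out : G) : G ⧸ A)).subset fun q hq ↦ ?_
  refine ⟨(q.out : G ⧸ T.K), ⟨T.j q.out, subset_tsupport _ hq, T.app_j_one _⟩, ?_⟩
  obtain ⟨k, hk⟩ := QuotientGroup.mk_out_eq_mul T.K q.out
  change (((q.out : G ⧸ T.K).out : G) : G ⧸ A) = q
  rw [hk]
  conv_rhs => rw [← q.out_eq']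
  exact QuotientGroup.eq.2 (by simpa using A.inv_mem (hA k.2))

/-- A function that is equivariant under right translations by `A` is a combination of the
translates of a function `e` on `A` with the same equivariance. -/
lemma eq_sum_leftTranslate {A : Subgroup G} (hA : T.K ≤ A) {f e : ConvAlg T.μ}
    (he : ∀ g ∉ A, e (T.j g) = 0)
    (hfe : ∀ (g : G), ∀ a ∈ A, f (T.j g) * e (T.j a) = f (T.j (g * a))) :
    f = ∑ q ∈ (T.finite_support_out hA f).toFinset,
      f (T.j q.out) • ConvAlg.leftTranslate (T.j q.out) e := by
  classical
  refine T.ext_of_j fun x ↦ ?_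
  have hx : (x : G ⧸ A).out⁻¹ * x ∈ A := QuotientGroup.eq.1 (Quotient.out_eq' (x : G ⧸ A))
  have hval : f (T.j (x : G ⧸ A).out) * e (T.j ((x : G ⧸ A).out⁻¹ * x)) = f (T.j x) := by
    rw [hfe _ _ hx, mul_inv_cancel_left]
  rw [ConvAlg.sum_apply, Finset.sum_eq_single (x : G ⧸ A)]
  · rw [ConvAlg.smul_apply, ConvAlg.leftTranslate_apply, ← map_inv, ← map_mul, hval]
  · intro q _ hq
    rw [ConvAlg.smul_apply, ConvAlg.leftTranslate_apply, ← map_inv, ← map_mul, he, mul_zero]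
    intro h
    exact hq ((Quotient.out_eq' q).symm.trans (QuotientGroup.eq.2 h))
  · intro h
    rw [Set.Finite.mem_toFinset, Function.mem_support, not_not] at h
    rw [ConvAlg.smul_apply, h, zero_mul]

/-- The integral of a right `A`-invariant function in `C_c(G_σ)`, where `K ≤ A ≤ H`, as a sum over
`G/A`. The constant `c` is the measure of the closure of `A`. -/
lemma exists_integral_eq_sum {A : Subgroup G} (hKA : T.K ≤ A) (hAH : A ≤ T.H) :
    ∃ c : ℂ, c ≠ 0 ∧ (A = T.H → c = 1) ∧ ∀ f : ConvAlg T.μ,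
      (∀ (g : G), ∀ a ∈ A, f (T.j (g * a)) = f (T.j g)) →
        ∫ u, f u ∂T.μ = c * ∑ᶠ q : G ⧸ A, f (T.j q.out) := by
  classical
  let Y : Set (G ⧸ T.K) := (fun a : G ↦ (a : G ⧸ T.K)) '' A
  let E : Set T.Gσ := (fun u ↦ app u ((1 : G) : G ⧸ T.K)) ⁻¹' Y
  have hEo : IsOpen E := (isOpen_discrete Y).preimage (T.continuous_app _)
  have hEc : IsClosed E := (isClosed_discrete Y).preimage (T.continuous_app _)
  have hEH : E ⊆ T.Hσ := by
    rintro u ⟨a, ha, hu⟩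
    exact T.mem_Hσ.2 ⟨a, hAH ha, hu⟩
  have hmem : ∀ g, T.j g ∈ E ↔ g ∈ A := by
    intro g
    change app (T.j g) ((1 : G) : G ⧸ T.K) ∈ Y ↔ _
    rw [T.app_j_one]
    refine ⟨?_, fun h ↦ ⟨g, h, rfl⟩⟩
    rintro ⟨a, ha, h⟩
    simpa using A.mul_mem ha (hKA (QuotientGroup.eq.1 h))
  let e : ConvAlg T.μ :=
    { toFun := E.indicator fun _ ↦ 1
      continuous' := continuous_const.indicator
        (by simp [(show IsClopen E from ⟨hEc, hEo⟩).frontier_eq])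
      compact' := HasCompactSupport.intro (T.isCompact_Hσ.of_isClosed_subset hEc hEH)
        fun x hx ↦ Set.indicator_of_notMem hx _ }
  have hej : ∀ g, e (T.j g) = if g ∈ A then 1 else 0 := fun g ↦ by
    change E.indicator (fun _ ↦ (1 : ℂ)) (T.j g) = _
    rw [Set.indicator_apply]
    simp only [hmem]
  have hc : ∫ u, e u ∂T.μ = (T.μ.real E : ℂ) := by
    change ∫ u, E.indicator (fun _ ↦ (1 : ℂ)) u ∂T.μ = _
    rw [integral_indicator_const _ hEo.measurableSet]
    simp
  refine ⟨∫ u, e u ∂T.μ, ?_, ?_, ?_⟩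
  · rw [hc, Complex.ofReal_ne_zero, measureReal_def, ENNReal.toReal_ne_zero]
    refine ⟨(hEo.measure_pos T.μ ⟨1, ?_⟩).ne', ?_⟩
    · rw [← map_one T.j, hmem]; exact A.one_mem
    · exact ((measure_mono hEH).trans_lt (T.μ_Hσ.trans_lt ENNReal.one_lt_top)).ne
  · rintro rfl
    have : E = T.Hσ := by ext u; exact T.mem_Hσ.symm
    rw [hc, this, measureReal_def, μ_Hσ]
    simp
  · intro f hf
    have h1 := T.eq_sum_leftTranslate hKA (f := f) (e := e)
      (fun g hg ↦ by rw [hej, if_neg hg]) (fun g a ha ↦ by rw [hej, if_pos ha, mul_one, hf g a ha])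
    have h2 : ∫ u, f u ∂T.μ = ∑ q ∈ (T.finite_support_out hKA f).toFinset,
        ∫ u, (f (T.j q.out) • ConvAlg.leftTranslate (T.j q.out) e) u ∂T.μ := by
      conv_lhs => rw [h1]
      simp only [ConvAlg.sum_apply]
      exact integral_finsetSum _ fun q _ ↦ ConvAlg.integrable _
    rw [h2, finsum_eq_sum_of_support_subset _
      (s := (T.finite_support_out hKA f).toFinset) (by simp), Finset.mul_sum]
    refine Finset.sum_congr rfl fun q _ ↦ ?_
    simp only [ConvAlg.smul_apply, ConvAlg.leftTranslate_apply]
    rw [integral_const_mul, integral_mul_left_eq_self, mul_comm]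

/-! ### Multiplicativity of the restriction map -/

lemma corner_p_mul (f : starCorner T.p T.star_p) : T.p * f.1 = f.1 := by
  obtain ⟨_, a, rfl⟩ := f
  simp only [← mul_assoc, p_mul_p]

lemma corner_mul_p (f : starCorner T.p T.star_p) : f.1 * T.p = f.1 := by
  obtain ⟨_, a, rfl⟩ := f
  simp only [mul_assoc, p_mul_p]

lemma restrict_mul (f g : starCorner T.p T.star_p) :
    T.restrict (f * g) = T.restrict f * T.restrict g := by
  refine Subtype.ext (funext fun x ↦ ?_)
  change (f.1 * g.1) (T.j x) = conv (T := T) (T.restrict f).1 (T.restrict g).1 x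
  obtain ⟨c, -, hc, h⟩ := T.exists_integral_eq_sum T.K_le le_rfl
  let F : ConvAlg T.μ :=
    { toFun := fun y ↦ f.1 y * g.1 (y⁻¹ * T.j x)
      continuous' := f.1.continuous'.mul (g.1.continuous'.comp (by fun_prop))
      compact' := f.1.compact'.mul_right }
  have hF : ∀ y, F (T.j y) = (T.restrict f).1 y * (T.restrict g).1 (y⁻¹ * x) := fun y ↦ by
    change f.1 (T.j y) * g.1 ((T.j y)⁻¹ * T.j x) = _
    rw [← map_inv, ← map_mul]
    rfl
  have := h F fun y a ha ↦ by rw [hF, hF]; exact conv_rep _ _ x y ⟨a, ha⟩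
  rw [ConvAlg.mul_apply]
  refine this.trans ?_
  rw [hc rfl, one_mul, conv]
  simp only [hF]

/-! ### The modular function of the completion -/

lemma mem_orbit_mk {A : Subgroup G} {x g : G} :
    (g : G ⧸ A) ∈ MulAction.orbit A (x : G ⧸ A) ↔ ∃ a ∈ A, ∃ b ∈ A, g = a * x * b := by
  constructor
  · rintro ⟨a, ha⟩
    have h : (a * x : G)⁻¹ * g ∈ A := QuotientGroup.eq.1 ha
    exact ⟨a, a.2, _, h, by group⟩
  · rintro ⟨a, ha, b, hb, rfl⟩
    exact ⟨⟨a, ha⟩, QuotientGroup.eq.2 (by simpa [mul_assoc] using hb)⟩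

lemma conjIndex_eq_ncard (A : Subgroup G) (x : G) :
    conjIndex A x = (MulAction.orbit A (x : G ⧸ A)).ncard := by
  rw [← MulAction.index_stabilizer, conjIndex, Subgroup.relIndex]
  congr 1
  ext a
  rw [MulAction.mem_stabilizer_iff, Subgroup.mem_subgroupOf]
  change _ ↔ ((a * x : G) : G ⧸ A) = (x : G ⧸ A)
  rw [eq_comm, QuotientGroup.eq, Subgroup.mem_map]
  constructor
  · rintro ⟨b, hb, h⟩
    have : (a : G) = x * b * x⁻¹ := by simpa using h.symm
    rw [this]; simpa [mul_assoc] using hb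
  · intro h
    exact ⟨_, h, by simp [mul_assoc]⟩

lemma finite_orbit_K (x : G) : (MulAction.orbit T.K (x : G ⧸ T.K)).Finite := by
  refine (T.finite_smul (x : G ⧸ T.K)).subset ?_
  rintro _ ⟨k, rfl⟩
  exact ⟨k, T.K_le k.2, rfl⟩

/-- The modular function of `G_σ` restricts to `Δ_K`: the double coset `K_σ x K_σ` consists of
`[K : K ∩ xKx⁻¹]` left cosets of `K_σ`, its inverse of `[K : K ∩ x⁻¹Kx]`, and `Δ` is constant on
it. -/
lemma modularFun_j (x : G) : ConvAlg.modularFun (T.j x) = T.ΔK x := by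
  classical
  obtain ⟨c, hc, -, hint⟩ := T.exists_integral_eq_sum le_rfl T.K_le
  let Y : Set (G ⧸ T.K) := MulAction.orbit T.K (x : G ⧸ T.K)
  let E : Set T.Gσ := (fun u ↦ app u ((1 : G) : G ⧸ T.K)) ⁻¹' Y
  have hE : IsClopen E := (isClopen_discrete Y).preimage (T.continuous_app _)
  have hmem : ∀ g, T.j g ∈ E ↔ (g : G ⧸ T.K) ∈ Y := fun g ↦ by
    change app (T.j g) ((1 : G) : G ⧸ T.K) ∈ Y ↔ _
    rw [T.app_j_one]
  let r : T.Gσ → ℝ := E.indicator fun _ ↦ 1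
  have hr : Continuous r := continuous_const.indicator (by simp [hE.frontier_eq])
  have hr' : HasCompactSupport r := by
    refine HasCompactSupport.intro (K := (T.Hσ : Set T.Gσ) * {T.j x} * (T.Hσ : Set T.Gσ))
      ((T.isCompact_Hσ.mul isCompact_singleton).mul T.isCompact_Hσ) fun u hu ↦ ?_
    refine Set.indicator_of_notMem (fun hE ↦ hu ?_) _
    obtain ⟨k, hk⟩ := hE
    refine ⟨T.j k * T.j x, ⟨_, T.j_mem_Hσ.2 (T.K_le k.2), _, rfl, rfl⟩,
      (T.j k * T.j x)⁻¹ * u, ?_, by group⟩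
    refine T.mem_Hσ.2 ?_
    have e1 : app u ((1 : G) : G ⧸ T.K) = app (T.j k * T.j x) ((1 : G) : G ⧸ T.K) := by
      rw [← map_mul, T.app_j_one]
      exact hk.symm
    rw [app_mul, e1, ← app_mul, inv_mul_cancel]
    exact ⟨1, T.H.one_mem, rfl⟩
  let F : ConvAlg T.μ :=
    { toFun := fun u ↦ (r u : ℂ)
      continuous' := by fun_prop
      compact' := hr'.comp_left (g := fun t : ℝ ↦ (t : ℂ)) Complex.ofReal_zero }
  have hF : ∀ g, F (T.j g) = if (g : G ⧸ T.K) ∈ Y then 1 else 0 := fun g ↦ by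
    change ((E.indicator (fun _ ↦ (1 : ℝ)) (T.j g) : ℝ) : ℂ) = _
    rw [Set.indicator_apply]
    simp only [hmem]
    split_ifs <;> simp
  have hFs : ∀ g, star F (T.j g) = ConvAlg.modularFun (T.j x) *
      if (g : G ⧸ T.K) ∈ MulAction.orbit T.K ((x⁻¹ : G) : G ⧸ T.K) then 1 else 0 := fun g ↦ by
    rw [ConvAlg.star_apply, ← map_inv, hF]
    have e1 : ((g⁻¹ : G) : G ⧸ T.K) ∈ Y ↔
        (g : G ⧸ T.K) ∈ MulAction.orbit T.K ((x⁻¹ : G) : G ⧸ T.K) := by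
      rw [mem_orbit_mk, mem_orbit_mk]
      constructor
      · rintro ⟨a, ha, b, hb, h⟩
        exact ⟨b⁻¹, T.K.inv_mem hb, a⁻¹, T.K.inv_mem ha, by rw [← inv_inv g, h]; group⟩
      · rintro ⟨a, ha, b, hb, rfl⟩
        exact ⟨b⁻¹, T.K.inv_mem hb, a⁻¹, T.K.inv_mem ha, by group⟩
    by_cases h : ((g⁻¹ : G) : G ⧸ T.K) ∈ Y
    · rw [if_pos h, if_pos (e1.1 h)]
      obtain ⟨a, ha, b, hb, h⟩ := mem_orbit_mk.1 h
      rw [h, map_mul, map_mul, ConvAlg.modularFun_mul, ConvAlg.modularFun_mul,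
        T.modularFun_of_mem (T.j_mem_Hσ.2 (T.K_le ha)),
        T.modularFun_of_mem (T.j_mem_Hσ.2 (T.K_le hb))]
      simp
    · rw [if_neg h, if_neg (fun h' ↦ h (e1.2 h'))]
      simp
  have hsum : ∀ y : G, ∑ᶠ q : G ⧸ T.K,
      (if q ∈ MulAction.orbit T.K (y : G ⧸ T.K) then (1 : ℂ) else 0) = conjIndex T.K y := by
    intro y
    rw [conjIndex_eq_ncard, Set.ncard_eq_toFinset_card _ (T.finite_orbit_K y),
      finsum_eq_sum_of_support_subset _ (s := (T.finite_orbit_K y).toFinset) (by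
        intro q hq
        simpa using hq)]
    rw [Finset.sum_congr rfl fun q hq ↦ if_pos ((T.finite_orbit_K y).mem_toFinset.1 hq)]
    simp
  have hinv : ∀ (y g : G), ∀ a ∈ T.K, ((g * a : G) : G ⧸ T.K) ∈
      MulAction.orbit T.K (y : G ⧸ T.K) ↔ (g : G ⧸ T.K) ∈ MulAction.orbit T.K (y : G ⧸ T.K) := by
    intro y g a ha
    have : ((g * a : G) : G ⧸ T.K) = g := (QuotientGroup.eq.2 (by simpa using ha)).symm
    rw [this]
  have h1 : ∫ u, F u ∂T.μ = c * conjIndex T.K x := by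
    rw [hint F fun g a ha ↦ by rw [hF, hF, hinv x g a ha]]
    simp only [hF, Quotient.out_eq', Y, hsum]
  have h2 : ∫ u, star F u ∂T.μ = c * (ConvAlg.modularFun (T.j x) * conjIndex T.K x⁻¹) := by
    rw [hint (star F) fun g a ha ↦ by rw [hFs, hFs, hinv x⁻¹ g a ha]]
    simp only [hFs, QuotientGroup.out_eq']
    have hfin : (Function.support fun q : G ⧸ T.K ↦
        if q ∈ MulAction.orbit T.K ((x⁻¹ : G) : G ⧸ T.K) then (1 : ℂ) else 0).Finite :=
      (T.finite_orbit_K x⁻¹).subset fun q hq ↦ by simpa using hq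
    rw [← hsum x⁻¹, ← mul_finsum' _ _ hfin]
  have h3 : ∫ u, star F u ∂T.μ = ∫ u, F u ∂T.μ := by
    have e1 : ∀ u, star F u = ((ConvAlg.modularFun u⁻¹ * r u⁻¹ : ℝ) : ℂ) := fun u ↦ by
      rw [ConvAlg.star_apply]
      change _ * conj ((r u⁻¹ : ℝ) : ℂ) = _
      rw [Complex.conj_ofReal, Complex.ofReal_mul]
    have e2 : ∀ u, F u = (r u : ℂ) := fun u ↦ rfl
    simp only [e1, e2]
    rw [integral_complex_ofReal, integral_complex_ofReal, ConvAlg.integral_modularFun_inv hr hr']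
  have h4 : conjIndex T.K x⁻¹ ≠ 0 := by
    rw [conjIndex_eq_ncard]
    exact (Set.ncard_pos (T.finite_orbit_K _)).2 (MulAction.nonempty_orbit _) |>.ne'
  rw [h1, h2] at h3
  have h5 := mul_left_cancel₀ hc h3
  rw [ΔK, eq_div_iff (by exact_mod_cast h4)]
  exact_mod_cast h5

lemma restrict_star (f : starCorner T.p T.star_p) : T.restrict (star f) = star (T.restrict f) := by
  refine Subtype.ext (funext fun x ↦ ?_)
  change (ConvAlg.modularFun (T.j x)⁻¹ : ℂ) * conj (f.1 (T.j x)⁻¹) =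
    (T.ΔK x⁻¹ : ℂ) * conj (f.1 (T.j x⁻¹))
  rw [← map_inv, modularFun_j]

/-- The restriction map to `H_σ(G, H)` as a linear map. -/
noncomputable def restrictₗ : starCorner T.p T.star_p →ₗ[ℂ] T.heckeAlgebra where
  toFun := T.restrict
  map_add' _ _ := rfl
  map_smul' _ _ := rfl

/-! ### The generators `p_σ x p_σ` of the Hecke algebra -/

/-- The element `p_σ x p_σ` of `p_σ C_c(G_σ) p_σ`. -/
noncomputable def cornerGen (x : G) : starCorner T.p T.star_p :=
  ⟨T.p * ConvAlg.leftTranslate (T.j x) T.p, ConvAlg.leftTranslate (T.j x) T.p, by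
    rw [mul_assoc, ← ConvAlg.leftTranslate_mul, p_mul_p]⟩

/-- The element `p_σ x p_σ` of the Hecke algebra. It is supported in `HxH`. -/
noncomputable def gen (x : G) : T.heckeAlgebra := T.restrict (T.cornerGen x)

lemma leftTranslate_p (h : T.H) :
    ConvAlg.leftTranslate (T.j h) T.p = (T.σ h⁻¹ : ℂ) • T.p := by
  ext u
  rw [ConvAlg.leftTranslate_apply, ConvAlg.smul_apply, ← map_inv]
  exact T.p_mul_left (h⁻¹).2 u

lemma p_mul_leftTranslate (h : T.H) (f : ConvAlg T.μ) :
    T.p * ConvAlg.leftTranslate (T.j h) f = (T.σ h⁻¹ : ℂ) • (T.p * f) := by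
  have h1 := ConvAlg.star_leftTranslate_mul (T.j (h⁻¹ : T.H)) T.p f
  rw [leftTranslate_p, inv_inv, star_smul, star_p, smul_mul_assoc] at h1
  have e : (T.j (h⁻¹ : T.H))⁻¹ = T.j h := by simp
  rw [e] at h1
  rw [← h1, map_inv, Circle.coe_inv_eq_conj]
  rfl

lemma star_gen (x : G) : star (T.gen x) = T.gen x⁻¹ := by
  rw [gen, ← restrict_star, gen]
  congr 1
  refine Subtype.ext ?_
  change star (T.p * ConvAlg.leftTranslate (T.j x) T.p) =
    T.p * ConvAlg.leftTranslate (T.j x⁻¹) T.p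
  have := ConvAlg.star_leftTranslate_mul (T.j x) T.p T.p
  rw [star_mul, star_p, this, star_p, map_inv]

lemma gen_mul_right (x : G) (h : T.H) : T.gen (x * h) = (T.σ h⁻¹ : ℂ) • T.gen x := by
  change T.restrictₗ _ = _ • T.restrictₗ _
  rw [← map_smul]
  congr 1
  refine Subtype.ext ?_
  change T.p * ConvAlg.leftTranslate (T.j (x * h)) T.p =
    (T.σ h⁻¹ : ℂ) • (T.p * ConvAlg.leftTranslate (T.j x) T.p)
  rw [map_mul, ← ConvAlg.leftTranslate_leftTranslate, leftTranslate_p, map_smul, mul_smul_comm]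

/-- The elements of `C_c(G_σ) p_σ` are combinations of translates of `p_σ` by elements of
`G`. -/
lemma mul_p_eq_sum {f : ConvAlg T.μ} (hf : f * T.p = f) :
    f = ∑ q ∈ (T.finite_support_out T.K_le f).toFinset,
      f (T.j q.out) • ConvAlg.leftTranslate (T.j q.out) T.p := by
  refine T.eq_sum_leftTranslate T.K_le (fun g hg ↦ ?_) fun g a ha ↦ ?_
  · rw [p_j, T.chi_of_notMem hg]
  · rw [T.p_j_of_mem ha, ← hf, map_mul, T.mul_p_apply_mul _ _ ⟨a, ha⟩]

/-- The Hecke algebra is spanned by the elements `p_σ x p_σ`. -/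
lemma exists_eq_sum_gen (f : T.heckeAlgebra) :
    ∃ s : Finset (G ⧸ T.H), f = ∑ q ∈ s, f.1 q.out • T.gen q.out := by
  classical
  have hfin : (Function.support fun q : G ⧸ T.H ↦ f.1 q.out).Finite :=
    (hecke_finite f).subset fun q hq ↦ ⟨q.out, hq, q.out_eq'⟩
  let F : ConvAlg T.μ := ∑ q ∈ hfin.toFinset, f.1 q.out • ConvAlg.leftTranslate (T.j q.out) T.p
  have hF : ∀ x, F (T.j x) = f.1 x := by
    intro x
    have hx : (x : G ⧸ T.H).out⁻¹ * x ∈ T.H :=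
      QuotientGroup.eq.1 (QuotientGroup.out_eq' (x : G ⧸ T.H))
    rw [ConvAlg.sum_apply, Finset.sum_eq_single (x : G ⧸ T.H)]
    · rw [ConvAlg.smul_apply, ConvAlg.leftTranslate_apply, ← map_inv, ← map_mul, T.p_j_of_mem hx,
        ← hecke_mul_right]
      simp
    · intro q _ hq
      rw [ConvAlg.smul_apply, ConvAlg.leftTranslate_apply, ← map_inv, ← map_mul, p_j,
        T.chi_of_notMem, mul_zero]
      intro h
      exact hq ((QuotientGroup.out_eq' q).symm.trans (QuotientGroup.eq.2 h))
    · intro h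
      rw [Set.Finite.mem_toFinset, Function.mem_support, not_not] at h
      rw [ConvAlg.smul_apply, h, zero_mul]
  have hpF : T.p * F = F := T.p_mul_eq_self fun h x ↦ by rw [hF, hF, hecke_mul_left]
  have hF' : F = ∑ q ∈ hfin.toFinset, f.1 q.out • (T.cornerGen q.out).1 := by
    conv_lhs => rw [← hpF]
    simp only [F, Finset.mul_sum, mul_smul_comm]
    rfl
  refine ⟨hfin.toFinset, Subtype.ext (funext fun x ↦ ?_)⟩
  rw [← hF x, hF', ConvAlg.sum_apply]
  rw [AddSubmonoidClass.coe_finsetSum, Finset.sum_apply]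
  rfl

/-! ### Averages over `H` -/

/-- The subgroup of the `h ∈ K` that fix `yK`. -/
noncomputable def fixer (y : G) : Subgroup T.H :=
  (T.K ⊓ T.K.map (MulAut.conj y).toMonoidHom).subgroupOf T.H

instance (y : G) : (T.fixer y).FiniteIndex :=
  ⟨Subgroup.relIndex_inf_ne_zero T.relIndex_K_ne_zero (T.conj_K_relIndex_ne_zero y)⟩

lemma σ_fixer {y : G} {n : T.H} (hn : n ∈ T.fixer y) : T.σ n = 1 := by
  obtain ⟨h1, -⟩ := Subgroup.mem_subgroupOf.1 hn
  exact (T.mem_K.1 h1).2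

lemma conj_fixer {y : G} {n : T.H} (hn : n ∈ T.fixer y) : y⁻¹ * n * y ∈ T.K := by
  obtain ⟨-, k, hk, h⟩ := Subgroup.mem_subgroupOf.1 hn
  have : (n : G) = y * k * y⁻¹ := by simpa using h.symm
  rw [this]
  simpa [mul_assoc] using hk

open Classical in
/-- Representatives in `H` of the cosets of the fixer of `yK`. -/
noncomputable def reps (y : G) : Finset T.H :=
  haveI : Fintype (T.H ⧸ T.fixer y) := Fintype.ofFinite _
  Finset.univ.image fun q : T.H ⧸ T.fixer y ↦ q.out

lemma card_reps_ne_zero (y : G) : ((T.reps y).card : ℂ) ≠ 0 := by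
  classical
  rw [Nat.cast_ne_zero, Finset.card_ne_zero, reps, Finset.image_nonempty]
  exact ⟨((1 : T.H) : T.H ⧸ T.fixer y), @Finset.mem_univ _ (Fintype.ofFinite _) _⟩

/-- Left translation permutes the cosets of the fixer. -/
lemma sum_reps_mul {E : Type*} [AddCommMonoid E] (y : G) {F : T.H → E}
    (hF : ∀ h, ∀ n ∈ T.fixer y, F (h * n) = F h) (k : T.H) :
    ∑ h ∈ T.reps y, F (k * h) = ∑ h ∈ T.reps y, F h := by
  classical
  let _ : Fintype (T.H ⧸ T.fixer y) := Fintype.ofFinite _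
  have hinj : Function.Injective fun q : T.H ⧸ T.fixer y ↦ q.out := Quotient.out_injective
  have e1 : ∀ F' : T.H → E, ∑ h ∈ T.reps y, F' h = ∑ q : T.H ⧸ T.fixer y, F' q.out := fun F' ↦
    Finset.sum_image hinj.injOn
  rw [e1, e1]
  refine Eq.trans ?_ (Equiv.sum_comp (MulAction.toPerm k : Equiv.Perm (T.H ⧸ T.fixer y))
    fun q ↦ F q.out)
  refine Finset.sum_congr rfl fun q _ ↦ ?_
  obtain ⟨h, rfl⟩ := QuotientGroup.mk_surjective q
  obtain ⟨n, hn⟩ := QuotientGroup.mk_out_eq_mul (T.fixer y) h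
  obtain ⟨m, hm⟩ := QuotientGroup.mk_out_eq_mul (T.fixer y) (k * h)
  change F (k * (h : T.H ⧸ T.fixer y).out) = F ((k * h : T.H) : T.H ⧸ T.fixer y).out
  rw [hn, hm, ← mul_assoc, hF _ _ n.2, hF _ _ m.2]

/-- `p_σ y p_σ` is the average of the functions `σ(h) h y p_σ` over `h ∈ H`. -/
lemma cornerGen_eq_average (y : G) : (T.cornerGen y).1 = ((T.reps y).card : ℂ)⁻¹ •
    ∑ h ∈ T.reps y, (T.σ h : ℂ) • ConvAlg.leftTranslate (T.j (h * y)) T.p := by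
  set F : ConvAlg T.μ := ∑ h ∈ T.reps y, (T.σ h : ℂ) • ConvAlg.leftTranslate (T.j (h * y)) T.p
    with hF
  have h1 : ∀ x, F (T.j x) = ∑ h ∈ T.reps y, (T.σ h : ℂ) * T.p (T.j ((h * y)⁻¹ * x)) := by
    intro x
    rw [ConvAlg.sum_apply]
    refine Finset.sum_congr rfl fun h _ ↦ ?_
    rw [ConvAlg.smul_apply, ConvAlg.leftTranslate_apply, ← map_inv, ← map_mul]
  have h2 : T.p * F = F := by
    refine T.p_mul_eq_self fun k x ↦ ?_
    rw [h1, h1, ← T.sum_reps_mul y (fun h n hn ↦ ?_) k, Finset.mul_sum]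
    · refine Finset.sum_congr rfl fun h _ ↦ ?_
      have e : ((((k * h : T.H) : G) * y)⁻¹ * (k * x)) = (h * y)⁻¹ * x := by
        rw [Subgroup.coe_mul]; group
      rw [e, map_mul, Circle.coe_mul, mul_assoc]
    · obtain ⟨h3, h4⟩ := T.mem_K.1 (T.K.inv_mem (T.conj_fixer hn))
      have e : ((((h * n : T.H) : G) * y)⁻¹ * (k * x)) =
          (y⁻¹ * n * y)⁻¹ * ((h * y)⁻¹ * (k * x)) := by
        rw [Subgroup.coe_mul]; group
      rw [e, map_mul T.j, T.p_mul_left h3, h4, map_mul, T.σ_fixer hn]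
      simp
  rw [← h2, hF, Finset.mul_sum, Finset.sum_congr rfl (g := fun _ ↦ (T.cornerGen y).1),
    Finset.sum_const, ← Nat.cast_smul_eq_nsmul ℂ, smul_smul,
    inv_mul_cancel₀ (T.card_reps_ne_zero y), one_smul]
  intro h _
  rw [map_mul, ← ConvAlg.leftTranslate_leftTranslate, mul_smul_comm, p_mul_leftTranslate,
    smul_smul, σ_mul_σ_inv, one_smul]
  rfl

/-- The product of two generators, with the average `h ↦ σ(h) h` over `H` in place of the inner
`p_σ`. -/
lemma gen_mul_gen (x y : G) : T.gen x * T.gen y = ((T.reps y).card : ℂ)⁻¹ •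
    ∑ h ∈ T.reps y, (T.σ h : ℂ) • T.gen (x * h * y) := by
  have h1 : (T.cornerGen x * T.cornerGen y).1 = (((T.reps y).card : ℂ)⁻¹ •
      ∑ h ∈ T.reps y, (T.σ h : ℂ) • T.cornerGen (x * h * y)).1 := by
    change T.p * ConvAlg.leftTranslate (T.j x) T.p * (T.cornerGen y).1 = _
    rw [mul_assoc, ← ConvAlg.leftTranslate_mul, corner_p_mul, cornerGen_eq_average]
    simp only [map_smul, map_sum, mul_smul_comm, Finset.mul_sum,
      ConvAlg.leftTranslate_leftTranslate, ← map_mul]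
    change _ = _ • ((∑ h ∈ T.reps y, (T.σ h : ℂ) • T.cornerGen (x * h * y) : starCorner _ _) :
      ConvAlg T.μ)
    rw [AddSubmonoidClass.coe_finsetSum]
    simp only [mul_assoc]
    rfl
  rw [gen, gen, ← restrict_mul, Subtype.ext h1]
  change T.restrictₗ _ = _
  simp only [map_smul, map_sum]
  rfl

lemma gen_apply (y g : G) : (T.gen y).1 g = ((T.reps y).card : ℂ)⁻¹ *
    ∑ h ∈ T.reps y, (T.σ h : ℂ) * T.p (T.j ((h * y)⁻¹ * g)) := by
  change (T.cornerGen y).1 (T.j g) = _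
  rw [cornerGen_eq_average, ConvAlg.smul_apply, ConvAlg.sum_apply]
  simp only [ConvAlg.smul_apply, ConvAlg.leftTranslate_apply, map_mul, map_inv]

/-! ### Evaluation of equivariant functions on the Hecke algebra -/

variable {T} in
/-- For a function `Φ` on `G` with `Φ(xh) = σ(h)⁻¹ Φ(x)`, the linear map
`f ↦ ∑ f(x) Φ(x)` on the Hecke algebra, the sum being over `x ∈ G/H`. -/
noncomputable def heckeSum {E : Type*} [AddCommGroup E] [Module ℂ E] (Φ : G → E) :
    T.heckeAlgebra →ₗ[ℂ] E where
  toFun f := ∑ᶠ q : G ⧸ T.H, f.1 q.out • Φ q.out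
  map_add' f g := by
    have hfin : ∀ f : T.heckeAlgebra,
        (Function.support fun q : G ⧸ T.H ↦ f.1 q.out • Φ q.out).Finite := fun f ↦
      (hecke_finite f).subset fun q hq ↦
        ⟨q.out, fun h ↦ hq ((congrArg (· • Φ q.out) h).trans (zero_smul _ _)), q.out_eq'⟩
    rw [← finsum_add_distrib (hfin f) (hfin g)]
    exact finsum_congr fun q ↦ add_smul _ _ _
  map_smul' c f := by
    rw [RingHom.id_apply, smul_finsum]
    exact finsum_congr fun q ↦ smul_assoc c (f.1 q.out) (Φ q.out)

/-- `p_σ y p_σ` is the average of `σ(h) h y p_σ`, and every term contributes `σ(h) Φ(hy) = Φ(y)`. -/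
lemma heckeSum_gen {E : Type*} [AddCommGroup E] [Module ℂ E] {Φ : G → E}
    (hl : ∀ (h : T.H) (x : G), Φ (h * x) = (T.σ h⁻¹ : ℂ) • Φ x)
    (hr : ∀ (x : G) (h : T.H), Φ (x * h) = (T.σ h⁻¹ : ℂ) • Φ x) (y : G) :
    heckeSum Φ (T.gen y) = Φ y := by
  classical
  have h1 : ∀ z : G, ∀ q : G ⧸ T.H, T.p (T.j (z⁻¹ * q.out)) • Φ q.out =
      if q = (z : G ⧸ T.H) then Φ z else 0 := by
    intro z q
    split_ifs with hq
    · obtain ⟨k, hk⟩ := QuotientGroup.mk_out_eq_mul T.H z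
      rw [hq, hk, hr, inv_mul_cancel_left, T.p_j_of_mem k.2, smul_smul, σ_mul_σ_inv, one_smul]
    · rw [p_j, T.chi_of_notMem, zero_smul]
      intro h
      exact hq ((QuotientGroup.out_eq' q).symm.trans (QuotientGroup.eq.2 h).symm)
  let Q : Finset (G ⧸ T.H) := (T.reps y).image fun h : T.H ↦ (((h : G) * y : G) : G ⧸ T.H)
  have h2 : ∀ q : G ⧸ T.H, (T.gen y).1 q.out • Φ q.out = ((T.reps y).card : ℂ)⁻¹ •
      ∑ h ∈ T.reps y, (T.σ h : ℂ) • if q = ((h * y : G) : G ⧸ T.H) then Φ (h * y) else 0 := by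
    intro q
    rw [gen_apply, mul_smul, Finset.sum_smul]
    congr 1
    refine Finset.sum_congr rfl fun h _ ↦ ?_
    rw [mul_smul, h1]
  change ∑ᶠ q : G ⧸ T.H, (T.gen y).1 q.out • Φ q.out = _
  rw [finsum_eq_sum_of_support_subset _ (s := Q)]
  · simp only [h2]
    rw [← Finset.smul_sum, Finset.sum_comm, Finset.sum_congr rfl (g := fun _ ↦ Φ y),
      Finset.sum_const, ← Nat.cast_smul_eq_nsmul ℂ, smul_smul,
      inv_mul_cancel₀ (T.card_reps_ne_zero y), one_smul]
    intro h hh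
    rw [← Finset.smul_sum, Finset.sum_ite_eq' Q,
      if_pos (Finset.mem_image_of_mem (fun h : T.H ↦ (((h : G) * y : G) : G ⧸ T.H)) hh), hl,
      smul_smul, σ_mul_σ_inv, one_smul]
  · intro q hq
    by_contra hQ
    refine hq ?_
    simp only [h2]
    rw [Finset.sum_eq_zero, smul_zero]
    intro h hh
    rw [if_neg, smul_zero]
    rintro rfl
    exact hQ (Finset.mem_coe.2
      (Finset.mem_image_of_mem (fun h : T.H ↦ (((h : G) * y : G) : G ⧸ T.H)) hh))

/-! ### The elements `f* f` of the Hecke algebra -/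

lemma restrict_surjective : Function.Surjective T.restrict := by
  intro f
  obtain ⟨s, hs⟩ := T.exists_eq_sum_gen f
  refine ⟨∑ q ∈ s, f.1 q.out • T.cornerGen q.out, ?_⟩
  conv_rhs => rw [hs]
  change T.restrictₗ _ = _
  rw [map_sum]
  rfl

lemma coe_rightInnerSelf (f : ConvAlg T.μ) :
    (rightInnerSelf T.p T.star_p f).1 = star (f * T.p) * (f * T.p) := rfl

lemma star_leftTranslate_mul_leftTranslate (x y : G) (f g : ConvAlg T.μ) :
    star (ConvAlg.leftTranslate (T.j x) f) * ConvAlg.leftTranslate (T.j y) g =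
      star f * ConvAlg.leftTranslate (T.j (x⁻¹ * y)) g := by
  rw [ConvAlg.star_leftTranslate_mul, ConvAlg.leftTranslate_leftTranslate, map_mul, map_inv]

/-- The elements `∑ aᵢ* (p xᵢ⁻¹ xⱼ p) aⱼ` are of the form `f* f`, for `f = ∑ xᵢ aᵢ`. -/
lemma exists_restrict_rightInnerSelf_eq {ι : Type*} (F : Finset ι) (x : ι → G)
    (a : ι → T.heckeAlgebra) : ∃ f : ConvAlg T.μ, T.restrict (rightInnerSelf T.p T.star_p f) =
      ∑ i ∈ F, ∑ j ∈ F, star (a i) * T.gen ((x i)⁻¹ * x j) * a j := by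
  choose b hb using fun i ↦ T.restrict_surjective (a i)
  let f : ConvAlg T.μ := ∑ i ∈ F, ConvAlg.leftTranslate (T.j (x i)) (b i).1
  have hf : f * T.p = f := by
    simp only [f, Finset.sum_mul, ← ConvAlg.leftTranslate_mul, corner_mul_p]
  have h1 : rightInnerSelf T.p T.star_p f =
      ∑ i ∈ F, ∑ j ∈ F, star (b i) * T.cornerGen ((x i)⁻¹ * x j) * b j := by
    refine Subtype.ext ?_
    rw [coe_rightInnerSelf, hf, AddSubmonoidClass.coe_finsetSum]
    simp only [f, star_sum, Finset.sum_mul_sum, AddSubmonoidClass.coe_finsetSum]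
    refine Finset.sum_congr rfl fun i _ ↦ Finset.sum_congr rfl fun j _ ↦ ?_
    rw [star_leftTranslate_mul_leftTranslate]
    change _ = star (b i).1 * (T.p * ConvAlg.leftTranslate (T.j ((x i)⁻¹ * x j)) T.p) * (b j).1
    have e : star (b i).1 * T.p = star (b i).1 := by
      have := congrArg star (T.corner_p_mul (b i))
      rwa [star_mul, star_p] at this
    rw [← mul_assoc, e, mul_assoc, ← ConvAlg.leftTranslate_mul, corner_p_mul]
  refine ⟨f, ?_⟩
  rw [h1]
  change T.restrictₗ _ = _
  simp only [map_sum]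
  refine Finset.sum_congr rfl fun i _ ↦ Finset.sum_congr rfl fun j _ ↦ ?_
  change T.restrict _ = _
  rw [restrict_mul, restrict_mul, restrict_star, hb, hb]
  rfl

/-- Every `f* f` with `f ∈ C_c(G_σ) p_σ` is a positive form in the generators. -/
lemma exists_restrict_rightInnerSelf_eq_sum (f : ConvAlg T.μ) :
    ∃ (F : Finset (G ⧸ T.H)) (c : G ⧸ T.H → ℂ), T.restrict (rightInnerSelf T.p T.star_p f) =
      ∑ q ∈ F, ∑ r ∈ F, (conj (c q) * c r) • T.gen (q.out⁻¹ * r.out) := by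
  have h := T.mul_p_eq_sum (f := f * T.p) (by rw [mul_assoc, p_mul_p])
  set F := (T.finite_support_out T.K_le (f * T.p)).toFinset
  set c : G ⧸ T.H → ℂ := fun q ↦ (f * T.p) (T.j q.out)
  have h1 : rightInnerSelf T.p T.star_p f =
      ∑ q ∈ F, ∑ r ∈ F, (conj (c q) * c r) • T.cornerGen (q.out⁻¹ * r.out) := by
    refine Subtype.ext ?_
    rw [coe_rightInnerSelf, h, AddSubmonoidClass.coe_finsetSum]
    simp only [star_sum, Finset.sum_mul_sum, AddSubmonoidClass.coe_finsetSum]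
    refine Finset.sum_congr rfl fun q _ ↦ Finset.sum_congr rfl fun r _ ↦ ?_
    rw [star_smul, smul_mul_assoc, mul_smul_comm, star_leftTranslate_mul_leftTranslate, smul_smul,
      star_p]
    rfl
  refine ⟨F, c, ?_⟩
  rw [h1]
  change T.restrictₗ _ = _
  simp only [map_sum, map_smul]
  rfl

end HeckeTriple

end Restriction

/-! ### Norm bounds for `*`-representations -/

section StarRepresentations

open ContinuousLinearMap
open scoped InnerProductSpace ENNReal NNReal

variable {A : Type*} [NonUnitalNormedRing A] [StarRing A] [NormedStarGroup A] [NormedSpace ℂ A]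
  [IsScalarTower ℂ A A] [SMulCommClass ℂ A A]
  {V : Type*} [NormedAddCommGroup V] [InnerProductSpace ℂ V] [CompleteSpace V]

/-- `b` with `‖b‖ < 1` has a right quasi-inverse, as the fixed point of a contraction. -/
lemma exists_eq_add_mul [CompleteSpace A] {B : NonUnitalStarSubalgebra ℂ A}
    (hB : IsClosed (B : Set A)) (b : B) (hb : ‖(b : A)‖ < 1) : ∃ c : B, c = b + b * c := by
  have : CompleteSpace B := hB.completeSpace_coe
  have hf : ContractingWith ‖(b : A)‖₊ fun c : B ↦ b + b * c := by
    refine ⟨hb, LipschitzWith.of_dist_le_mul fun c d ↦ ?_⟩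
    rw [Subtype.dist_eq, Subtype.dist_eq, dist_eq_norm, dist_eq_norm]
    change ‖(b : A) + b * c - (b + b * d)‖ ≤ _
    rw [add_sub_add_left_eq_sub, ← mul_sub]
    exact norm_mul_le _ _
  exact ⟨hf.fixedPoint, hf.fixedPoint_isFixedPt.symm⟩

lemma exists_eq_add_mul' [CompleteSpace A] {B : NonUnitalStarSubalgebra ℂ A}
    (hB : IsClosed (B : Set A)) (b : B) (hb : ‖(b : A)‖ < 1) : ∃ c : B, c = b + c * b := by
  obtain ⟨c, hc⟩ := exists_eq_add_mul hB (star b) (by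
    change ‖star (b : A)‖ < 1
    rwa [norm_star])
  refine ⟨star c, ?_⟩
  conv_lhs => rw [hc]
  simp

/-- A `*`-representation of a Banach `*`-algebra (here, a closed `*`-subalgebra `B` of `A`) on a
Hilbert space is contractive: for self-adjoint `b` the norm of `π b` is its spectral radius, and
`1 - π b / z` has an inverse `1 + π c` for `‖b‖ < |z|`. -/
lemma norm_starRep_le [CompleteSpace A] [StarModule ℂ A] {B : NonUnitalStarSubalgebra ℂ A}
    (hB : IsClosed (B : Set A)) (π : B →ₗ[ℂ] (V →L[ℂ] V)) (hmul : ∀ a b, π (a * b) = π a * π b)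
    (hstar : ∀ a, π (star a) = star (π a)) (b : B) : ‖π b‖ ≤ ‖(b : A)‖ := by
  have hunit : ∀ b : B, ‖(b : A)‖ < 1 → IsUnit (1 - π b) := by
    intro b hb
    obtain ⟨c, hc⟩ := exists_eq_add_mul hB b hb
    obtain ⟨d, hd⟩ := exists_eq_add_mul' hB b hb
    have h1 : (1 - π b) * (1 + π c) = 1 := by
      have := congrArg π hc
      rw [map_add, hmul] at this
      calc (1 - π b) * (1 + π c) = 1 + π c - (π b + π b * π c) := by noncomm_ring
        _ = 1 := by rw [← this]; abel
    have h2 : (1 + π d) * (1 - π b) = 1 := by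
      have := congrArg π hd
      rw [map_add, hmul] at this
      calc (1 + π d) * (1 - π b) = 1 + π d - (π b + π d * π b) := by noncomm_ring
        _ = 1 := by rw [← this]; abel
    exact ⟨⟨1 - π b, 1 + π c, h1, by rw [← left_inv_eq_right_inv h2 h1, h2]⟩, rfl⟩
  have hspec : ∀ b : B, spectralRadius ℂ (π b) ≤ ‖(b : A)‖₊ := by
    intro b
    refine iSup₂_le fun z hz ↦ ?_
    rw [ENNReal.coe_le_coe, ← NNReal.coe_le_coe, coe_nnnorm, coe_nnnorm]
    by_contra! hlt
    have hz0 : z ≠ 0 := norm_pos_iff.1 ((norm_nonneg _).trans_lt hlt)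
    have h1 := hunit (z⁻¹ • b) (by
      change ‖z⁻¹ • (b : A)‖ < 1
      rw [norm_smul, norm_inv, inv_mul_lt_one₀ (norm_pos_iff.2 hz0)]
      exact hlt)
    refine hz ?_
    have h2 : algebraMap ℂ (V →L[ℂ] V) z - π b = Units.mk0 z hz0 • (1 - π (z⁻¹ • b)) := by
      rw [Units.smul_def, Units.val_mk0, smul_sub, map_smul, smul_smul, mul_inv_cancel₀ hz0,
        one_smul, Algebra.algebraMap_eq_smul_one]
    rw [spectrum.mem_resolventSet_iff, h2]
    exact h1.smul _
  have hsa : ∀ b : B, IsSelfAdjoint b → ‖π b‖ ≤ ‖(b : A)‖ := by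
    intro b hb
    have h1 : IsSelfAdjoint (π b) := by rw [IsSelfAdjoint, ← hstar, hb.star_eq]
    have h2 := hspec b
    rw [h1.spectralRadius_eq_nnnorm, ENNReal.coe_le_coe] at h2
    exact h2
  have h1 : ‖π b‖ ^ 2 ≤ ‖(b : A)‖ ^ 2 := by
    calc ‖π b‖ ^ 2 = ‖π (star b * b)‖ := by rw [hmul, hstar, CStarRing.norm_star_mul_self, sq]
      _ ≤ ‖star (b : A) * b‖ := hsa _ (IsSelfAdjoint.star_mul_self b)
      _ ≤ ‖star (b : A)‖ * ‖(b : A)‖ := norm_mul_le _ _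
      _ = ‖(b : A)‖ ^ 2 := by rw [norm_star, sq]
  exact le_of_sq_le_sq h1 (norm_nonneg _)

/-- A sequence with `xₙ² ≤ N xₙ₊₁` that grows at most like `r ^ 2ⁿ` starts below `N r`. -/
lemma le_mul_of_sq_le_mul {x : ℕ → ℝ} {N M r : ℝ} (hN : 0 ≤ N) (hr : 0 ≤ r)
    (h : ∀ n, x n ^ 2 ≤ N * x (n + 1)) (hM : ∀ n, x n ≤ M * r ^ 2 ^ n) : x 0 ≤ N * r := by
  by_contra! hlt
  have hx0 : 0 < x 0 := (mul_nonneg hN hr).trans_lt hlt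
  have hN0 : 0 < N := by
    refine hN.lt_of_ne fun h0 ↦ ?_
    have := h 0
    rw [← h0, zero_mul] at this
    exact absurd this (not_le.2 (by positivity))
  have h1 : ∀ n, N * (x 0 / N) ^ 2 ^ n ≤ x n := by
    intro n
    induction n with
    | zero => rw [pow_zero, pow_one, mul_div_cancel₀ _ hN0.ne']
    | succ n ih =>
      have h2 : (N * (x 0 / N) ^ 2 ^ n) ^ 2 ≤ N * x (n + 1) :=
        (pow_le_pow_left₀ (by positivity) ih 2).trans (h n)
      refine le_of_mul_le_mul_left (le_trans (le_of_eq ?_) h2) hN0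
      rw [pow_succ 2 n, pow_mul]
      ring
  have hq : r < x 0 / N := by rwa [lt_div_iff₀ hN0, mul_comm]
  rcases hr.eq_or_lt with rfl | hr0
  · have h2 := (h1 0).trans (hM 0)
    rw [pow_zero, pow_one, pow_one, mul_zero, mul_div_cancel₀ _ hN0.ne'] at h2
    exact absurd h2 (not_le.2 hx0)
  · have h2 : 1 < x 0 / N / r := by rwa [one_lt_div hr0]
    obtain ⟨n, hn⟩ := pow_unbounded_of_one_lt (M / N) h2
    have h3 : (x 0 / N / r) ^ n ≤ (x 0 / N / r) ^ 2 ^ n :=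
      pow_le_pow_right₀ h2.le Nat.lt_two_pow_self.le
    have h4 := (h1 n).trans (hM n)
    have h5 : (x 0 / N / r) ^ 2 ^ n ≤ M / N := by
      rw [div_pow _ r, div_le_iff₀ (by positivity), div_mul_eq_mul_div, le_div_iff₀ hN0, mul_comm]
      exact h4
    exact absurd (hn.trans_le (h3.trans h5)) (lt_irrefl _)

end StarRepresentations

/-! ### Extension to the enveloping `C*`-algebra -/

section Envelope

variable {A : Type*} [NonUnitalSeminormedRing A] [NormedSpace ℂ A] [StarRing A]
  {V : Type*} [NormedAddCommGroup V] [InnerProductSpace ℂ V] [CompleteSpace V]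

lemma toCStarEnvelope_add (a b : A) :
    toCStarEnvelope (a + b) = toCStarEnvelope a + toCStarEnvelope b :=
  StarCompletion.of_add (A := WithCStarNorm A) a b

lemma toCStarEnvelope_mul (a b : A) :
    toCStarEnvelope (a * b) = toCStarEnvelope a * toCStarEnvelope b :=
  StarCompletion.of_mul (A := WithCStarNorm A) a b

lemma toCStarEnvelope_smul (c : ℂ) (a : A) :
    toCStarEnvelope (c • a) = c • toCStarEnvelope a :=
  StarCompletion.of_smul (A := WithCStarNorm A) c a

lemma denseRange_toCStarEnvelope : DenseRange (toCStarEnvelope : A → CStarEnvelope A) :=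
  StarCompletion.isDenseInducing_of.dense

/-- A contractive `*`-representation of `A` extends to the enveloping `C*`-algebra, since
`a ↦ ‖π a‖` is one of the `C*`-seminorms that define its norm. -/
lemma exists_extension_envelope [IsScalarTower ℂ A A] [SMulCommClass ℂ A A] [StarModule ℂ A]
    (π : A →ₗ[ℂ] (V →L[ℂ] V)) (hmul : ∀ a b, π (a * b) = π a * π b)
    (hstar : ∀ a, π (star a) = star (π a)) (hle : ∀ a, ‖π a‖ ≤ ‖a‖) :
    ∃ ρ : CStarEnvelope A →L[ℂ] (V →L[ℂ] V), (∀ a, ρ (toCStarEnvelope a) = π a) ∧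
      (∀ x y, ρ (x * y) = ρ x * ρ y) ∧ ∀ x, ρ (star x) = star (ρ x) := by
  let q : CStarSeminorm A :=
    { (normSeminorm ℂ (V →L[ℂ] V)).comp π with
      mul_le' := fun a b ↦ by
        change ‖π (a * b)‖ ≤ ‖π a‖ * ‖π b‖
        rw [hmul]; exact norm_mul_le _ _
      star_mul_self' := fun a ↦ by
        change ‖π (star a * a)‖ = ‖π a‖ * ‖π a‖
        rw [hmul, hstar, CStarRing.norm_star_mul_self]
      le_norm' := hle }
  let i : A →ₗ[ℂ] CStarEnvelope A :=
    { toFun := toCStarEnvelope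
      map_add' := toCStarEnvelope_add
      map_smul' := toCStarEnvelope_smul }
  have hb : ∀ a, ‖π a‖ ≤ 1 * ‖i a‖ := fun a ↦ by
    rw [one_mul]
    exact (WithCStarNorm.le_maxNorm q a).trans_eq
      (StarCompletion.norm_of (A := WithCStarNorm A) a).symm
  let ρ : CStarEnvelope A →L[ℂ] (V →L[ℂ] V) := π.extendOfNorm i
  have hρ : ∀ a, ρ (toCStarEnvelope a) = π a := fun a ↦
    LinearMap.extendOfNorm_eq (e := i) denseRange_toCStarEnvelope ⟨1, hb⟩ a
  refine ⟨ρ, hρ, fun x y ↦ ?_, fun x ↦ ?_⟩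
  · refine denseRange_toCStarEnvelope.induction_on₂ (p := fun x y ↦ ρ (x * y) = ρ x * ρ y)
      (isClosed_eq (by fun_prop) (by fun_prop)) (fun a b ↦ ?_) x y
    rw [← toCStarEnvelope_mul, hρ, hρ, hρ, hmul]
  · refine denseRange_toCStarEnvelope.induction_on (p := fun x ↦ ρ (star x) = star (ρ x)) x
      (isClosed_eq (by fun_prop) (by fun_prop)) fun a ↦ ?_
    rw [star_toCStarEnvelope, hρ, hρ, hstar]

end Envelope

/-! ### Compression functors -/

section Compression

open CategoryTheory ContinuousLinearMap
open scoped InnerProductSpace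

universe w w' t' t

namespace HilbRep

lemma toCLM_act {ι : Type w'} {R S : HilbRep.{w} ι} (f : R ⟶ S) (i : ι) (ξ : R.V) :
    toCLM f (R.act i ξ) = S.act i (toCLM f ξ) := f.2 i ξ

/-- The morphism given by a bounded intertwining operator. -/
def homMk {ι : Type w'} {P : ObjectProperty (HilbRep.{w} ι)} {R S : P.FullSubcategory}
    (A : R.obj.V →L[ℂ] S.obj.V) (hA : ∀ i ξ, A (R.obj.act i ξ) = S.obj.act i (A ξ)) : R ⟶ S :=
  ObjectProperty.homMk (⟨A, hA⟩ : intertwiners R.obj S.obj)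

lemma hom_ext {ι : Type w'} {P : ObjectProperty (HilbRep.{w} ι)} {R S : P.FullSubcategory}
    {f g : R ⟶ S} (h : ∀ ξ, toCLM f.hom ξ = toCLM g.hom ξ) : f = g :=
  ObjectProperty.hom_ext _ (Subtype.ext (ContinuousLinearMap.ext h))

/-- A unitary intertwining operator is an isomorphism. -/
lemma nonempty_iso {ι : Type w'} {P : ObjectProperty (HilbRep.{w} ι)} {R S : P.FullSubcategory}
    (U : R.obj.V ≃ₗᵢ[ℂ] S.obj.V) (hU : ∀ i ξ, U (R.obj.act i ξ) = S.obj.act i (U ξ)) :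
    Nonempty (R ≅ S) :=
  ⟨{ hom := homMk (U.toContinuousLinearEquiv : R.obj.V →L[ℂ] S.obj.V) hU
     inv := homMk (U.symm.toContinuousLinearEquiv : S.obj.V →L[ℂ] R.obj.V) fun i ξ ↦ by
       apply U.injective
       change U (U.symm (S.obj.act i ξ)) = U (R.obj.act i (U.symm ξ))
       rw [hU, U.apply_symm_apply, U.apply_symm_apply]
     hom_inv_id := hom_ext fun ξ ↦ U.symm_apply_apply ξ
     inv_hom_id := hom_ext fun ξ ↦ U.apply_symm_apply ξ }⟩

/-- The data of a functor that sends a representation to its compression to a closed subspace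
that generates it. The subspace of `R` is `space R`, the compressed representation is `act R`;
the operators `emb R s : space R → R`, whose ranges generate `R`, are the restrictions of
operators of the representation, and their Gram operators `(emb R s)* (emb R t)` are
operators `act R (gram s t)` of the compressed representation. -/
structure Compression {ι : Type w'} {κ : Type t'} (P : ObjectProperty (HilbRep.{w} ι))
    (Q : ObjectProperty (HilbRep.{w} κ)) (S : Type t) where
  /-- the subspace to which a representation is compressed -/
  space (R : P.FullSubcategory) : Submodule ℂ R.obj.V
  isClosed (R : P.FullSubcategory) : IsClosed (space R : Set R.obj.V)
  /-- the operators of the compressed representation -/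
  act (R : P.FullSubcategory) : κ → (space R →L[ℂ] space R)
  /-- the generating operators -/
  emb (R : P.FullSubcategory) : S → (space R →L[ℂ] R.obj.V)
  /-- the Gram operators of the generating operators -/
  gram : S → S → κ
  /-- the index of the inclusion among the generating operators -/
  base : S
  map_mem {R R' : P.FullSubcategory} (f : R ⟶ R') {ξ : R.obj.V} (hξ : ξ ∈ space R) :
    toCLM f.hom ξ ∈ space R'
  map_act {R R' : P.FullSubcategory} (f : R ⟶ R') (k : κ) (ξ : space R) :
    toCLM f.hom (act R k ξ) = act R' k ⟨toCLM f.hom ξ, map_mem f ξ.2⟩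
  map_emb {R R' : P.FullSubcategory} (f : R ⟶ R') (s : S) (ξ : space R) :
    toCLM f.hom (emb R s ξ) = emb R' s ⟨toCLM f.hom ξ, map_mem f ξ.2⟩
  total (R : P.FullSubcategory) : IsTotalFamily (emb R)
  emb_base (R : P.FullSubcategory) (ξ : space R) : emb R base ξ = ξ
  inner_emb (R : P.FullSubcategory) (s t : S) (ξ η : space R) :
    ⟪emb R s ξ, emb R t η⟫_ℂ = ⟪ξ, act R (gram s t) η⟫_ℂ
  /-- an operator that is determined by an operator of the compressed spaces intertwines the
  representations -/
  intertwine {R R' : P.FullSubcategory} (A : R.obj.V →L[ℂ] R'.obj.V) (T : space R →L[ℂ] space R')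
    (hA : ∀ s ξ, A (emb R s ξ) = emb R' s (T ξ)) (i : ι) (ξ : R.obj.V) :
    A (R.obj.act i ξ) = R'.obj.act i (A ξ)
  property (R : P.FullSubcategory) :
    haveI : CompleteSpace (space R) := (isClosed R).completeSpace_coe
    Q { V := space R, act := act R }

namespace Compression

variable {ι : Type w'} {κ : Type t'} {P : ObjectProperty (HilbRep.{w} ι)}
  {Q : ObjectProperty (HilbRep.{w} κ)} {S : Type t} (D : Compression P Q S)

instance (R : P.FullSubcategory) : CompleteSpace (D.space R) := (D.isClosed R).completeSpace_coe

/-- The compressed representation. -/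
noncomputable def obj (R : P.FullSubcategory) : Q.FullSubcategory :=
  ⟨{ V := D.space R, act := D.act R }, D.property R⟩

/-- The restriction of an intertwining operator. -/
noncomputable def map {R R' : P.FullSubcategory} (f : R ⟶ R') : D.obj R ⟶ D.obj R' :=
  homMk (R := D.obj R) (S := D.obj R')
    (((toCLM f.hom).comp (D.space R).subtypeL).codRestrict (D.space R')
      fun ξ ↦ D.map_mem f ξ.2)
    fun k ξ ↦ Subtype.ext (D.map_act f k ξ)

/-- The compression functor. -/
noncomputable def functor : P.FullSubcategory ⥤ Q.FullSubcategory where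
  obj := D.obj
  map := D.map
  map_id _ := rfl
  map_comp _ _ := rfl

instance : D.functor.Additive where
  map_add := rfl

lemma linear : D.functor.Linear ℂ where
  map_smul _ _ := rfl

lemma preservesAdjoints : PreservesAdjoints D.functor := by
  intro R R' T T' h
  refine (eq_adjoint_iff _ _).2 fun ξ η ↦ ?_
  let ξ' : D.space R' := ξ
  let η' : D.space R := η
  change ⟪toCLM T'.hom (ξ' : R'.obj.V), (η' : R.obj.V)⟫_ℂ =
    ⟪(ξ' : R'.obj.V), toCLM T.hom (η' : R.obj.V)⟫_ℂ
  rw [h, adjoint_inner_left]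

instance : D.functor.Faithful where
  map_injective {R R' f g} h := by
    have h1 : ∀ ξ : D.space R, toCLM f.hom ξ = toCLM g.hom ξ := fun ξ ↦
      congrArg (fun k : D.obj R ⟶ D.obj R' ↦ (D.space R').subtypeL (toCLM k.hom ξ)) h
    have h2 : toCLM f.hom = toCLM g.hom := (D.total R).ext fun s ξ ↦ by
      rw [D.map_emb, D.map_emb]
      congr 1
      exact Subtype.ext (h1 ξ)
    exact hom_ext fun ξ ↦ by rw [h2]

lemma adjoint_emb_comp (R : P.FullSubcategory) (s t : S) :
    (D.emb R s).adjoint ∘L D.emb R t = D.act R (D.gram s t) := by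
  ext1 η
  refine ext_inner_left ℂ fun ξ ↦ ?_
  rw [ContinuousLinearMap.comp_apply, adjoint_inner_right, D.inner_emb]

instance : D.functor.Full where
  map_surjective {R R'} T := by
    let T₀ : D.space R →L[ℂ] D.space R' := toCLM T.hom
    have hT : ∀ (k : κ) (ξ : D.space R), T₀ (D.act R k ξ) = D.act R' k (T₀ ξ) :=
      fun k ξ ↦ toCLM_act T.hom k ξ
    obtain ⟨A, hA⟩ := (D.total R).exists_intertwiner (D.emb R') T₀ fun s t ↦ by
      rw [adjoint_emb_comp, adjoint_emb_comp]
      exact ContinuousLinearMap.ext fun ξ ↦ hT _ ξ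
    refine ⟨homMk A (D.intertwine A T₀ hA), hom_ext fun ξ ↦ Subtype.ext ?_⟩
    let ξ' : D.space R := ξ
    have := hA D.base ξ'
    rw [D.emb_base, D.emb_base] at this
    exact this

/-- A compression functor onto which every representation lifts is an equivalence. -/
lemma exists_equivalence (h : ∀ N : Q.FullSubcategory, ∃ R : P.FullSubcategory,
      Nonempty (D.obj R ≅ N)) :
    ∃ e : P.FullSubcategory ≌ Q.FullSubcategory, e.functor = D.functor := by
  have : D.functor.EssSurj := ⟨fun N ↦ h N⟩
  have : D.functor.IsEquivalence := {}
  exact ⟨D.functor.asEquivalence, rfl⟩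

end Compression

end HilbRep

end Compression

section SmoothRepresentations

open CategoryTheory ContinuousLinearMap
open scoped InnerProductSpace ComplexConjugate

universe w w'

namespace HeckeTriple

variable {G : Type w'} [Group G] (T : HeckeTriple G)

/-! ### Products and adjoints of combinations of the generators -/

lemma sum_gen_mul_sum_gen {ι κ : Type*} (s : Finset ι) (t : Finset κ) (c : ι → ℂ) (d : κ → ℂ)
    (x : ι → G) (y : κ → G) :
    (∑ i ∈ s, c i • T.gen (x i)) * ∑ j ∈ t, d j • T.gen (y j) =
      ∑ i ∈ s, ∑ j ∈ t, (c i * d j) • (T.gen (x i) * T.gen (y j)) := by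
  have h1 : ∑ i ∈ s, c i • T.gen (x i) = T.restrictₗ (∑ i ∈ s, c i • T.cornerGen (x i)) := by
    simp only [map_sum, map_smul]; rfl
  have h2 : ∑ j ∈ t, d j • T.gen (y j) = T.restrictₗ (∑ j ∈ t, d j • T.cornerGen (y j)) := by
    simp only [map_sum, map_smul]; rfl
  rw [h1, h2]
  refine (T.restrict_mul _ _).symm.trans ?_
  simp only [Finset.sum_mul_sum, smul_mul_smul_comm]
  change T.restrictₗ _ = _
  simp only [map_sum, map_smul]
  refine Finset.sum_congr rfl fun i _ ↦ Finset.sum_congr rfl fun j _ ↦ ?_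
  exact congrArg _ (T.restrict_mul _ _)

lemma star_sum_gen {ι : Type*} (s : Finset ι) (c : ι → ℂ) (x : ι → G) :
    star (∑ i ∈ s, c i • T.gen (x i)) = ∑ i ∈ s, conj (c i) • T.gen (x i)⁻¹ := by
  have h1 : ∑ i ∈ s, c i • T.gen (x i) = T.restrictₗ (∑ i ∈ s, c i • T.cornerGen (x i)) := by
    simp only [map_sum, map_smul]; rfl
  rw [h1]
  refine (T.restrict_star _).symm.trans ?_
  simp only [star_sum, star_smul]
  change T.restrictₗ _ = _
  simp only [map_sum, map_smul]
  refine Finset.sum_congr rfl fun i _ ↦ ?_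
  exact congrArg _ ((T.restrict_star _).trans (T.star_gen _))

/-- `p_σ 1 p_σ = p_σ` is the unit of the Hecke algebra. -/
lemma gen_one_mul (f : T.heckeAlgebra) : T.gen 1 * f = f := by
  obtain ⟨f, rfl⟩ := T.restrict_surjective f
  rw [gen, ← restrict_mul]
  congr 1
  refine Subtype.ext ?_
  change T.p * ConvAlg.leftTranslate (T.j 1) T.p * f.1 = f.1
  rw [map_one, ConvAlg.leftTranslate_one, p_mul_p, corner_p_mul]

/-! ### Compression of unitary representations -/

lemma smul_mul_smul_operator {V : Type*} [NormedAddCommGroup V] [InnerProductSpace ℂ V]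
    (a b : ℂ) (A B : V →L[ℂ] V) : (a • A) * (b • B) = (a * b) • (A * B) := by
  rw [smul_mul_assoc, mul_smul_comm, smul_smul]

lemma star_sum_smul_operator {V : Type*} [NormedAddCommGroup V] [InnerProductSpace ℂ V]
    [CompleteSpace V] {ι : Type*} (s : Finset ι) (c : ι → ℂ) (A : ι → V →L[ℂ] V) :
    star (∑ i ∈ s, c i • A i) = ∑ i ∈ s, conj (c i) • star (A i) := by
  rw [star_sum]
  exact Finset.sum_congr rfl fun i _ ↦ star_smul _ _

lemma σ_inv_apply (h : T.H) : ((T.σ⁻¹ h : Circle) : ℂ) = T.σ h⁻¹ := by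
  rw [MonoidHom.inv_apply, map_inv]

lemma conj_σ (h : T.H) : conj (T.σ h : ℂ) = T.σ h⁻¹ := by
  rw [map_inv, Circle.coe_inv_eq_conj]

/-- The subspace of the vectors with `π(h) ξ = σ(h)⁻¹ ξ`. It is the range of the average of
`σ(h) π(h)` over `H`, which is the operator of `p_σ`. -/
def isotypicSubspace (R : HilbRep.{w} G) : Submodule ℂ R.V where
  carrier := R.isotypic T.σ⁻¹
  add_mem' {ξ η} hξ hη h := by rw [map_add, hξ h, hη h, smul_add]
  zero_mem' h := by rw [map_zero, smul_zero]
  smul_mem' c ξ hξ h := by rw [map_smul, hξ h, smul_comm]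

variable {R : HilbRep.{w} G}

lemma mem_isotypicSubspace {ξ : R.V} :
    ξ ∈ T.isotypicSubspace R ↔ ∀ h : T.H, R.act h ξ = (T.σ h⁻¹ : ℂ) • ξ :=
  forall_congr' fun h ↦ by rw [σ_inv_apply]

lemma act_isotypic (ξ : T.isotypicSubspace R) (h : T.H) :
    R.act h (ξ : R.V) = (T.σ h⁻¹ : ℂ) • (ξ : R.V) := T.mem_isotypicSubspace.1 ξ.2 h

variable (R) in
lemma isClosed_isotypicSubspace : IsClosed (T.isotypicSubspace R : Set R.V) := by
  have : (T.isotypicSubspace R : Set R.V) =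
      ⋂ h : T.H, {ξ | R.act h ξ = (T.σ h⁻¹ : ℂ) • ξ} := by
    ext ξ
    simp only [SetLike.mem_coe, mem_isotypicSubspace, Set.mem_iInter, Set.mem_ofPred_eq]
  rw [this]
  exact isClosed_iInter fun h ↦ isClosed_eq (by fun_prop) (by fun_prop)

instance : CompleteSpace (T.isotypicSubspace R) :=
  (T.isClosed_isotypicSubspace R).completeSpace_coe

section Unitary

variable (hR : R.IsUnitaryRep)
include hR

lemma act_mul_apply (x y : G) (ξ : R.V) : R.act (x * y) ξ = R.act x (R.act y ξ) := by
  rw [hR.2.1]; rfl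

lemma inner_act_act (x y : G) (ξ η : R.V) :
    ⟪R.act x ξ, R.act y η⟫_ℂ = ⟪ξ, R.act (x⁻¹ * y) η⟫_ℂ := by
  have h1 : star (R.act x) = R.act x⁻¹ := by
    refine left_inv_eq_right_inv (Unitary.star_mul_self_of_mem (hR.2.2 x)) ?_
    rw [← hR.2.1, mul_inv_cancel, hR.1]
  rw [act_mul_apply hR, ← h1, star_eq_adjoint, adjoint_inner_right]

end Unitary

variable (R) in
/-- The compression `P π(x) P` of `π(x)` to the isotypic subspace. -/
noncomputable def compress (x : G) : T.isotypicSubspace R →L[ℂ] T.isotypicSubspace R :=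
  (T.isotypicSubspace R).subtypeL.adjoint ∘L R.act x ∘L (T.isotypicSubspace R).subtypeL

lemma inner_compress (x : G) (ξ η : T.isotypicSubspace R) :
    ⟪ξ, T.compress R x η⟫_ℂ = ⟪(ξ : R.V), R.act x (η : R.V)⟫_ℂ := by
  rw [compress, ContinuousLinearMap.comp_apply, adjoint_inner_right]
  rfl

lemma compress_mul_left (hR : R.IsUnitaryRep) (h : T.H) (x : G) :
    T.compress R (h * x) = (T.σ h⁻¹ : ℂ) • T.compress R x := by
  ext1 η
  refine ext_inner_left ℂ fun ξ ↦ ?_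
  have h1 := inner_act_act hR ((h⁻¹ : T.H) : G) x ξ η
  rw [T.act_isotypic, inv_inv, inner_smul_left, conj_σ] at h1
  rw [inner_compress, smul_apply, inner_smul_right, inner_compress, h1]
  simp

lemma compress_mul_right (hR : R.IsUnitaryRep) (x : G) (h : T.H) :
    T.compress R (x * h) = (T.σ h⁻¹ : ℂ) • T.compress R x := by
  ext1 η
  refine ext_inner_left ℂ fun ξ ↦ ?_
  rw [inner_compress, act_mul_apply hR, act_isotypic, map_smul, smul_apply, inner_smul_right,
    inner_smul_right, inner_compress]

/-- The projection of `π(x) ξ` to the isotypic subspace is the average of `σ(h) π(hx) ξ` over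
`H`. -/
lemma coe_compress (hR : R.IsUnitaryRep) (x : G) (ξ : T.isotypicSubspace R) :
    (T.compress R x ξ : R.V) = ((T.reps x).card : ℂ)⁻¹ •
      ∑ h ∈ T.reps x, (T.σ h : ℂ) • R.act (h * x) (ξ : R.V) := by
  set a : R.V := ((T.reps x).card : ℂ)⁻¹ •
      ∑ h ∈ T.reps x, (T.σ h : ℂ) • R.act (h * x) (ξ : R.V) with ha
  have hmem : a ∈ T.isotypicSubspace R := by
    refine T.mem_isotypicSubspace.2 fun k ↦ ?_
    rw [ha, map_smul, smul_comm]
    congr 1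
    rw [map_sum]
    refine Eq.trans ?_ (congrArg _ (T.sum_reps_mul x (fun h n hn ↦ ?_) k))
    · rw [Finset.smul_sum]
      refine Finset.sum_congr rfl fun h _ ↦ ?_
      have e : (T.σ k⁻¹ : ℂ) * T.σ (k * h) = T.σ h := by
        rw [← Circle.coe_mul, ← map_mul, inv_mul_cancel_left]
      rw [map_smul, ← act_mul_apply hR, smul_smul, e, Subgroup.coe_mul, mul_assoc]
    · obtain ⟨h1, h2⟩ := T.mem_K.1 (T.conj_fixer hn)
      have e : (((h * n : T.H) : G) * x) = h * x * (x⁻¹ * n * x) := by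
        rw [Subgroup.coe_mul]; group
      have e2 := T.act_isotypic ξ ⟨_, h1⟩
      rw [map_inv, h2, inv_one, Circle.coe_one, one_smul] at e2
      rw [e, act_mul_apply hR, e2, map_mul, T.σ_fixer hn, mul_one]
  have : T.compress R x ξ = ⟨a, hmem⟩ := by
    refine ext_inner_left ℂ fun η ↦ ?_
    rw [inner_compress]
    change _ = ⟪(η : R.V), a⟫_ℂ
    rw [ha, inner_smul_right, inner_sum, Finset.sum_congr rfl
      (g := fun _ ↦ ⟪(η : R.V), R.act x (ξ : R.V)⟫_ℂ), Finset.sum_const, nsmul_eq_mul,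
      ← mul_assoc, inv_mul_cancel₀ (T.card_reps_ne_zero x), one_mul]
    intro h _
    have h1 := inner_act_act hR ((h⁻¹ : T.H) : G) x η ξ
    rw [T.act_isotypic, inv_inv, inner_smul_left, conj_σ] at h1
    have e : (((h⁻¹ : T.H) : G)⁻¹ * x) = h * x := by simp
    rw [inner_smul_right, ← e, ← h1, ← mul_assoc, σ_mul_σ_inv, one_mul]
  rw [this]

variable (R) in
/-- The action `f ↦ ∑ f(x) π(x)` of the Hecke algebra on the isotypic subspace. -/
noncomputable def heckeAct :
    T.heckeAlgebra →ₗ[ℂ] (T.isotypicSubspace R →L[ℂ] T.isotypicSubspace R) :=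
  heckeSum (T.compress R)

lemma heckeAct_gen (hR : R.IsUnitaryRep) (x : G) : T.heckeAct R (T.gen x) = T.compress R x :=
  T.heckeSum_gen (T.compress_mul_left hR) (T.compress_mul_right hR) x

lemma heckeAct_mul (hR : R.IsUnitaryRep) (f g : T.heckeAlgebra) :
    T.heckeAct R (f * g) = T.heckeAct R f * T.heckeAct R g := by
  -- On generators, the average formula is applied to `P π(y) P`.
  have key : ∀ x y, T.heckeAct R (T.gen x * T.gen y) = T.compress R x * T.compress R y := by
    intro x y
    rw [gen_mul_gen, map_smul, map_sum]
    simp only [map_smul, heckeAct_gen T hR]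
    ext1 ξ
    refine ext_inner_left ℂ fun η ↦ ?_
    rw [mul_apply_eq_comp, inner_compress, coe_compress T hR]
    simp only [smul_apply, sum_apply, map_smul, map_sum, inner_smul_right, inner_sum,
      inner_compress, ← act_mul_apply hR, mul_assoc]
  obtain ⟨s, hs⟩ := T.exists_eq_sum_gen f
  obtain ⟨t, ht⟩ := T.exists_eq_sum_gen g
  rw [hs, ht, sum_gen_mul_sum_gen]
  simp only [map_sum, map_smul, key, heckeAct_gen T hR, Finset.sum_mul_sum]
  refine Finset.sum_congr rfl fun i _ ↦ Finset.sum_congr rfl fun j _ ↦ ?_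
  exact (smul_mul_smul_operator _ _ _ _).symm

lemma heckeAct_star (hR : R.IsUnitaryRep) (f : T.heckeAlgebra) :
    T.heckeAct R (star f) = star (T.heckeAct R f) := by
  have key : ∀ x, T.compress R x⁻¹ = star (T.compress R x) := by
    intro x
    ext1 ξ
    refine ext_inner_left ℂ fun η ↦ ?_
    have := inner_act_act hR x 1 η ξ
    rw [mul_one, hR.1] at this
    rw [star_eq_adjoint, adjoint_inner_right, inner_compress, ← this, ← inner_conj_symm _ ξ,
      inner_compress, inner_conj_symm]
    rfl
  obtain ⟨s, hs⟩ := T.exists_eq_sum_gen f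
  rw [hs, star_sum_gen]
  simp only [map_sum, map_smul, heckeAct_gen T hR, key]
  exact (star_sum_smul_operator _ _ _).symm

lemma compress_one (hR : R.IsUnitaryRep) : T.compress R 1 = 1 := by
  ext1 ξ
  refine ext_inner_left ℂ fun η ↦ ?_
  rw [inner_compress, hR.1]
  rfl

/-- The operators `π(x)` restricted to the isotypic subspace. -/
noncomputable def isotypicEmb (R : HilbRep.{w} G) (x : G) : T.isotypicSubspace R →L[ℂ] R.V :=
  R.act x ∘L (T.isotypicSubspace R).subtypeL

lemma inner_isotypicEmb (hR : R.IsUnitaryRep) (x y : G) (ξ η : T.isotypicSubspace R) :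
    ⟪T.isotypicEmb R x ξ, T.isotypicEmb R y η⟫_ℂ = ⟪ξ, T.heckeAct R (T.gen (x⁻¹ * y)) η⟫_ℂ := by
  rw [heckeAct_gen T hR, inner_compress]
  exact inner_act_act hR x y ξ η

/-- For `f = ∑ c_x x p_σ` the operator of `f* f` is `B* B`, where `B = ∑ c_x π(x)` on the isotypic
subspace. -/
lemma heckeAct_isPositive (hR : R.IsUnitaryRep) (f : ConvAlg T.μ) :
    (T.heckeAct R (T.restrict (rightInnerSelf T.p T.star_p f))).IsPositive := by
  obtain ⟨F, c, hF⟩ := T.exists_restrict_rightInnerSelf_eq_sum f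
  let B : T.isotypicSubspace R →L[ℂ] R.V := ∑ q ∈ F, c q • T.isotypicEmb R q.out
  have : T.heckeAct R (T.restrict (rightInnerSelf T.p T.star_p f)) = B.adjoint ∘L B := by
    ext1 ξ
    refine ext_inner_left ℂ fun η ↦ ?_
    rw [hF, ContinuousLinearMap.comp_apply, adjoint_inner_right]
    simp only [B, map_sum, map_smul, sum_apply, smul_apply, sum_inner, inner_sum,
      inner_smul_left, inner_smul_right, inner_isotypicEmb T hR, Finset.mul_sum]
    rw [Finset.sum_comm]
    refine Finset.sum_congr rfl fun q _ ↦ Finset.sum_congr rfl fun r _ ↦ ?_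
    ring
  rw [this]
  exact isPositive_adjoint_comp_self B

lemma isTotalFamily_isotypicEmb (hR : HilbRep.IsUnitarySmooth.{w} T.σ⁻¹ R) :
    IsTotalFamily (T.isotypicEmb R) := by
  rw [IsTotalFamily, ← hR.2]
  congr 2
  ext v
  constructor
  · rintro ⟨x, ξ, rfl⟩; exact ⟨x, ξ, ξ.2, rfl⟩
  · rintro ⟨x, ξ, hξ, rfl⟩; exact ⟨x, ⟨ξ, hξ⟩, rfl⟩

/-- The compression of smooth representations of `G` to their isotypic subspaces. -/
noncomputable def smoothCompression : HilbRep.Compression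
    (HilbRep.IsUnitarySmooth.{w} T.σ⁻¹) (IsPositiveHeckeRep.{w} T) G where
  space R := T.isotypicSubspace R.obj
  isClosed R := T.isClosed_isotypicSubspace R.obj
  act R := T.heckeAct R.obj
  emb R := T.isotypicEmb R.obj
  gram x y := T.gen (x⁻¹ * y)
  base := 1
  map_mem {R R'} f ξ hξ := T.mem_isotypicSubspace.2 fun h ↦ by
    rw [← HilbRep.toCLM_act, T.mem_isotypicSubspace.1 hξ, map_smul]
  map_act {R R'} f k ξ := by
    have hf : ∀ (x : G) (η : R.obj.V), HilbRep.toCLM f.hom (R.obj.act x η) =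
        R'.obj.act x (HilbRep.toCLM f.hom η) := HilbRep.toCLM_act f.hom
    obtain ⟨s, hs⟩ := T.exists_eq_sum_gen k
    rw [hs]
    simp only [map_sum, map_smul, heckeAct_gen T R.property.1, heckeAct_gen T R'.property.1,
      sum_apply, smul_apply, Submodule.coe_sum, Submodule.coe_smul, coe_compress T R.property.1,
      coe_compress T R'.property.1, hf]
  map_emb f x ξ := HilbRep.toCLM_act f.hom x ξ
  total R := T.isTotalFamily_isotypicEmb R.property
  emb_base R ξ := by
    change R.obj.act 1 (ξ : R.obj.V) = ξ
    rw [R.property.1.1]; rfl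
  inner_emb R x y ξ η := T.inner_isotypicEmb R.property.1 x y ξ η
  intertwine {R R'} A B hA y v := by
    have : A ∘L R.obj.act y = R'.obj.act y ∘L A :=
      (T.isTotalFamily_isotypicEmb R.property).ext fun x ξ ↦ by
        change A (R.obj.act y (R.obj.act x ξ)) = R'.obj.act y (A (T.isotypicEmb R.obj x ξ))
        rw [← act_mul_apply R.property.1, hA]
        refine (hA (y * x) ξ).trans ?_
        exact act_mul_apply R'.property.1 y x _
    exact congrArg (fun C : R.obj.V →L[ℂ] R'.obj.V ↦ C v) this
  property R := by
    have hR := R.property.1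
    refine ⟨⟨fun f g ↦ map_add _ f g, fun c f ↦ map_smul _ c f, T.heckeAct_mul hR,
      T.heckeAct_star hR, ?_⟩, T.heckeAct_isPositive hR⟩
    refine top_le_iff.1 fun ξ _ ↦ subset_closure (Submodule.subset_span ⟨T.gen 1, ξ, ?_⟩)
    change ξ = T.heckeAct R.obj (T.gen 1) ξ
    rw [heckeAct_gen T hR, compress_one T hR]
    rfl

end HeckeTriple

end SmoothRepresentations

/-! ### Dilation of positive representations of the Hecke algebra -/

section Dilation

open CategoryTheory ContinuousLinearMap
open scoped InnerProductSpace ComplexConjugate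

universe w w'

namespace HeckeTriple

variable {G : Type w'} [Group G] (T : HeckeTriple G)

section

variable {W : Type w} [NormedAddCommGroup W] [InnerProductSpace ℂ W] [CompleteSpace W]
  (ρ : T.heckeAlgebra →ₗ[ℂ] (W →L[ℂ] W)) (hmul : ∀ f g, ρ (f * g) = ρ f * ρ g)
  (hstar : ∀ f, ρ (star f) = star (ρ f)) (h1 : ρ (T.gen 1) = 1)

include hmul hstar h1 in
/-- The kernel `(x, y) ↦ ρ(p x⁻¹y p)` of a positive representation of the Hecke algebra is
positive definite. -/
lemma heckeKernel_nonneg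
    (hpos : ∀ a : ConvAlg T.μ, (ρ (T.restrict (rightInnerSelf T.p T.star_p a))).IsPositive)
    (F : Finset G) (ξ : G → W) :
    0 ≤ (∑ x ∈ F, ∑ y ∈ F, ⟪ξ x, ρ (T.gen (x⁻¹ * y)) (ξ y)⟫_ℂ).re := by
  refine matrix_form_nonneg (LinearMap.range ρ) ⟨_, h1⟩ ?_ ?_ (fun x y ↦ ρ (T.gen (x⁻¹ * y)))
    (fun x y ↦ ⟨_, rfl⟩) F ?_ ξ
  · rintro _ ⟨f, rfl⟩ _ ⟨g, rfl⟩; exact ⟨f * g, hmul f g⟩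
  · rintro _ ⟨f, rfl⟩; exact ⟨star f, hstar f⟩
  · intro A ζ hA
    choose a ha using hA
    obtain ⟨f, hf⟩ := T.exists_restrict_rightInnerSelf_eq F (fun x ↦ x) a
    have := (hpos f).re_inner_nonneg_right ζ
    rw [hf] at this
    refine this.trans_eq ?_
    simp only [map_sum, hmul, hstar, ha, sum_apply, inner_sum]
    simp only [Complex.re_sum]
    refine Finset.sum_congr rfl fun x _ ↦ Finset.sum_congr rfl fun y _ ↦ ?_
    rw [mul_apply_eq_comp, mul_apply_eq_comp, star_eq_adjoint, adjoint_inner_right]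
    rfl

include hmul hstar h1 in
/-- A positive representation of the Hecke algebra is dilated to a unitary representation of `G`
that it generates. -/
lemma exists_dilation
    (hpos : ∀ a : ConvAlg T.μ, (ρ (T.restrict (rightInnerSelf T.p T.star_p a))).IsPositive) :
    ∃ (R : HilbRep.{max w' w} G) (e : G → W →L[ℂ] R.V), R.IsUnitaryRep ∧ IsTotalFamily e ∧
      (∀ x y ξ η, ⟪e x ξ, e y η⟫_ℂ = ⟪ξ, ρ (T.gen (x⁻¹ * y)) η⟫_ℂ) ∧
      ∀ x y ξ, R.act x (e y ξ) = e (x * y) ξ := by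
  obtain ⟨V, _, _, _, e, he, heM⟩ := exists_kolmogorov (fun x y : G ↦ ρ (T.gen (x⁻¹ * y)))
    (fun x y ↦ by rw [← hstar, star_gen, mul_inv_rev, inv_inv])
    (T.heckeKernel_nonneg ρ hmul hstar h1 hpos)
  have hinner : ∀ x y ξ η, ⟪e x ξ, e y η⟫_ℂ = ⟪ξ, ρ (T.gen (x⁻¹ * y)) η⟫_ℂ := by
    intro x y ξ η
    rw [← heM x y, ContinuousLinearMap.comp_apply, adjoint_inner_right]
  choose π hπ using fun x : G ↦ he.exists_extension_of_gram_eq (fun y ↦ e (x * y))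
    fun y z ↦ by rw [heM, heM, mul_inv_rev, mul_assoc, inv_mul_cancel_left]
  have hπ1 : π 1 = 1 := he.ext fun y ξ ↦ by rw [hπ, one_mul]; rfl
  have hπm : ∀ x y, π (x * y) = π x * π y := fun x y ↦ he.ext fun z ξ ↦ by
    rw [mul_apply_eq_comp, hπ, hπ, hπ, mul_assoc]
  have hadj : ∀ x, star (π x) = π x⁻¹ := by
    intro x
    refine he.ext fun y ξ ↦ sub_eq_zero.1 (he.eq_zero_of_inner fun z η ↦ ?_)
    rw [inner_sub_right, star_eq_adjoint, adjoint_inner_right, hπ, hπ, hinner, hinner, mul_inv_rev,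
      mul_assoc, sub_self]
  refine ⟨⟨V, π⟩, e, ⟨hπ1, hπm, fun x ↦ Unitary.mem_iff.2 ⟨?_, ?_⟩⟩, he, hinner, hπ⟩
  · rw [hadj, ← hπm, inv_mul_cancel, hπ1]
  · rw [hadj, ← hπm, mul_inv_cancel, hπ1]

variable {ρ} {R : HilbRep.{max w' w} G} {e : G → W →L[ℂ] R.V} (hR : R.IsUnitaryRep)
  (he : IsTotalFamily e) (hinner : ∀ x y ξ η, ⟪e x ξ, e y η⟫_ℂ = ⟪ξ, ρ (T.gen (x⁻¹ * y)) η⟫_ℂ)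
  (hact : ∀ x y ξ, R.act x (e y ξ) = e (x * y) ξ)

include he hinner hact in
lemma dilation_base_mem (ξ : W) : e 1 ξ ∈ T.isotypicSubspace R := by
  refine T.mem_isotypicSubspace.2 fun h ↦ sub_eq_zero.1 (he.eq_zero_of_inner fun z η ↦ ?_)
  rw [hact, inner_sub_right, inner_smul_right, hinner, hinner, mul_one, mul_one, gen_mul_right,
    map_smul, smul_apply, inner_smul_right, sub_self]

include hmul hR he hinner hact in
/-- The compression of the dilation to the range of `e 1` is the original representation. -/
lemma dilation_compress (x : G) (ξ : W) :
    T.compress R x ⟨e 1 ξ, T.dilation_base_mem he hinner hact ξ⟩ =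
      ⟨e 1 (ρ (T.gen x) ξ), T.dilation_base_mem he hinner hact _⟩ := by
  refine Subtype.ext (sub_eq_zero.1 (he.eq_zero_of_inner fun z η ↦ ?_))
  have h2 : ⟪e z η, e 1 (ρ (T.gen x) ξ)⟫_ℂ = ⟪η, ρ (T.gen z⁻¹ * T.gen x) ξ⟫_ℂ := by
    rw [hinner, hmul, mul_one]; rfl
  rw [inner_sub_right, h2, gen_mul_gen, coe_compress T hR]
  simp only [map_smul, map_sum, smul_apply, sum_apply, inner_smul_right, inner_sum, hact, mul_one,
    hinner, mul_assoc, sub_self]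

include hmul h1 hR he hinner hact in
/-- The isotypic subspace of the dilation is the original space: an isotypic vector orthogonal to
`e 1 W` is orthogonal to `π(x) e 1 W` for all `x`, by `dilation_compress`. -/
lemma exists_dilation_base_eq (m : T.isotypicSubspace R) : ∃ ξ, e 1 ξ = (m : R.V) := by
  have h11 : ∀ ξ η, ⟪e 1 ξ, e 1 η⟫_ℂ = ⟪ξ, η⟫_ℂ := fun ξ η ↦ by
    rw [hinner, inv_one, one_mul, h1]; rfl
  refine ⟨(e 1).adjoint m, ?_⟩
  let u : T.isotypicSubspace R :=
    m - ⟨e 1 ((e 1).adjoint m), T.dilation_base_mem he hinner hact _⟩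
  have hu : ∀ ζ, ⟪(u : R.V), e 1 ζ⟫_ℂ = 0 := fun ζ ↦ by
    change ⟪(m : R.V) - e 1 ((e 1).adjoint m), e 1 ζ⟫_ℂ = 0
    rw [inner_sub_left, h11, adjoint_inner_left, sub_self]
  refine (sub_eq_zero.1 ?_).symm
  change (u : R.V) = 0
  refine he.eq_zero_of_inner fun x ξ ↦ ?_
  have := hact x 1 ξ
  rw [mul_one] at this
  rw [← this, ← inner_conj_symm]
  have h3 := T.inner_compress x u ⟨e 1 ξ, T.dilation_base_mem he hinner hact ξ⟩
  rw [T.dilation_compress hmul hR he hinner hact] at h3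
  rw [← h3]
  exact (congrArg _ (hu _)).trans (map_zero _)

end

/-- Every positive representation of the Hecke algebra is the compression of its dilation. -/
lemma exists_smoothCompression_obj_iso (N : PositiveHeckeRep.{max w' w} T) :
    ∃ R, Nonempty ((T.smoothCompression).obj R ≅ N) := by
  obtain ⟨⟨hadd, hsmul, hmul, hstar, hnd⟩, hpos⟩ := N.property
  let ρ : T.heckeAlgebra →ₗ[ℂ] (N.obj.V →L[ℂ] N.obj.V) :=
    { toFun := N.obj.act, map_add' := hadd, map_smul' := hsmul }
  -- The unit of the Hecke algebra acts as the identity, by nondegeneracy.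
  have h1 : ρ (T.gen 1) = 1 := by
    refine ContinuousLinearMap.ext fun v ↦ ?_
    have hv : v ∈ (Submodule.span ℂ {v | ∃ a ξ, v = N.obj.act a ξ}).topologicalClosure :=
      hnd ▸ Submodule.mem_top
    refine Submodule.topologicalClosure_minimal
      (t := LinearMap.eqLocus (ρ (T.gen 1)).toLinearMap LinearMap.id) _ (Submodule.span_le.2 ?_)
      (isClosed_eq (ρ (T.gen 1)).continuous continuous_id) hv
    rintro _ ⟨a, ξ, rfl⟩
    change (N.obj.act (T.gen 1) * N.obj.act a) ξ = N.obj.act a ξ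
    rw [← hmul, gen_one_mul]
  obtain ⟨R, e, hR, he, hinner, hact⟩ := T.exists_dilation ρ hmul hstar h1 hpos
  have hmem := T.dilation_base_mem he hinner hact
  have hsm : HilbRep.IsUnitarySmooth T.σ⁻¹ R := by
    refine ⟨hR, top_le_iff.1 (he ▸ Submodule.topologicalClosure_mono (Submodule.span_mono ?_))⟩
    rintro _ ⟨x, ξ, rfl⟩
    exact ⟨x, e 1 ξ, hmem ξ, by rw [hact, mul_one]⟩
  let U₀ : N.obj.V →ₗᵢ[ℂ] T.isotypicSubspace R :=
    { toFun := fun ξ ↦ ⟨e 1 ξ, hmem ξ⟩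
      map_add' := fun ξ η ↦ Subtype.ext (map_add _ ξ η)
      map_smul' := fun c ξ ↦ Subtype.ext (map_smul _ c ξ)
      norm_map' := fun ξ ↦ by
        change ‖e 1 ξ‖ = ‖ξ‖
        have := hinner 1 1 ξ ξ
        rw [inv_one, one_mul, h1, one_apply_eq_self, inner_self_eq_norm_sq_to_K,
          inner_self_eq_norm_sq_to_K] at this
        exact (sq_eq_sq₀ (norm_nonneg _) (norm_nonneg _)).1 (by exact_mod_cast this) }
  let U : N.obj.V ≃ₗᵢ[ℂ] T.isotypicSubspace R := LinearIsometryEquiv.ofSurjective U₀ fun m ↦ by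
    obtain ⟨ξ, hξ⟩ := T.exists_dilation_base_eq hmul h1 hR he hinner hact m
    exact ⟨ξ, Subtype.ext hξ⟩
  obtain ⟨i⟩ := HilbRep.nonempty_iso (R := N) (S := T.smoothCompression.obj ⟨R, hsm⟩) U
    fun k ξ ↦ by
      change U₀ (ρ k ξ) = T.heckeAct R k (U₀ ξ)
      obtain ⟨s, hs⟩ := T.exists_eq_sum_gen k
      rw [hs]
      simp only [map_sum, map_smul, sum_apply, smul_apply, heckeAct_gen T hR]
      refine Finset.sum_congr rfl fun q _ ↦ ?_
      congr 1
      exact (T.dilation_compress hmul hR he hinner hact _ ξ).symm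
  exact ⟨_, ⟨i.symm⟩⟩

/-- The equivalence between `(H, σ̄)`-smooth representations and positive representations of the
Hecke algebra. -/
lemma exists_smooth_equivalence : ∃ e : SmoothRep.{max w' w} T.σ⁻¹ ≌ PositiveHeckeRep.{max w' w} T,
    e.functor.Additive ∧ e.functor.Linear ℂ ∧ HilbRep.PreservesAdjoints e.functor := by
  obtain ⟨e, he⟩ := T.smoothCompression.exists_equivalence T.exists_smoothCompression_obj_iso
  refine ⟨e, ?_⟩
  rw [he]
  exact ⟨inferInstance, HilbRep.Compression.linear _, HilbRep.Compression.preservesAdjoints _⟩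

end HeckeTriple

end Dilation

/-! ### Complex conjugate representations -/

section ConjugateSpace

open CategoryTheory ContinuousLinearMap
open scoped InnerProductSpace ComplexConjugate

universe w w'

/-- The complex conjugate of a Hilbert space: the same additive group, with the scalar
multiplication `(c, v) ↦ c̄ v` and the inner product `(v, w) ↦ ⟪w, v⟫`. -/
def ConjSpace (V : Type*) : Type _ := V

namespace ConjSpace

variable {V V' : Type*} [NormedAddCommGroup V] [InnerProductSpace ℂ V]
  [NormedAddCommGroup V'] [InnerProductSpace ℂ V']

instance : NormedAddCommGroup (ConjSpace V) := inferInstanceAs (NormedAddCommGroup V)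

/-- The identity, as an additive isomorphism to the conjugate space. -/
def mk : V ≃+ ConjSpace V := AddEquiv.refl V

instance : Module ℂ (ConjSpace V) := Module.compHom V (starRingEnd ℂ)

lemma smul_mk (c : ℂ) (v : V) : c • mk v = mk (conj c • v) := rfl

lemma mk_smul (c : ℂ) (v : V) : mk (c • v) = conj c • mk v := by
  rw [smul_mk, Complex.conj_conj]

noncomputable instance : InnerProductSpace ℂ (ConjSpace V) where
  inner v w := ⟪(mk.symm w : V), mk.symm v⟫_ℂ
  norm_smul_le c v := by
    change ‖conj c • (mk.symm v : V)‖ ≤ ‖c‖ * ‖(mk.symm v : V)‖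
    rw [norm_smul, RCLike.norm_conj]
  norm_sq_eq_re_inner v := norm_sq_eq_re_inner (𝕜 := ℂ) (mk.symm v : V)
  conj_inner_symm v w := inner_conj_symm (𝕜 := ℂ) (mk.symm w : V) (mk.symm v)
  add_left v w x := inner_add_right (𝕜 := ℂ) (mk.symm x : V) (mk.symm v) (mk.symm w)
  smul_left v w c := inner_smul_right (𝕜 := ℂ) (mk.symm w : V) (mk.symm v) (conj c)

instance [CompleteSpace V] : CompleteSpace (ConjSpace V) := inferInstanceAs (CompleteSpace V)

/-- A subspace of the conjugate space, as a subspace of the space. -/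
def unconj (X : Submodule ℂ (ConjSpace V)) : Submodule ℂ V where
  carrier := {v | mk v ∈ X}
  add_mem' ha hb := X.add_mem ha hb
  zero_mem' := X.zero_mem
  smul_mem' c v hv := by
    rw [Set.mem_ofPred_eq, mk_smul]
    exact X.smul_mem _ hv

/-- A bounded operator, as an operator between the conjugate spaces. -/
def map (A : V →L[ℂ] V') : ConjSpace V →L[ℂ] ConjSpace V' where
  toFun v := mk (A (mk.symm v))
  map_add' v w := map_add A (mk.symm v) (mk.symm w)
  map_smul' c v := map_smul A (conj c) (mk.symm v)
  cont := A.continuous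

/-- A bounded operator between conjugate spaces, as an operator between the spaces. -/
def unmap (A : ConjSpace V →L[ℂ] ConjSpace V') : V →L[ℂ] V' where
  toFun v := mk.symm (A (mk v))
  map_add' v w := map_add A (mk v) (mk w)
  map_smul' c v := by
    rw [mk_smul, map_smul, RingHom.id_apply]
    change conj (conj c) • mk.symm (A (mk v)) = _
    rw [Complex.conj_conj]
  cont := A.continuous

lemma map_adjoint [CompleteSpace V] [CompleteSpace V'] (A : V →L[ℂ] V') :
    map A.adjoint = (map A).adjoint := by
  refine (eq_adjoint_iff _ _).2 fun v w ↦ ?_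
  exact adjoint_inner_right A (mk.symm w) (mk.symm v)

/-- A space is the conjugate of its conjugate. -/
def conjConj : ConjSpace (ConjSpace V) ≃ₗᵢ[ℂ] V where
  toFun v := mk.symm (mk.symm v)
  invFun v := mk (mk v)
  left_inv _ := rfl
  right_inv _ := rfl
  map_add' _ _ := rfl
  map_smul' c v := by
    change conj (conj c) • mk.symm (mk.symm v) = c • mk.symm (mk.symm v)
    rw [Complex.conj_conj]
  norm_map' _ := rfl

end ConjSpace

namespace HilbRep

/-- The complex conjugate representation. -/
noncomputable def conjRep {ι : Type w'} (R : HilbRep.{w} ι) : HilbRep.{w} ι where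
  V := ConjSpace R.V
  act i := ConjSpace.map (R.act i)

variable {G : Type w'} [Group G] {H : Subgroup G}

lemma IsUnitarySmooth.conjRep {R : HilbRep.{w} G} {τ τ' : H →* Circle}
    (hτ : ∀ h, (τ' h : ℂ) = conj (τ h : ℂ)) (hR : IsUnitarySmooth.{w} τ R) :
    IsUnitarySmooth.{w} τ' R.conjRep := by
  obtain ⟨⟨h1, hm, hu⟩, hs⟩ := hR
  refine ⟨⟨?_, fun x y ↦ ?_, fun x ↦ ?_⟩, ?_⟩
  · change ConjSpace.map (R.act 1) = _
    rw [h1]; rfl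
  · change ConjSpace.map (R.act (x * y)) = _
    rw [hm]; rfl
  · have hx := Unitary.mem_iff.1 (hu x)
    have h2 : star (ConjSpace.map (R.act x)) = ConjSpace.map (star (R.act x)) :=
      (ConjSpace.map_adjoint (R.act x)).symm
    refine Unitary.mem_iff.2 ⟨?_, ?_⟩
    · change star (ConjSpace.map (R.act x)) * ConjSpace.map (R.act x) = 1
      rw [h2]
      exact congrArg ConjSpace.map hx.1
    · change ConjSpace.map (R.act x) * star (ConjSpace.map (R.act x)) = 1
      rw [h2]
      exact congrArg ConjSpace.map hx.2
  · refine top_le_iff.1 fun v _ ↦ ?_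
    set X := Submodule.span ℂ {v | ∃ x, ∃ ξ ∈ R.conjRep.isotypic τ', v = R.conjRep.act x ξ}
    let Y : Submodule ℂ R.V := ConjSpace.unconj X.topologicalClosure
    have hY : IsClosed (Y : Set R.V) := X.isClosed_topologicalClosure
    have hle : Submodule.span ℂ {v | ∃ x, ∃ ξ ∈ R.isotypic τ, v = R.act x ξ} ≤ Y := by
      rw [Submodule.span_le]
      rintro _ ⟨x, ξ, hξ, rfl⟩
      have hξ' : R.conjRep.act x (ConjSpace.mk ξ) ∈ X :=
        Submodule.subset_span ⟨x, ConjSpace.mk ξ, fun h ↦ ?_, rfl⟩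
      · exact X.le_topologicalClosure hξ'
      change ConjSpace.mk (R.act h ξ) = (τ' h : ℂ) • ConjSpace.mk ξ
      rw [hξ h, ConjSpace.mk_smul, hτ]
    have hv : (ConjSpace.mk.symm v : R.V) ∈
        (Submodule.span ℂ {v | ∃ x, ∃ ξ ∈ R.isotypic τ, v = R.act x ξ}).topologicalClosure := by
      rw [hs]; trivial
    exact Submodule.topologicalClosure_minimal _ hle hY hv

/-- The complex conjugate of a smooth representation. -/
noncomputable def conjObj {τ τ' : H →* Circle} (hτ : ∀ h, (τ' h : ℂ) = conj (τ h : ℂ))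
    (R : (IsUnitarySmooth.{w} τ).FullSubcategory) : (IsUnitarySmooth.{w} τ').FullSubcategory :=
  ⟨R.obj.conjRep, R.property.conjRep hτ⟩

/-- Complex conjugation of smooth representations. -/
noncomputable def conjFunctor {τ τ' : H →* Circle} (hτ : ∀ h, (τ' h : ℂ) = conj (τ h : ℂ)) :
    (IsUnitarySmooth.{w} τ).FullSubcategory ⥤ (IsUnitarySmooth.{w} τ').FullSubcategory where
  obj := conjObj hτ
  map {R S} f := homMk (R := conjObj hτ R) (S := conjObj hτ S)
    (by exact ConjSpace.map (V := R.obj.V) (V' := S.obj.V) (toCLM f.hom))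
    fun i ξ ↦ toCLM_act f.hom i (ConjSpace.mk.symm ξ : R.obj.V)
  map_id _ := rfl
  map_comp _ _ := rfl

/-- Complex conjugation is an equivalence between the `(H, τ)`-smooth and the `(H, τ̄)`-smooth
representations. -/
lemma exists_conj_equivalence {τ τ' : H →* Circle} (hτ : ∀ h, (τ' h : ℂ) = conj (τ h : ℂ)) :
    ∃ e : (IsUnitarySmooth.{w} τ).FullSubcategory ≌ (IsUnitarySmooth.{w} τ').FullSubcategory,
      e.functor.Additive ∧ PreservesAdjoints e.functor := by
  let C := conjFunctor.{w} hτ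
  have hτ' : ∀ h, (τ h : ℂ) = conj (τ' h : ℂ) := fun h ↦ by rw [hτ, Complex.conj_conj]
  have : C.Faithful := ⟨fun {R S f g} h ↦ hom_ext fun ξ ↦
    congrArg (fun k : C.obj R ⟶ C.obj S ↦ toCLM k.hom (ConjSpace.mk (V := R.obj.V) ξ)) h⟩
  have : C.Full := ⟨fun {R S} f ↦ by
    let A : ConjSpace R.obj.V →L[ℂ] ConjSpace S.obj.V := toCLM f.hom
    exact ⟨homMk (R := R) (S := S) (ConjSpace.unmap A)
      fun i ξ ↦ toCLM_act f.hom i (ConjSpace.mk (V := R.obj.V) ξ), rfl⟩⟩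
  have : C.EssSurj := ⟨fun R ↦ ⟨(conjFunctor.{w} hτ').obj R,
    nonempty_iso (R := C.obj ((conjFunctor.{w} hτ').obj R)) (S := R)
      (ConjSpace.conjConj (V := R.obj.V)) fun i ξ ↦ rfl⟩⟩
  have : C.IsEquivalence := {}
  refine ⟨C.asEquivalence, ⟨fun {R S f g} ↦ rfl⟩, fun R S T T' h ↦ ?_⟩
  exact (congrArg ConjSpace.map h).trans (ConjSpace.map_adjoint (toCLM T.hom))

lemma PreservesAdjoints.comp {ι κ ν : Type*} {P : ObjectProperty (HilbRep.{w} ι)}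
    {Q : ObjectProperty (HilbRep.{w} κ)} {Q' : ObjectProperty (HilbRep.{w} ν)}
    {F : P.FullSubcategory ⥤ Q.FullSubcategory} {F' : Q.FullSubcategory ⥤ Q'.FullSubcategory}
    (hF : PreservesAdjoints F) (hF' : PreservesAdjoints F') : PreservesAdjoints (F ⋙ F') :=
  fun R S T T' h ↦ hF' _ _ _ _ (hF R S T T' h)

end HilbRep

end ConjugateSpace

/-! ### Compression of representations of the ideal of a projection -/

section CornerCompression

open CategoryTheory ContinuousLinearMap
open scoped InnerProductSpace

universe w w'

namespace ProjectionCorner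

variable {A : Type w'} [NonUnitalNormedRing A] [StarRing A] [NormedStarGroup A] [NormedSpace ℂ A]
  [IsScalarTower ℂ A A] [SMulCommClass ℂ A A]
  {p : A} (hp : star p = p) (hpp : p * p = p)

include hpp in
lemma mul_corner (b : starCorner p hp) : p * (b : A) = b := by
  obtain ⟨_, a, rfl⟩ := b
  change p * (p * a * p) = p * a * p
  rw [← mul_assoc, ← mul_assoc, hpp]

include hpp in
lemma corner_mul (b : starCorner p hp) : (b : A) * p = b := by
  obtain ⟨_, a, rfl⟩ := b
  change p * a * p * p = p * a * p
  rw [mul_assoc, hpp]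

include hpp in
lemma isClosed_starCorner : IsClosed (starCorner p hp : Set A) := by
  have : (starCorner p hp : Set A) = {x | p * x * p = x} := by
    ext x
    constructor
    · intro hx
      change p * x * p = x
      rw [mul_corner hp hpp ⟨x, hx⟩]
      exact corner_mul hp hpp ⟨x, hx⟩
    · intro hx
      exact ⟨x, hx.symm⟩
  rw [this]
  exact isClosed_eq (by fun_prop) continuous_id

/-- The element `p a* b p` of the corner. -/
def gram (a b : A) : starCorner p hp := ⟨p * (star a * b) * p, _, rfl⟩

lemma star_gram (a b : A) : star (gram hp a b) = gram hp b a := by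
  refine Subtype.ext ?_
  change star (p * (star a * b) * p) = p * (star b * a) * p
  simp only [star_mul, star_star, hp, mul_assoc]

lemma rightInnerSelf_eq_gram (a : A) : rightInnerSelf p hp a = gram hp a a := by
  refine Subtype.ext ?_
  change star (a * p) * (a * p) = p * (star a * a) * p
  simp only [star_mul, hp, mul_assoc]

variable [StarModule ℂ A]

include hp in
lemma star_toCStarEnvelope_eq : star (toCStarEnvelope p) = toCStarEnvelope p := by
  rw [star_toCStarEnvelope, hp]

/-- The closed ideal of the enveloping `C*`-algebra that the projection generates. -/
noncomputable abbrev cornerIdeal : NonUnitalStarSubalgebra ℂ (CStarEnvelope A) :=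
  closedIdeal (toCStarEnvelope p) (star_toCStarEnvelope_eq hp)

lemma isClosed_cornerIdeal : IsClosed (cornerIdeal hp : Set (CStarEnvelope A)) := isClosed_closure

lemma mul_mul_mem_cornerIdeal (x y : CStarEnvelope A) :
    x * toCStarEnvelope p * y ∈ cornerIdeal hp :=
  subset_closure (Submodule.subset_span ⟨x, y, rfl⟩)

/-- The element `ap` of the ideal. It is written as `app`, a product `x p y` with `x, y` in the
`C*`-algebra. -/
noncomputable def idl (a : A) : cornerIdeal hp :=
  ⟨toCStarEnvelope (a * p * p), by
    rw [toCStarEnvelope_mul, toCStarEnvelope_mul]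
    exact mul_mul_mem_cornerIdeal hp _ _⟩

include hpp in
lemma coe_idl (a : A) : (idl hp a : CStarEnvelope A) = toCStarEnvelope (a * p) := by
  change toCStarEnvelope (a * p * p) = _
  rw [mul_assoc, hpp]

include hpp in
lemma idl_mul_idl (a b : A) : idl hp a * idl hp b = idl hp (a * p * b) := by
  refine Subtype.ext ?_
  change (idl hp a : CStarEnvelope A) * idl hp b = _
  rw [coe_idl hp hpp, coe_idl hp hpp, coe_idl hp hpp, ← toCStarEnvelope_mul]
  simp only [mul_assoc]

include hpp in
lemma star_idl_mul_idl (a b : A) : star (idl hp a) * idl hp b = idl hp (gram hp a b) := by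
  refine Subtype.ext ?_
  change star (idl hp a : CStarEnvelope A) * idl hp b = _
  rw [coe_idl hp hpp, coe_idl hp hpp, coe_idl hp hpp, star_toCStarEnvelope, ← toCStarEnvelope_mul]
  change _ = toCStarEnvelope (p * (star a * b) * p * p)
  rw [star_mul, hp]
  simp only [mul_assoc, hpp]

include hpp in
lemma idl_mul_star_idl_mul_idl (a b c : A) :
    idl hp a * star (idl hp b) * idl hp c = idl hp (a * (gram hp b c : A)) := by
  rw [mul_assoc, star_idl_mul_idl hp hpp, idl_mul_idl hp hpp, mul_assoc, mul_corner hp hpp]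

include hpp in
/-- The elements `a p b*` with `a, b ∈ A` are total in the ideal. -/
lemma cornerIdeal_induction (Y : Submodule ℂ (cornerIdeal hp))
    (hY : IsClosed (Y : Set (cornerIdeal hp))) (h : ∀ a b, idl hp a * star (idl hp b) ∈ Y)
    (i : cornerIdeal hp) : i ∈ Y := by
  let Z : Submodule ℂ (CStarEnvelope A) :=
    { carrier := Subtype.val '' (Y : Set (cornerIdeal hp))
      add_mem' := by
        rintro _ _ ⟨x, hx, rfl⟩ ⟨y, hy, rfl⟩; exact ⟨x + y, Y.add_mem hx hy, rfl⟩
      zero_mem' := ⟨0, Y.zero_mem, rfl⟩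
      smul_mem' := by rintro c _ ⟨x, hx, rfl⟩; exact ⟨c • x, Y.smul_mem c hx, rfl⟩ }
  have hZ : IsClosed (Z : Set (CStarEnvelope A)) :=
    (isClosed_cornerIdeal hp).isClosedEmbedding_subtypeVal.isClosedMap _ hY
  have h1 : ∀ a b : A, toCStarEnvelope a * toCStarEnvelope p * toCStarEnvelope b ∈ Z := by
    intro a b
    refine ⟨_, h a (star b), ?_⟩
    change (idl hp a : CStarEnvelope A) * star (idl hp (star b) : CStarEnvelope A) = _
    rw [coe_idl hp hpp, coe_idl hp hpp, star_toCStarEnvelope, ← toCStarEnvelope_mul,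
      ← toCStarEnvelope_mul, ← toCStarEnvelope_mul, star_mul, star_star, hp, ← mul_assoc,
      mul_assoc a p p, hpp]
  have h2 : ∀ x y : CStarEnvelope A, x * toCStarEnvelope p * y ∈ Z := by
    intro x y
    refine denseRange_toCStarEnvelope.induction_on
      (p := fun x ↦ x * toCStarEnvelope p * y ∈ Z) x (hZ.preimage (by fun_prop)) fun a ↦ ?_
    exact denseRange_toCStarEnvelope.induction_on
      (p := fun y ↦ toCStarEnvelope a * toCStarEnvelope p * y ∈ Z) y
      (hZ.preimage (by fun_prop)) (h1 a)
  obtain ⟨j, hj, hji⟩ : (i : CStarEnvelope A) ∈ Z := by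
    refine closure_minimal (s := (Submodule.span ℂ {x | ∃ a b, x = a * toCStarEnvelope p * b} :
      Set (CStarEnvelope A))) (Submodule.span_le.2 ?_) hZ i.2
    rintro _ ⟨x, y, rfl⟩
    exact h2 x y
  rwa [← Subtype.ext hji]

section Representation

variable {hp} {R : HilbRep.{w} (cornerIdeal hp)} (hR : HilbRep.IsNondegStarRep (cornerIdeal hp) R)

include hR in
lemma act_mul_idl (i j : cornerIdeal hp) (ξ : R.V) : R.act (i * j) ξ = R.act i (R.act j ξ) := by
  rw [hR.2.2.1]; rfl

include hR in
/-- Representations of the ideal are norm continuous, being contractive. -/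
lemma continuous_act (ξ : R.V) : Continuous fun i ↦ R.act i ξ := by
  let π : cornerIdeal hp →ₗ[ℂ] (R.V →L[ℂ] R.V) :=
    { toFun := R.act, map_add' := hR.1, map_smul' := hR.2.1 }
  have h : ∀ i, ‖π i‖ ≤ ‖(i : CStarEnvelope A)‖ :=
    norm_starRep_le (isClosed_cornerIdeal hp) π hR.2.2.1 hR.2.2.2.1
  have : Continuous π := AddMonoidHomClass.continuous_of_bound π 1 fun i ↦ by
    rw [one_mul]; exact h i
  exact (ContinuousLinearMap.apply ℂ R.V ξ).continuous.comp this

variable (hp R) in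
/-- The range of the projection `p` in a representation of the ideal. -/
noncomputable def cornerSpace : Submodule ℂ R.V :=
  LinearMap.eqLocus (R.act (idl hp p)).toLinearMap LinearMap.id

lemma mem_cornerSpace {ξ : R.V} : ξ ∈ cornerSpace hp R ↔ R.act (idl hp p) ξ = ξ := Iff.rfl

variable (hp R) in
lemma isClosed_cornerSpace : IsClosed (cornerSpace hp R : Set R.V) :=
  isClosed_eq (R.act (idl hp p)).continuous continuous_id

instance : CompleteSpace (cornerSpace hp R) := (isClosed_cornerSpace hp R).completeSpace_coe

include hR hpp in
lemma act_corner_mem (b : starCorner p hp) (ξ : R.V) : R.act (idl hp b) ξ ∈ cornerSpace hp R := by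
  rw [mem_cornerSpace, ← act_mul_idl hR, idl_mul_idl hp hpp, hpp, mul_corner hp hpp]

/-- The operators of the corner on the range of the projection. -/
noncomputable def cornerAct (b : starCorner p hp) : cornerSpace hp R →L[ℂ] cornerSpace hp R :=
  (R.act (idl hp b) ∘L (cornerSpace hp R).subtypeL).codRestrict _
    fun ξ ↦ act_corner_mem hpp hR b ξ

variable (R) in
/-- The operators `ap`, restricted to the range of the projection. -/
noncomputable def cornerEmb (a : A) : cornerSpace hp R →L[ℂ] R.V :=
  R.act (idl hp a) ∘L (cornerSpace hp R).subtypeL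

lemma cornerEmb_apply (a : A) (ξ : cornerSpace hp R) :
    cornerEmb R a ξ = R.act (idl hp a) ξ := rfl

lemma inner_cornerEmb (a b : A) (ξ η : cornerSpace hp R) :
    ⟪cornerEmb R a ξ, cornerEmb R b η⟫_ℂ = ⟪ξ, cornerAct hpp hR (gram hp a b) η⟫_ℂ := by
  change ⟪R.act (idl hp a) ξ, R.act (idl hp b) η⟫_ℂ =
    ⟪(ξ : R.V), R.act (idl hp (gram hp a b)) η⟫_ℂ
  rw [← star_idl_mul_idl hp hpp, act_mul_idl hR, hR.2.2.2.1, star_eq_adjoint, adjoint_inner_right]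

include hR hpp in
/-- The representation is generated by the range of the projection: `a p b* v` is the image under
`ap` of the vector `p b* v` of the range. -/
lemma isTotalFamily_cornerEmb : IsTotalFamily (cornerEmb (hp := hp) R) := by
  set X := (Submodule.span ℂ {v | ∃ a ξ, v = cornerEmb (hp := hp) R a ξ}).topologicalClosure
    with hX
  have h1 : ∀ (v : R.V) (i : cornerIdeal hp), R.act i v ∈ X := fun v ↦ by
    let L : cornerIdeal hp →ₗ[ℂ] R.V :=
      { toFun := fun i ↦ R.act i v
        map_add' := fun i j ↦ by rw [hR.1]; rfl
        map_smul' := fun c i ↦ by rw [hR.2.1]; rfl }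
    refine cornerIdeal_induction hp hpp (X.comap L)
      ((Submodule.isClosed_topologicalClosure _).preimage (continuous_act hR v)) fun a b ↦ ?_
    change R.act (idl hp a * star (idl hp b)) v ∈ X
    have h2 : R.act (star (idl hp b)) v ∈ cornerSpace hp R := by
      have e : idl hp p * star (idl hp b) = star (idl hp b) := by
        refine Subtype.ext ?_
        change (idl hp p : CStarEnvelope A) * star (idl hp b : CStarEnvelope A) =
          star (idl hp b : CStarEnvelope A)
        rw [coe_idl hp hpp, coe_idl hp hpp, star_toCStarEnvelope, ← toCStarEnvelope_mul, star_mul,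
          hp, ← mul_assoc, hpp, hpp]
      rw [mem_cornerSpace, ← act_mul_idl hR, e]
    rw [act_mul_idl hR]
    exact Submodule.le_topologicalClosure _ (Submodule.subset_span ⟨a, ⟨_, h2⟩, rfl⟩)
  refine top_le_iff.1 ?_
  rw [← hR.2.2.2.2]
  refine Submodule.topologicalClosure_minimal _ (Submodule.span_le.2 ?_)
    (Submodule.isClosed_topologicalClosure _)
  rintro _ ⟨i, v, rfl⟩
  exact h1 v i

include hR hpp in
/-- It suffices to intertwine the elements `a p b*` on the vectors `c p ξ`, where
`(a p b*) (c p)` is again of the form `d p`. -/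
lemma corner_intertwine {R' : HilbRep.{w} (cornerIdeal hp)}
    (hR' : HilbRep.IsNondegStarRep (cornerIdeal hp) R') (B : R.V →L[ℂ] R'.V)
    (C : cornerSpace hp R →L[ℂ] cornerSpace hp R')
    (hB : ∀ a ξ, B (cornerEmb R a ξ) = cornerEmb R' a (C ξ)) (i : cornerIdeal hp) (v : R.V) :
    B (R.act i v) = R'.act i (B v) := by
  have key : ∀ (a : A) (ξ : cornerSpace hp R) (i : cornerIdeal hp),
      B (R.act i (cornerEmb R a ξ)) = R'.act i (B (cornerEmb R a ξ)) := fun a ξ ↦ by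
    let L : cornerIdeal hp →ₗ[ℂ] R'.V :=
      { toFun := fun i ↦ B (R.act i (cornerEmb R a ξ)) - R'.act i (B (cornerEmb R a ξ))
        map_add' := fun i j ↦ by
          rw [hR.1, hR'.1, add_apply, add_apply, map_add]; abel
        map_smul' := fun c i ↦ by
          rw [hR.2.1, hR'.2.1, smul_apply, smul_apply, map_smul, ← smul_sub]; rfl }
    have hL : Continuous L := (B.continuous.comp (continuous_act hR _)).sub (continuous_act hR' _)
    intro i
    refine sub_eq_zero.1 (cornerIdeal_induction hp hpp (LinearMap.ker L)
      (isClosed_singleton.preimage hL) (fun b c ↦ ?_) i)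
    refine sub_eq_zero.2 ?_
    rw [hB, cornerEmb_apply, cornerEmb_apply, ← act_mul_idl hR, ← act_mul_idl hR',
      idl_mul_star_idl_mul_idl hp hpp]
    exact hB _ ξ
  have : B ∘L R.act i = R'.act i ∘L B :=
    (isTotalFamily_cornerEmb hpp hR).ext fun a ξ ↦ key a ξ i
  exact congrArg (fun D : R.V →L[ℂ] R'.V ↦ D v) this

end Representation

/-- The nondegenerate `*`-representations of the corner `pAp` that are positive on the elements
`f* f` with `f` in `Ap`. -/
def IsPositiveRep : ObjectProperty (HilbRep.{w} (starCorner p hp)) := fun R ↦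
  HilbRep.IsNondegStarRep (starCorner p hp) R ∧
    ∀ a : A, (R.act (rightInnerSelf p hp a)).IsPositive

include hpp in
lemma isPositiveRep_compression {R : HilbRep.{w} (cornerIdeal hp)}
    (hR : HilbRep.IsNondegStarRep (cornerIdeal hp) R) :
    IsPositiveRep hp { V := cornerSpace hp R, act := cornerAct hpp hR } := by
  have hadd : ∀ a b : A, idl hp (a + b) = idl hp a + idl hp b := fun a b ↦ Subtype.ext <| by
    change _ = (idl hp a : CStarEnvelope A) + idl hp b
    rw [coe_idl hp hpp, coe_idl hp hpp, coe_idl hp hpp, add_mul, toCStarEnvelope_add]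
  have hsmul : ∀ (c : ℂ) (a : A), idl hp (c • a) = c • idl hp a := fun c a ↦ Subtype.ext <| by
    change _ = c • (idl hp a : CStarEnvelope A)
    rw [coe_idl hp hpp, coe_idl hp hpp, smul_mul_assoc, toCStarEnvelope_smul]
  have hmul : ∀ b c : starCorner p hp, idl hp (b * c : A) = idl hp b * idl hp c := fun b c ↦ by
    rw [idl_mul_idl hp hpp, corner_mul hp hpp]
  have hstar : ∀ b : starCorner p hp, idl hp (star b : A) = star (idl hp b) := fun b ↦
    Subtype.ext <| by
      change _ = star (idl hp b : CStarEnvelope A)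
      rw [coe_idl hp hpp, coe_idl hp hpp, star_toCStarEnvelope, corner_mul hp hpp]
      exact congrArg _ (corner_mul hp hpp (star b))
  refine ⟨⟨fun a b ↦ ?_, fun c a ↦ ?_, fun a b ↦ ?_, fun a ↦ ?_, ?_⟩, fun a ↦ ?_⟩
  · refine ContinuousLinearMap.ext fun ξ ↦ Subtype.ext ?_
    change R.act (idl hp (a + b : A)) ξ = R.act (idl hp a) ξ + R.act (idl hp b) ξ
    rw [hadd, hR.1]; rfl
  · refine ContinuousLinearMap.ext fun ξ ↦ Subtype.ext ?_
    change R.act (idl hp (c • a : A)) ξ = c • R.act (idl hp a) ξ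
    rw [hsmul, hR.2.1]; rfl
  · refine ContinuousLinearMap.ext fun ξ ↦ Subtype.ext ?_
    change R.act (idl hp (a * b : A)) ξ = R.act (idl hp a) (R.act (idl hp b) ξ)
    rw [hmul, act_mul_idl hR]
  · refine (eq_adjoint_iff _ _).2 fun ξ η ↦ ?_
    change ⟪R.act (idl hp (star a : A)) ξ, (η : R.V)⟫_ℂ = ⟪(ξ : R.V), R.act (idl hp a) η⟫_ℂ
    rw [hstar, hR.2.2.2.1, star_eq_adjoint, adjoint_inner_left]
  · refine top_le_iff.1 fun ξ _ ↦ ?_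
    have hξ : ξ = cornerAct hpp hR ⟨p, p, by rw [hpp, hpp]⟩ ξ := Subtype.ext ξ.2.symm
    exact Submodule.le_topologicalClosure _ (Submodule.subset_span ⟨_, ξ, hξ⟩)
  · have : cornerAct hpp hR (rightInnerSelf p hp a) =
        (cornerEmb R a).adjoint ∘L cornerEmb R a := by
      refine ContinuousLinearMap.ext fun ξ ↦ ext_inner_left ℂ fun η ↦ ?_
      rw [rightInnerSelf_eq_gram, ContinuousLinearMap.comp_apply, adjoint_inner_right,
        inner_cornerEmb hpp hR]
    change (cornerAct hpp hR (rightInnerSelf p hp a)).IsPositive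
    rw [this]
    exact isPositive_adjoint_comp_self _

/-- The compression of representations of the ideal generated by a projection to the range of the
projection. -/
noncomputable def compression : HilbRep.Compression
    (HilbRep.IsNondegStarRep.{w} (cornerIdeal hp)) (IsPositiveRep.{w} hp) A where
  space R := cornerSpace hp R.obj
  isClosed R := isClosed_cornerSpace hp R.obj
  act R := cornerAct hpp R.property
  emb R := cornerEmb R.obj
  gram := gram hp
  base := p
  map_mem {R R'} f ξ hξ := by
    rw [mem_cornerSpace, ← HilbRep.toCLM_act, mem_cornerSpace.1 hξ]
  map_act f k ξ := HilbRep.toCLM_act f.hom _ _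
  map_emb f s ξ := HilbRep.toCLM_act f.hom _ _
  total R := isTotalFamily_cornerEmb hpp R.property
  emb_base R ξ := ξ.2
  inner_emb R s t ξ η := inner_cornerEmb hpp R.property s t ξ η
  intertwine {R R'} B C hB i v := corner_intertwine hpp R.property R'.property B C hB i v
  property R := isPositiveRep_compression hp hpp R.property

end ProjectionCorner

end CornerCompression

/-! ### Dilation of positive representations of the corner -/

section CornerDilation

open CategoryTheory ContinuousLinearMap
open scoped InnerProductSpace

universe w w'

namespace ProjectionCorner

variable {A : Type w'} [NonUnitalNormedRing A] [StarRing A] [NormedStarGroup A] [NormedSpace ℂ A]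
  [IsScalarTower ℂ A A] [SMulCommClass ℂ A A] [StarModule ℂ A] [CompleteSpace A]
  {p : A} (hp : star p = p) (hpp : p * p = p)

/-- The projection, as an element of the corner. -/
def unit : starCorner p hp := ⟨p, p, by rw [hpp, hpp]⟩

lemma gram_add_right (a b c : A) : gram hp a (b + c) = gram hp a b + gram hp a c :=
  Subtype.ext <| by
    change p * (star a * (b + c)) * p = p * (star a * b) * p + p * (star a * c) * p
    rw [mul_add, mul_add, add_mul]

lemma gram_smul_right (a b : A) (c : ℂ) : gram hp a (c • b) = c • gram hp a b :=
  Subtype.ext <| by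
    change p * (star a * (c • b)) * p = c • (p * (star a * b) * p)
    rw [mul_smul_comm, mul_smul_comm, smul_mul_assoc]

include hpp in
lemma gram_mul_p (a b : A) : gram hp a (b * p) = gram hp a b :=
  Subtype.ext <| by
    change p * (star a * (b * p)) * p = p * (star a * b) * p
    simp only [mul_assoc, hpp]

include hpp in
lemma gram_mul_corner (a b : A) (c : starCorner p hp) :
    gram hp a (b * c) = gram hp a b * c :=
  Subtype.ext <| by
    change p * (star a * (b * c)) * p = p * (star a * b) * p * c
    rw [mul_assoc _ p, mul_corner hp hpp, ← mul_assoc (star a), ← mul_assoc p, mul_assoc _ _ p,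
      corner_mul hp hpp]

lemma gram_mul_left (a b c : A) : gram hp (a * b) c = gram hp b (star a * c) :=
  Subtype.ext <| by
    change p * (star (a * b) * c) * p = p * (star b * (star a * c)) * p
    rw [star_mul, mul_assoc (star b)]

include hpp in
/-- The elements `∑ cᵢ* (p aᵢ* aⱼ p) cⱼ` are of the form `f* f`, for `f = ∑ aᵢ cᵢ`. -/
lemma rightInnerSelf_sum (F : Finset A) (c : A → starCorner p hp) :
    rightInnerSelf p hp (∑ a ∈ F, a * c a) =
      ∑ a ∈ F, ∑ b ∈ F, star (c a) * gram hp a b * c b := by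
  refine Subtype.ext ?_
  change star ((∑ a ∈ F, a * (c a : A)) * p) * ((∑ a ∈ F, a * (c a : A)) * p) = _
  simp only [Finset.sum_mul, mul_assoc, corner_mul hp hpp, star_sum, Finset.mul_sum,
    AddSubmonoidClass.coe_finsetSum]
  rw [Finset.sum_comm]
  refine Finset.sum_congr rfl fun a _ ↦ Finset.sum_congr rfl fun b _ ↦ ?_
  change star (a * (c a : A)) * (b * c b) =
    star (c a : A) * (p * (star a * b) * p * c b)
  have h1 : star (c a : A) * p = star (c a : A) := by
    have := congrArg star (mul_corner hp hpp (c a))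
    rwa [star_mul, hp] at this
  rw [mul_assoc _ p, mul_corner hp hpp, star_mul, ← mul_assoc, ← mul_assoc, ← mul_assoc, h1]
  simp only [mul_assoc]

section

variable {W : Type w} [NormedAddCommGroup W] [InnerProductSpace ℂ W] [CompleteSpace W]
  (ρ : starCorner p hp →ₗ[ℂ] (W →L[ℂ] W)) (hmul : ∀ f g, ρ (f * g) = ρ f * ρ g)
  (hstar : ∀ f, ρ (star f) = star (ρ f)) (h1 : ρ (unit hp hpp) = 1)

include hmul hstar h1 in
/-- The kernel `(a, b) ↦ ρ(p a* b p)` of a positive representation of the corner is positive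
definite. -/
lemma cornerKernel_nonneg (hpos : ∀ a : A, (ρ (rightInnerSelf p hp a)).IsPositive)
    (F : Finset A) (ξ : A → W) :
    0 ≤ (∑ a ∈ F, ∑ b ∈ F, ⟪ξ a, ρ (gram hp a b) (ξ b)⟫_ℂ).re := by
  refine matrix_form_nonneg (LinearMap.range ρ) ⟨_, h1⟩ ?_ ?_ (fun a b ↦ ρ (gram hp a b))
    (fun a b ↦ ⟨_, rfl⟩) F ?_ ξ
  · rintro _ ⟨f, rfl⟩ _ ⟨g, rfl⟩; exact ⟨f * g, hmul f g⟩
  · rintro _ ⟨f, rfl⟩; exact ⟨star f, hstar f⟩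
  · intro B ζ hB
    choose c hc using hB
    have := (hpos (∑ a ∈ F, a * c a)).re_inner_nonneg_right ζ
    rw [rightInnerSelf_sum hp hpp] at this
    refine this.trans_eq ?_
    simp only [map_sum, hmul, hstar, hc, sum_apply, inner_sum, Complex.re_sum]
    refine Finset.sum_congr rfl fun x _ ↦ Finset.sum_congr rfl fun y _ ↦ ?_
    rw [mul_apply_eq_comp, mul_apply_eq_comp, star_eq_adjoint, adjoint_inner_right]
    rfl

section Family

variable {V : Type*} [NormedAddCommGroup V] [InnerProductSpace ℂ V] [CompleteSpace V]
  {ρ} {e : A → W →L[ℂ] V} (he : IsTotalFamily e)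
  (hinner : ∀ a b ξ η, ⟪e a ξ, e b η⟫_ℂ = ⟪ξ, ρ (gram hp a b) η⟫_ℂ)

include he hinner in
/-- Vectors of the generating family are equal if their inner products with the family are. -/
lemma family_eq {b c : A} {ξ η : W} (h : ∀ a, ρ (gram hp a b) ξ = ρ (gram hp a c) η) :
    e b ξ = e c η :=
  sub_eq_zero.1 (he.eq_zero_of_inner fun a ζ ↦ by
    rw [inner_sub_right, hinner, hinner, h, sub_self])

include he hinner in
lemma family_add (b c : A) (ξ : W) : e (b + c) ξ = e b ξ + e c ξ :=
  sub_eq_zero.1 (he.eq_zero_of_inner fun a ζ ↦ by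
    rw [inner_sub_right, inner_add_right, hinner, hinner, hinner, gram_add_right, map_add,
      add_apply, inner_add_right, sub_self])

include he hinner in
lemma family_smul (c : ℂ) (b : A) (ξ : W) : e (c • b) ξ = c • e b ξ :=
  sub_eq_zero.1 (he.eq_zero_of_inner fun a ζ ↦ by
    rw [inner_sub_right, inner_smul_right, hinner, hinner, gram_smul_right, map_smul,
      smul_apply, inner_smul_right, sub_self])

include hpp he hinner in
lemma family_mul_p (b : A) (ξ : W) : e (b * p) ξ = e b ξ :=
  family_eq hp he hinner fun a ↦ by rw [gram_mul_p hp hpp]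

include hpp hmul he hinner in
lemma family_mul_corner (b : A) (c : starCorner p hp) (ξ : W) : e (b * c) ξ = e b (ρ c ξ) :=
  family_eq hp he hinner fun a ↦ by rw [gram_mul_corner hp hpp, hmul]; rfl

include hpp hmul hstar hinner in
lemma norm_family_le (a : A) (ξ : W) : ‖e a ξ‖ ≤ ‖p‖ * ‖a‖ * ‖ξ‖ := by
  have h2 : ‖ρ (gram hp a a)‖ ≤ (‖p‖ * ‖a‖) ^ 2 := by
    refine (norm_starRep_le (isClosed_starCorner hp hpp) ρ hmul hstar _).trans ?_
    change ‖p * (star a * a) * p‖ ≤ _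
    calc ‖p * (star a * a) * p‖ ≤ ‖p‖ * (‖star a‖ * ‖a‖) * ‖p‖ := by
          refine (norm_mul_le _ _).trans (mul_le_mul_of_nonneg_right ?_ (norm_nonneg _))
          exact (norm_mul_le _ _).trans
            (mul_le_mul_of_nonneg_left (norm_mul_le _ _) (norm_nonneg _))
      _ = (‖p‖ * ‖a‖) ^ 2 := by rw [norm_star]; ring
  refine le_of_sq_le_sq ?_ (by positivity)
  have h3 : ‖e a ξ‖ ^ 2 = ‖⟪ξ, ρ (gram hp a a) ξ⟫_ℂ‖ := by
    rw [← hinner, inner_self_eq_norm_sq_to_K]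
    simp
  rw [h3, mul_pow]
  calc ‖⟪ξ, ρ (gram hp a a) ξ⟫_ℂ‖ ≤ ‖ξ‖ * ‖ρ (gram hp a a) ξ‖ := norm_inner_le_norm _ _
    _ ≤ ‖ξ‖ * ((‖p‖ * ‖a‖) ^ 2 * ‖ξ‖) :=
      mul_le_mul_of_nonneg_left ((le_opNorm _ _).trans
        (mul_le_mul_of_nonneg_right h2 (norm_nonneg _))) (norm_nonneg _)
    _ = _ := by ring

include hpp hmul hstar hinner in
/-- Left multiplication by `a` is bounded by `‖a‖`: the norms of `u(c) = ∑ e(cs) ξ(s)` satisfy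
`‖u(c)‖² ≤ ‖v‖ ‖u(c* c)‖` with `v = ∑ e(s) ξ(s)`, and grow at most linearly in `‖c‖`. -/
lemma norm_sum_mul_le (a : A) (F : Finset A) (ξ : A → W) :
    ‖∑ s ∈ F, e (a * s) (ξ s)‖ ≤ ‖a‖ * ‖∑ s ∈ F, e s (ξ s)‖ := by
  set v := ∑ s ∈ F, e s (ξ s) with hv
  let u : A → V := fun c ↦ ∑ s ∈ F, e (c * s) (ξ s)
  have hu : ∀ c, ‖u c‖ ^ 2 ≤ ‖v‖ * ‖u (star c * c)‖ := by
    intro c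
    have h2 : ⟪u c, u c⟫_ℂ = ⟪v, u (star c * c)⟫_ℂ := by
      simp only [u, hv, sum_inner, inner_sum, hinner, gram_mul_left, ← mul_assoc]
    have h3 : ‖u c‖ ^ 2 = ‖⟪v, u (star c * c)⟫_ℂ‖ := by
      rw [← h2, inner_self_eq_norm_sq_to_K]
      simp
    rw [h3]
    exact norm_inner_le_norm _ _
  let M : ℝ := ∑ s ∈ F, ‖p‖ * ‖s‖ * ‖ξ s‖
  have hM0 : 0 ≤ M := Finset.sum_nonneg fun s _ ↦ by positivity
  have hM : ∀ c, ‖u c‖ ≤ M * ‖c‖ := by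
    intro c
    rw [Finset.sum_mul]
    refine norm_sum_le_of_le _ fun s _ ↦ ?_
    refine (norm_family_le hp hpp hmul hstar hinner _ _).trans ?_
    calc ‖p‖ * ‖c * s‖ * ‖ξ s‖ ≤ ‖p‖ * (‖c‖ * ‖s‖) * ‖ξ s‖ := by
          gcongr; exact norm_mul_le _ _
      _ = _ := by ring
  -- `c n = (a* a) ^ 2ⁿ`
  let c : ℕ → A := fun n ↦ Nat.rec (star a * a) (fun _ b ↦ b * b) n
  have hc : ∀ n, star (c n) = c n := by
    intro n
    induction n with
    | zero => change star (star a * a) = star a * a; rw [star_mul, star_star]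
    | succ n ih => change star (c n * c n) = c n * c n; rw [star_mul, ih]
  have hcn : ∀ n, ‖c n‖ ≤ ‖star a * a‖ ^ 2 ^ n := by
    intro n
    induction n with
    | zero => rw [pow_zero, pow_one]; rfl
    | succ n ih =>
      rw [pow_succ, pow_mul, sq]
      exact (norm_mul_le _ _).trans (mul_le_mul ih ih (norm_nonneg _) (by positivity))
  have h4 : ‖u (c 0)‖ ≤ ‖v‖ * ‖star a * a‖ :=
    le_mul_of_sq_le_mul (x := fun n ↦ ‖u (c n)‖) (norm_nonneg v) (norm_nonneg _)
      (fun n ↦ by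
        have := hu (c n)
        rw [hc] at this
        exact this)
      (fun n ↦ (hM _).trans (mul_le_mul_of_nonneg_left (hcn n) hM0))
  change ‖u a‖ ≤ _
  refine le_of_sq_le_sq ?_ (by positivity)
  calc ‖u a‖ ^ 2 ≤ ‖v‖ * ‖u (c 0)‖ := hu a
    _ ≤ ‖v‖ * (‖v‖ * ‖star a * a‖) := mul_le_mul_of_nonneg_left h4 (norm_nonneg _)
    _ ≤ ‖v‖ * (‖v‖ * (‖a‖ * ‖a‖)) := by
      gcongr
      exact (norm_mul_le _ _).trans_eq (by rw [norm_star])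
    _ = _ := by ring

end Family

include hmul hstar h1 in
/-- A positive representation of the corner is dilated to a representation of the enveloping
`C*`-algebra that it generates. -/
lemma exists_dilation (hpos : ∀ a : A, (ρ (rightInnerSelf p hp a)).IsPositive) :
    ∃ (V : Type max w' w) (_ : NormedAddCommGroup V) (_ : InnerProductSpace ℂ V)
      (_ : CompleteSpace V) (e : A → W →L[ℂ] V) (π : CStarEnvelope A →L[ℂ] (V →L[ℂ] V)),
      IsTotalFamily e ∧ (∀ a b ξ η, ⟪e a ξ, e b η⟫_ℂ = ⟪ξ, ρ (gram hp a b) η⟫_ℂ) ∧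
      (∀ x y, π (x * y) = π x * π y) ∧ (∀ x, π (star x) = star (π x)) ∧
      ∀ a b ξ, π (toCStarEnvelope a) (e b ξ) = e (a * b) ξ := by
  obtain ⟨V, _, _, _, e, he, heM⟩ := exists_kolmogorov (fun a b : A ↦ ρ (gram hp a b))
    (fun a b ↦ by rw [← hstar, star_gram])
    (cornerKernel_nonneg hp hpp ρ hmul hstar h1 hpos)
  have hinner : ∀ a b ξ η, ⟪e a ξ, e b η⟫_ℂ = ⟪ξ, ρ (gram hp a b) η⟫_ℂ := by
    intro a b ξ η
    rw [← heM a b, ContinuousLinearMap.comp_apply, adjoint_inner_right]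
  choose π hπle hπ using fun a : A ↦ he.exists_extension (fun b ↦ e (a * b)) (norm_nonneg a)
    (norm_sum_mul_le hp hpp hmul hstar hinner a)
  let π₀ : A →ₗ[ℂ] (V →L[ℂ] V) :=
    { toFun := π
      map_add' := fun a b ↦ he.ext fun c ξ ↦ by
        rw [add_apply, hπ, hπ, hπ, add_mul, family_add hp he hinner]
      map_smul' := fun t a ↦ he.ext fun c ξ ↦ by
        rw [RingHom.id_apply, smul_apply, hπ, hπ, smul_mul_assoc, family_smul hp he hinner] }
  obtain ⟨π', h1', h2', h3'⟩ := exists_extension_envelope π₀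
    (fun a b ↦ he.ext fun c ξ ↦ by
      change π (a * b) (e c ξ) = π a (π b (e c ξ))
      rw [hπ, hπ, hπ, mul_assoc])
    (fun a ↦ he.ext fun c ξ ↦ sub_eq_zero.1 (he.eq_zero_of_inner fun b η ↦ by
      change ⟪e b η, π (star a) (e c ξ) - star (π a) (e c ξ)⟫_ℂ = 0
      rw [inner_sub_right, star_eq_adjoint, adjoint_inner_right, hπ, hπ, hinner, hinner,
        gram_mul_left, sub_self]))
    hπle
  refine ⟨V, _, _, _, e, π', he, hinner, h2', h3', fun a b ξ ↦ ?_⟩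
  rw [h1']
  exact hπ a b ξ

end

/-- Every positive representation of the corner is the compression of its dilation. -/
lemma exists_compression_obj_iso (N : (IsPositiveRep.{max w' w} hp).FullSubcategory) :
    ∃ R, Nonempty ((compression hp hpp).obj R ≅ N) := by
  obtain ⟨⟨hadd, hsmul, hmul, hstar, hnd⟩, hpos⟩ := N.property
  let ρ : starCorner p hp →ₗ[ℂ] (N.obj.V →L[ℂ] N.obj.V) :=
    { toFun := N.obj.act, map_add' := hadd, map_smul' := hsmul }
  -- The projection acts as the identity, by nondegeneracy.
  have h1 : ρ (unit hp hpp) = 1 := by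
    refine ContinuousLinearMap.ext fun v ↦ ?_
    have hv : v ∈ (Submodule.span ℂ {v | ∃ a ξ, v = N.obj.act a ξ}).topologicalClosure :=
      hnd ▸ Submodule.mem_top
    refine Submodule.topologicalClosure_minimal
      (t := LinearMap.eqLocus (ρ (unit hp hpp)).toLinearMap LinearMap.id) _
      (Submodule.span_le.2 ?_) (isClosed_eq (ρ (unit hp hpp)).continuous continuous_id) hv
    rintro _ ⟨a, ξ, rfl⟩
    change (N.obj.act (unit hp hpp) * N.obj.act a) ξ = N.obj.act a ξ
    rw [← hmul]
    congr 2
    exact Subtype.ext (mul_corner hp hpp a)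
  obtain ⟨V, _, _, _, e, π, he, hinner, hπmul, hπstar, hπ⟩ :=
    exists_dilation hp hpp ρ hmul hstar h1 hpos
  let R₀ : HilbRep.{max w' w} (cornerIdeal hp) := ⟨V, fun i ↦ π i⟩
  have hact : ∀ a b ξ, R₀.act (idl hp a) (e b ξ) = e (a * p * b) ξ := fun a b ξ ↦ by
    change π (idl hp a : CStarEnvelope A) (e b ξ) = _
    rw [coe_idl hp hpp, hπ]
  have hact' : ∀ a ξ, R₀.act (idl hp a) (e p ξ) = e a ξ := fun a ξ ↦ by
    rw [hact, mul_assoc, hpp, family_mul_p hp hpp he hinner]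
  have hcorner : ∀ (b : starCorner p hp) ξ, e (b : A) ξ = e p (ρ b ξ) := fun b ξ ↦ by
    rw [← family_mul_corner hp hpp hmul he hinner, mul_corner hp hpp]
  have hR₀ : HilbRep.IsNondegStarRep (cornerIdeal hp) R₀ := by
    refine ⟨fun a b ↦ map_add π _ _, fun c a ↦ map_smul π c _, fun a b ↦ hπmul _ _,
      fun a ↦ hπstar _, ?_⟩
    refine top_le_iff.1 (he ▸ Submodule.topologicalClosure_mono (Submodule.span_mono ?_))
    rintro _ ⟨a, ξ, rfl⟩
    exact ⟨idl hp a, e p ξ, (hact' a ξ).symm⟩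
  let U₀ : N.obj.V →ₗᵢ[ℂ] V :=
    { toLinearMap := (e p).toLinearMap
      norm_map' := fun ξ ↦ by
        change ‖e p ξ‖ = ‖ξ‖
        have := hinner p p ξ ξ
        have e1 : gram hp p p = unit hp hpp := Subtype.ext (by
          change p * (star p * p) * p = p
          rw [hp, hpp, hpp, hpp])
        rw [e1, h1, one_apply_eq_self, inner_self_eq_norm_sq_to_K,
          inner_self_eq_norm_sq_to_K] at this
        exact (sq_eq_sq₀ (norm_nonneg _) (norm_nonneg _)).1 (by exact_mod_cast this) }
  have hmem : ∀ ξ, e p ξ ∈ cornerSpace hp R₀ := fun ξ ↦ hact' p ξ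
  let U₁ : N.obj.V →ₗᵢ[ℂ] cornerSpace hp R₀ :=
    { toFun := fun ξ ↦ ⟨e p ξ, hmem ξ⟩
      map_add' := fun ξ η ↦ Subtype.ext (map_add _ ξ η)
      map_smul' := fun c ξ ↦ Subtype.ext (map_smul _ c ξ)
      norm_map' := U₀.norm_map }
  have hsurj : Function.Surjective U₁ := by
    intro m
    have hcl : IsClosed (LinearMap.range U₀.toLinearMap : Set V) :=
      U₀.isometry.isClosedEmbedding.isClosed_range
    have h2 := he.induction ((LinearMap.range U₀.toLinearMap).comap
      (R₀.act (idl hp p)).toLinearMap) (hcl.preimage (R₀.act (idl hp p)).continuous)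
      (fun a ξ ↦ by
        change R₀.act (idl hp p) (e a ξ) ∈ LinearMap.range U₀.toLinearMap
        have e1 : e (p * p * a) ξ = e (p * a * p : A) ξ := by
          rw [family_mul_p hp hpp he hinner, hpp]
        rw [hact, e1, hcorner ⟨p * a * p, a, rfl⟩]
        exact ⟨_, rfl⟩) m
    obtain ⟨ξ, hξ⟩ := h2
    refine ⟨ξ, Subtype.ext ?_⟩
    exact hξ.trans m.2
  obtain ⟨i⟩ := HilbRep.nonempty_iso (R := N) (S := (compression hp hpp).obj ⟨R₀, hR₀⟩)
    (LinearIsometryEquiv.ofSurjective U₁ hsurj) fun b ξ ↦ Subtype.ext <| by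
      change e p (ρ b ξ) = R₀.act (idl hp b) (e p ξ)
      rw [hact', hcorner]
  exact ⟨_, ⟨i.symm⟩⟩

include hpp in
/-- The equivalence between representations of the ideal generated by a projection and positive
representations of the corner. -/
lemma exists_equivalence :
    ∃ E : (HilbRep.IsNondegStarRep.{max w' w} (cornerIdeal hp)).FullSubcategory ≌
        (IsPositiveRep.{max w' w} hp).FullSubcategory,
      E.functor.Additive ∧ E.functor.Linear ℂ ∧ HilbRep.PreservesAdjoints E.functor := by
  obtain ⟨E, hE⟩ := (compression hp hpp).exists_equivalence (exists_compression_obj_iso hp hpp)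
  refine ⟨E, ?_⟩
  rw [hE]
  exact ⟨inferInstance, HilbRep.Compression.linear _, HilbRep.Compression.preservesAdjoints _⟩

end ProjectionCorner

end CornerDilation

theorem corollary5p5 {G : Type u} [Group G] (T : HeckeTriple G) (hT : T.IsReduced) :
    (∃ e : HeckeTriple.SmoothRep.{max u v} T.σ ≌ HeckeTriple.PositiveHeckeRep.{max u v} T,
        e.functor.Additive ∧ HilbRep.PreservesAdjoints e.functor) ∧
    (∃ e : HeckeTriple.SmoothRep.{max u v} T.σ⁻¹ ≌ HeckeTriple.PositiveHeckeRep.{max u v} T,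
        e.functor.Additive ∧ e.functor.Linear ℂ ∧ HilbRep.PreservesAdjoints e.functor) ∧
    (∃ e : HeckeTriple.IdealRep.{max u v} T ≌ HeckeTriple.PositiveCornerRep.{max u v} T,
        e.functor.Additive ∧ e.functor.Linear ℂ ∧ HilbRep.PreservesAdjoints e.functor) := by
  obtain ⟨e, h1, h2, h3⟩ := HeckeTriple.exists_smooth_equivalence.{v} T
  refine ⟨?_, ⟨e, h1, h2, h3⟩, ?_⟩
  · obtain ⟨c, h4, h5⟩ := HilbRep.exists_conj_equivalence.{max u v} (τ := T.σ) (τ' := T.σ⁻¹)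
      fun h ↦ by rw [MonoidHom.inv_apply, Circle.coe_inv_eq_conj]
    exact ⟨c.trans e, (inferInstance : (c.functor ⋙ e.functor).Additive), h5.comp h3⟩
  · have hpp : T.pL1 * T.pL1 = T.pL1 := by
      rw [HeckeTriple.pL1, ← StarCompletion.of_mul, HeckeTriple.p_mul_p]
    exact ProjectionCorner.exists_equivalence.{v} T.star_pL1 hpp
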